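/- Let $\mathbb T=\mathbb R/2\pi\mathbb Z$, with $|y-z|$ denoting the distance on $\mathbb T$. Let $N\in\mathbb N$, $\sigma_\sharp\in(0,1)$ and let $b\in C^{N+2}(\mathbb T;\mathbb R)$ satisfy $\|b\|_{C^{N+2}}\le\sigma_\sharp^{-1}$. Assume that $b$ has finitely many critical points $\gamma_j$, that $|\gamma_j-\gamma_l|\ge 4\sigma_\sharp$ for $j\ne l$, and that for each $j$ there is $k\le N$ with $b^{(k+1)}(\gamma_j)\ne0$. A critical point $\gamma$ has order $m\ge1$ if $b^{(j)}(\gamma)=0$ for $1\le j\le m$ and $b^{(m+1)}(\gamma)\neq 0$. For $\varepsilon,\sigma_0>0$ define $$|B'(y)|:=\begin{cases}2\sigma_0\big(|y-\gamma_j|^m+\varepsilon^{\frac m{m+3}}\big)& |y-\gamma_j|\le\sigma_\sharp,\ \gamma_j\text{ a critical point of order }m,\\ 2\sigma_0|b'(y)|& |y-\gamma_j|\ge2\sigma_\sharp\text{ for every critical point }\gamma_j,\\ \text{linear interpolation in } y&\text{otherwise,}\end{cases}$$ and, for $\alpha\ge0$, $\lambda\in\mathbb R$, $y,z\in\mathbb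 T$, $$A(z):=\frac{\varepsilon^{-1/2}}{(\alpha+\varepsilon^{1/3}|B'(z)|^{2/3}+|b(z)-\lambda|)^{1/2}},$$ $$\frac1{L(y,z,\lambda)}:=\begin{cases}\dfrac{(\alpha+\varepsilon^{1/3}|B'(y)|^{2/3}+\varepsilon^{1/3}|B'(z)|^{2/3}+|b(y)-\lambda|+|b(z)-\lambda|)^{1/2}}{\varepsilon^{1/2}}&|y-z|<\sigma_\sharp,\\[2mm] \dfrac{(\alpha+\sigma_\sharp)^{1/2}}{\varepsilon^{1/2}}&\text{otherwise.}\end{cases}$$ **Proposition 2.1.** There exist $\varepsilon_0,c_0,C>0$ and $\sigma_0\in(0,1)$, depending only on $b$, $N$ and $\sigma_\sharp$, such that for all $\varepsilon\in(0,\varepsilon_0)$, $\alpha\ge0$, $\lambda\in\mathbb R$ and $z\in\mathbb T$ the following holds. If a continuous function $K(\cdot,z,\lambda):\mathbb T\to\mathbb C$ solves, in the sense of distributions on $\mathbb T$, $$-\varepsilon\partial_y^2K+\alpha K-\sigma_0\varepsilon^{\frac{N+1}{N+3}}K+i(b(y)-\lambda)K=\delta(y-z),$$ then $$|K(z,z,\lambda)|\le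 C\,A(z),\qquad |K(y,z,\lambda)|\le C\,A(z)\,e^{-c_0\frac{|y-z|}{L(y,z,\lambda)}}\quad(y\in\mathbb T),$$ and, for every $y\ne z$, $K(\cdot,z,\lambda)$ is differentiable at $y$ with $$|\partial_yK(y,z,\lambda)|\le C\,\varepsilon^{-1}e^{-c_0\frac{|y-z|}{L(y,z,\lambda)}}.$$ -/

import Mathlib

open scoped ContDiff

noncomputable section

/-- The distance on the torus `𝕋 = ℝ / 2πℤ` between the classes of two real numbers. Functions on
`𝕋` are represented below by `2π`-periodic functions on `ℝ`. -/
def torusDist (y z : ℝ) : ℝ := ‖((y - z : ℝ) : AddCircle (2 * Real.pi))‖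

/-- `γ` is a critical point of `b` of order `m`:
`b^{(j)}(γ) = 0` for `1 ≤ j ≤ m` and `b^{(m+1)}(γ) ≠ 0`, where `m ≥ 1`. -/
def IsCriticalPointOfOrder (b : ℝ → ℝ) (γ : ℝ) (m : ℕ) : Prop :=
  1 ≤ m ∧ (∀ j : ℕ, 1 ≤ j → j ≤ m → iteratedDeriv j b γ = 0) ∧ iteratedDeriv (m + 1) b γ ≠ 0

/-- The standing assumptions on the shear profile `b : 𝕋 → ℝ`, with parameters `σs = σ_♯` and `N`.
The `C^{N+2}` norm is the maximum of the sup norms of the derivatives of order at most `N + 2`. -/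
structure ShearAssumption (b : ℝ → ℝ) (σs : ℝ) (N : ℕ) : Prop where
  pos : 0 < σs
  lt_one : σs < 1
  periodic : Function.Periodic b (2 * Real.pi)
  contDiff : ContDiff ℝ (N + 2 : ℕ) b
  norm_le : ∀ j : ℕ, j ≤ N + 2 → ∀ y : ℝ, |iteratedDeriv j b y| ≤ σs⁻¹
  finite_critical : {γ : ℝ | γ ∈ Set.Ico 0 (2 * Real.pi) ∧ deriv b γ = 0}.Finite
  order_le : ∀ γ : ℝ, deriv b γ = 0 → ∃ k : ℕ, k ≤ N ∧ iteratedDeriv (k + 1) b γ ≠ 0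
  separated : ∀ γ γ' : ℝ, deriv b γ = 0 → deriv b γ' = 0 → torusDist γ γ' ≠ 0 →
    4 * σs ≤ torusDist γ γ'

/-- `2σ₀ (r^m + ε^{m/(m+3)})`: the regularized shear at distance `r` from a critical point of
order `m`. -/
def innerShear (σ₀ ε : ℝ) (m : ℕ) (r : ℝ) : ℝ :=
  2 * σ₀ * (r ^ m + ε ^ ((m : ℝ) / ((m : ℝ) + 3)))

open Classical in
/-- The regularized shear `|B'(y)|`. Critical points are taken in `ℝ` (with all their translates by
`2πℤ`). Under `ShearAssumption` at most one critical point `γ` has `|y - γ| < 2σ_♯`, so the choice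
below is no choice. In the annulus `σ_♯ < |y - γ| < 2σ_♯` the function interpolates linearly
between its values at the points `γ ± σ_♯` and `γ ± 2σ_♯` on the side of `y`. -/
def regShear (b : ℝ → ℝ) (σs σ₀ ε y : ℝ) : ℝ :=
  if h : ∃ p : ℝ × ℕ, IsCriticalPointOfOrder b p.1 p.2 ∧ |y - p.1| < 2 * σs then
    let γ : ℝ := h.choose.1
    let m : ℕ := h.choose.2
    if |y - γ| ≤ σs then innerShear σ₀ ε m |y - γ|
    else
      let t : ℝ := (|y - γ| - σs) / σs
      (1 - t) * innerShear σ₀ ε m σs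
        + t * (2 * σ₀ * |deriv b (γ + SignType.sign (y - γ) * (2 * σs))|)
  else 2 * σ₀ * |deriv b y|

/-- The amplitude
`A(z) = ε^{-1/2} / (α + ε^{1/3} |B'(z)|^{2/3} + |b(z) - lam|)^{1/2}`. -/
def amplitude (b : ℝ → ℝ) (σs σ₀ ε α lam z : ℝ) : ℝ :=
  ε ^ (-(1 / 2) : ℝ) /
    (α + ε ^ (1 / 3 : ℝ) * regShear b σs σ₀ ε z ^ (2 / 3 : ℝ) + |b z - lam|) ^ (1 / 2 : ℝ)

/-- The inverse length scale `1 / L(y, z, lam)`. -/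
def invLength (b : ℝ → ℝ) (σs σ₀ ε α lam y z : ℝ) : ℝ :=
  if torusDist y z < σs then
    (α + ε ^ (1 / 3 : ℝ) * regShear b σs σ₀ ε y ^ (2 / 3 : ℝ)
        + ε ^ (1 / 3 : ℝ) * regShear b σs σ₀ ε z ^ (2 / 3 : ℝ)
        + |b y - lam| + |b z - lam|) ^ (1 / 2 : ℝ) / ε ^ (1 / 2 : ℝ)
  else (α + σs) ^ (1 / 2 : ℝ) / ε ^ (1 / 2 : ℝ)

/-- `K = K(·, z, lam)` is a (continuous) solution on `𝕋`, in the sense of distributions, of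
`-ε K'' + α K - σ₀ ε^{(N+1)/(N+3)} K + i (b - lam) K = δ_z`. -/
def IsFundamentalSolution (b : ℝ → ℝ) (N : ℕ) (σ₀ ε α lam z : ℝ) (K : ℝ → ℂ) : Prop :=
  Continuous K ∧ Function.Periodic K (2 * Real.pi) ∧
  ∀ φ : ℝ → ℂ, ContDiff ℝ ∞ φ → Function.Periodic φ (2 * Real.pi) →
    ∫ y in (0 : ℝ)..(2 * Real.pi),
      K y * (-(ε : ℂ) * iteratedDeriv 2 φ y
        + ((α - σ₀ * ε ^ (((N : ℝ) + 1) / ((N : ℝ) + 3)) : ℝ) : ℂ) * φ y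
        + Complex.I * ((b y - lam : ℝ) : ℂ) * φ y) = φ z

end

/-!
The proof rests on one intrinsic quantity, the frequency `ρ` of `b - lam` (`freq`, `shearFreq`):
a smooth function comparable with the largest of `α ^ (1/2)` and
`(√ε ^ k * |(b - lam)^{(k)}|) ^ (1/(k+2))`, `k ≤ N + 1`. Since at every point one of the derivatives
`b', …, b^{(N+1)}` is bounded away from zero, `ρ` varies by a bounded factor on intervals of length
`√ε / ρ` (`exists_isFrequency_freq`), and `ρ² ≥ c ε ^ ((N+1)/(N+3))`, which makes the unstable term
of the equation a small multiple of `ρ²`.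

A continuous distributional solution is a classical solution of the homogeneous equation between two
consecutive translates of `z`, and its derivative jumps there by `1/ε` in absolute value
(`IsFundamentalSolution.exists_classical`). For such a solution `k`, the energy estimate
`∫ w (ρ² |k|² + ε |k'|²) ≤ C w(z) |k(z)|` (`exists_energy_estimate`) holds for every weight `w` whose
relative variation on the scale `√ε / ρ` is small. It is hypocoercive: the real part of the equation
controls `∫ w (α |k|² + ε |k'|²)`, the imaginary part tested against `(b - lam) / ρ²` controls the
part of `ρ² |k|²` where `b - lam` itself is of size `ρ²`, and integrations by parts climb from each
derivative of `b - lam` to the next one (`exists_sum_le_of_interpolation`).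

Applied with the Agmon weights `exp (2 ψ) / r` and `exp (2 ψ) * r`, where `ψ` (`agmonExponent`) is
comparable with a small multiple of the `ρ`-distance to the end points in units of `√ε`, and `r` is a
more slowly varying copy of `ρ`, the estimate gives `|k| ≤ C exp (-ψ) / (√ε ρ(z))` and
`|k'| ≤ C exp (-ψ) / ε` (`exists_pointwise_bounds`).

Finally `ρ` is compared with the quantities in the statement. Pointwise, `ρ` dominates the rate
`α ^ (1/2) + (√ε |B'|) ^ (1/3) + |b - lam| ^ (1/2)` (`exists_decayRate_le`), so that `1 / (√ε ρ(z))` is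
bounded by the amplitude. For the exponent one needs more: that the integral of `ρ` from `z` to `y`
dominates `|y - z|` times this rate at the end points. This holds because functions of finite type are
doubling, so that their values at the end points of an interval are controlled by their mean over it
(`exists_rpow_doubling`, `exists_torusDist_mul_invLength_le`).
-/

open scoped ContDiff
open Set

/-! ### The weighted energy estimate -/

lemma mul_mul_abs_le_of_sq_le {n p J r s η : ℝ} (hn : 0 ≤ n) (hp : 0 ≤ p) (hJ : J ^ 2 ≤ n * p)
    (hη : 0 < η) : r * s * |J| ≤ (η * (r ^ 2 * n) + η⁻¹ * (s ^ 2 * p)) / 2 := by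
  have h0 : 0 ≤ (η * (r ^ 2 * n) + η⁻¹ * (s ^ 2 * p)) / 2 := by positivity
  have e : η * η⁻¹ = 1 := mul_inv_cancel₀ hη.ne'
  have h2 : r ^ 2 * s ^ 2 * J ^ 2 ≤ (η * (r ^ 2 * n)) * (η⁻¹ * (s ^ 2 * p)) := by
    calc r ^ 2 * s ^ 2 * J ^ 2 ≤ r ^ 2 * s ^ 2 * (n * p) := by gcongr
      _ = (η * η⁻¹) * (r ^ 2 * s ^ 2 * (n * p)) := by rw [e, one_mul]
      _ = _ := by ring
  refine (le_abs_self _).trans (abs_le_of_sq_le_sq ?_ h0)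
  rw [mul_pow, mul_pow, sq_abs]
  nlinarith [sq_nonneg (η * (r ^ 2 * n) - η⁻¹ * (s ^ 2 * p))]

lemma integral_le_sub_add_integral {z T : ℝ} (hzT : z ≤ T) {H H' f g : ℝ → ℝ}
    (hH : ∀ y ∈ Icc z T, HasDerivAt H (H' y) y) (hH' : ContinuousOn H' (Icc z T))
    (hf : ContinuousOn f (Icc z T)) (hg : ContinuousOn g (Icc z T))
    (h : ∀ y ∈ Icc z T, f y ≤ H' y + g y) :
    ∫ y in z..T, f y ≤ (H T - H z) + ∫ y in z..T, g y := by
  have iH := hH'.intervalIntegrable_of_Icc (μ := MeasureTheory.volume) hzT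
  have if' := hf.intervalIntegrable_of_Icc (μ := MeasureTheory.volume) hzT
  have ig := hg.intervalIntegrable_of_Icc (μ := MeasureTheory.volume) hzT
  rw [← intervalIntegral.integral_eq_sub_of_hasDerivAt (f := H) (f' := H')
    (by rwa [uIcc_of_le hzT]) iH, ← intervalIntegral.integral_add iH ig]
  exact intervalIntegral.integral_mono_on hzT if' (iH.add ig) h

/-- The recursion `X (k+1) ≤ C (t Y + X k / t)`, `0 < t ≤ 1`, lets every `X k` be absorbed, up to an
arbitrarily small multiple of `Y`, by `X 0`. -/
lemma exists_sum_le_of_interpolation (C : ℝ) (hC : 0 < C) (n : ℕ) (η : ℝ) (hη : 0 < η) :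
    ∃ D : ℝ, 0 < D ∧ ∀ (X : ℕ → ℝ) (Y : ℝ), 0 ≤ Y → (∀ k, 0 ≤ X k) →
      (∀ k < n, ∀ t : ℝ, 0 < t → t ≤ 1 → X (k + 1) ≤ C * (t * Y + t⁻¹ * X k)) →
      ∑ k ∈ Finset.range (n + 1), X k ≤ η * Y + D * X 0 := by
  have key : ∀ k : ℕ, k ≤ n → ∀ η : ℝ, 0 < η → ∃ D : ℝ, 0 < D ∧ ∀ (X : ℕ → ℝ) (Y : ℝ), 0 ≤ Y →
      (∀ k, 0 ≤ X k) →
      (∀ k < n, ∀ t : ℝ, 0 < t → t ≤ 1 → X (k + 1) ≤ C * (t * Y + t⁻¹ * X k)) →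
      X k ≤ η * Y + D * X 0 := by
    intro k
    induction k with
    | zero =>
      intro _ η hη
      refine ⟨1, one_pos, fun X Y hY hX _ => ?_⟩
      have := mul_nonneg hη.le hY
      linarith
    | succ k ih =>
      intro hk η hη
      set t : ℝ := min 1 (η / (2 * C)) with ht
      have ht0 : 0 < t := lt_min one_pos (by positivity)
      have ht1 : t ≤ 1 := min_le_left _ _
      have ht2 : C * t ≤ η / 2 := by
        have : t ≤ η / (2 * C) := min_le_right _ _
        calc C * t ≤ C * (η / (2 * C)) := by gcongr
          _ = η / 2 := by field_simp
      obtain ⟨D, hD, h⟩ := ih (by omega) (η * t / (2 * C)) (by positivity)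
      refine ⟨C * t⁻¹ * D, by positivity, fun X Y hY hX hrec => ?_⟩
      have h1 := hrec k (by omega) t ht0 ht1
      have h2 := h X Y hY hX hrec
      calc X (k + 1) ≤ C * (t * Y + t⁻¹ * X k) := h1
        _ ≤ C * (t * Y + t⁻¹ * (η * t / (2 * C) * Y + D * X 0)) := by gcongr
        _ = C * t * Y + η / 2 * Y + C * t⁻¹ * D * X 0 := by field_simp; ring
        _ ≤ η / 2 * Y + η / 2 * Y + C * t⁻¹ * D * X 0 := by gcongr
        _ = _ := by ring
  choose! D hD h using fun k (hk : k ≤ n) => key k hk (η / (n + 1)) (by positivity)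
  refine ⟨∑ k ∈ Finset.range (n + 1), D k, Finset.sum_pos (fun k hk => hD k ?_) ⟨0, by simp⟩, ?_⟩
  · simpa [Nat.lt_succ_iff] using hk
  intro X Y hY hX hrec
  calc ∑ k ∈ Finset.range (n + 1), X k
      ≤ ∑ k ∈ Finset.range (n + 1), (η / (n + 1) * Y + D k * X 0) := by
        refine Finset.sum_le_sum fun k hk => h k ?_ X Y hY hX hrec
        simpa [Nat.lt_succ_iff] using hk
    _ = _ := by
        rw [Finset.sum_add_distrib, Finset.sum_mul]
        simp
        field_simp

/-- `ρ` is a slowly varying frequency for the functions `β 0, …, β (n+1)` (in the application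
`β 0 = b - λ` and `β k = b^{(k)}`), at the length `s = √ε`: on an interval of length `s / ρ y` around
`y`, the function `ρ` varies by a bounded factor, and `β 0` has size `ρ²` in the sense of its `n`-jet
unless `α` has. -/
structure IsFrequency (n : ℕ) (β : ℕ → ℝ → ℝ) (α s C : ℝ) (ρ ρ' : ℝ → ℝ) : Prop where
  pos : ∀ y, 0 < ρ y
  hasDerivAt : ∀ y, HasDerivAt ρ (ρ' y) y
  continuous_deriv : Continuous ρ'
  slow : ∀ y, s * |ρ' y| ≤ C * ρ y ^ 2
  jet_le : ∀ k ≤ n + 1, ∀ y, s ^ k * |β k y| ≤ C * ρ y ^ (k + 2)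
  le_jet : ∀ y, 1 ≤ α / ρ y ^ 2 + ∑ k ∈ Finset.range (n + 1), (s ^ k * β k y / ρ y ^ (k + 2)) ^ 2

/-- The quadratic quantities of a solution `k` of `s² k'' = (a + i q) k` on `[z, T]`:
`n = |k|²`, `p = |k'|²`, `Jr + i Ji = conj k * k'`. The number `M` bounds the jumps of `s² Jr` and
`s² Ji` between the end points. -/
structure IsQuadraticData (q : ℝ → ℝ) (s a z T M : ℝ) (n p Jr Ji : ℝ → ℝ) : Prop where
  n_nonneg : ∀ y, 0 ≤ n y
  p_nonneg : ∀ y, 0 ≤ p y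
  n_cont : Continuous n
  p_cont : Continuous p
  Jr_cont : Continuous Jr
  Ji_cont : Continuous Ji
  Jr_sq_le : ∀ y, Jr y ^ 2 ≤ n y * p y
  Ji_sq_le : ∀ y, Ji y ^ 2 ≤ n y * p y
  n_deriv : ∀ y ∈ Icc z T, HasDerivAt n (2 * Jr y) y
  Jr_deriv : ∀ y ∈ Icc z T, HasDerivAt Jr (p y + a / s ^ 2 * n y) y
  Ji_deriv : ∀ y ∈ Icc z T, HasDerivAt Ji (q y / s ^ 2 * n y) y
  n_end : n T = n z
  Jr_end : |s ^ 2 * (Jr T - Jr z)| ≤ M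
  Ji_end : |s ^ 2 * (Ji T - Ji z)| ≤ M

section Energy

variable {n : ℕ} {β : ℕ → ℝ → ℝ} {α s C : ℝ} {ρ ρ' : ℝ → ℝ}

/-- The derivatives of `β 0` in the units given by the frequency `ρ`. -/
noncomputable def scaledJet (β : ℕ → ℝ → ℝ) (s : ℝ) (ρ : ℝ → ℝ) (k : ℕ) (y : ℝ) : ℝ :=
  s ^ k * β k y / ρ y ^ (k + 2)

lemma IsFrequency.continuous (h : IsFrequency n β α s C ρ ρ') : Continuous ρ :=
  continuous_iff_continuousAt.2 fun y => (h.hasDerivAt y).continuousAt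

lemma IsFrequency.abs_scaledJet_le (h : IsFrequency n β α s C ρ ρ') (hs : 0 < s) {k : ℕ}
    (hk : k ≤ n + 1) (y : ℝ) : |scaledJet β s ρ k y| ≤ C := by
  have hρ := h.pos y
  have h1 := h.jet_le k hk y
  rw [scaledJet, abs_div, abs_mul, abs_of_pos (pow_pos hs k), abs_of_pos (pow_pos hρ _),
    div_le_iff₀ (pow_pos hρ _)]
  exact h1

lemma IsFrequency.hasDerivAt_scaledJet (h : IsFrequency n β α s C ρ ρ') (hs : 0 < s)
    (hβ : ∀ k ≤ n, ∀ y, HasDerivAt (β k) (β (k + 1) y) y) {k : ℕ} (hk : k ≤ n) (y : ℝ) :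
    HasDerivAt (scaledJet β s ρ k)
      (ρ y / s * (scaledJet β s ρ (k + 1) y
        - (k + 2) * (s * ρ' y / ρ y ^ 2) * scaledJet β s ρ k y)) y := by
  have hρ := (h.pos y).ne'
  have hs' := hs.ne'
  have := ((hβ k hk y).const_mul (s ^ k)).div ((h.hasDerivAt y).pow (k + 2))
    (pow_ne_zero _ hρ)
  refine this.congr_deriv ?_
  simp only [scaledJet, Pi.pow_apply]
  rw [show k + 2 - 1 = k + 1 by omega]
  push_cast
  field_simp
  ring

lemma IsFrequency.continuous_scaledJet (h : IsFrequency n β α s C ρ ρ')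
    (hβ : ∀ k ≤ n, ∀ y, HasDerivAt (β k) (β (k + 1) y) y) (hβc : Continuous (β (n + 1)))
    {k : ℕ} (hk : k ≤ n + 1) : Continuous (scaledJet β s ρ k) := by
  have hc : Continuous (β k) := by
    rcases Nat.lt_or_ge n k with h1 | h1
    · obtain rfl : k = n + 1 := by omega
      exact hβc
    · exact continuous_iff_continuousAt.2 fun y => (hβ k h1 y).continuousAt
  exact (continuous_const.mul hc).div (h.continuous.pow _) fun y => pow_ne_zero _ (h.pos y).ne'

variable {a τ z T M δ : ℝ} {N P Jr Ji w w' : ℝ → ℝ}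

/-- Pointwise form of the interpolation `X (k+1) ≤ C (t Y + X k / t)`, up to a total derivative. -/
lemma chain_pointwise {ρ s w n p J κ θ t C m a₀ a₁ a₂ D k : ℝ}
    (hw : 0 ≤ w) (hn : 0 ≤ n) (hp : 0 ≤ p) (hJ : J ^ 2 ≤ n * p) (hC : 1 ≤ C)
    (hκ : |κ| ≤ C) (hθ : |θ| ≤ 1) (h1 : |a₁| ≤ C) (h2 : |a₂| ≤ C) (ht : 0 < t)
    (hk : 0 ≤ k) (hkm : k ≤ m)
    (hD : D = ρ ^ 2 * a₁ ^ 2 * w * n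
      + ρ ^ 2 * w * n * (a₀ * (κ * a₁ - (k + 2) * κ * a₁ + a₂ - (k + 3) * κ * a₁ + a₁ * θ))
      + 2 * ρ * s * a₀ * a₁ * w * J) :
    ρ ^ 2 * a₁ ^ 2 * w * n ≤ D + (C ^ 2 * (2 * m + 9)) *
      (t * (w * (ρ ^ 2 * n + s ^ 2 * p)) + t⁻¹ * (ρ ^ 2 * a₀ ^ 2 * w * n)) := by
  set E := κ * a₁ - (k + 2) * κ * a₁ + a₂ - (k + 3) * κ * a₁ + a₁ * θ with hE
  have hC0 : 0 ≤ C := by linarith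
  have hκa : |κ * a₁| ≤ C ^ 2 := by
    rw [abs_mul, sq]; gcongr
  have haθ : |a₁ * θ| ≤ C ^ 2 := by
    rw [abs_mul]
    calc |a₁| * |θ| ≤ C * 1 := by gcongr
      _ ≤ C ^ 2 := by nlinarith
  have ha2 : |a₂| ≤ C ^ 2 := h2.trans (by nlinarith)
  have hEb : |E| ≤ C ^ 2 * (2 * m + 6) := by
    have e : E = (-(2 * k + 4)) * (κ * a₁) + a₂ + a₁ * θ := by rw [hE]; ring
    rw [e]
    calc |(-(2 * k + 4)) * (κ * a₁) + a₂ + a₁ * θ|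
        ≤ |(-(2 * k + 4)) * (κ * a₁)| + |a₂| + |a₁ * θ| := abs_add_three _ _ _
      _ ≤ (2 * k + 4) * C ^ 2 + C ^ 2 + C ^ 2 := by
        rw [abs_mul, abs_neg, abs_of_nonneg (by positivity : 0 ≤ 2 * k + 4)]
        gcongr
      _ ≤ _ := by nlinarith [sq_nonneg C]
  have hti : 0 < t⁻¹ := inv_pos.2 ht
  have tt : t * t⁻¹ = 1 := mul_inv_cancel₀ ht.ne'
  have hx : |a₀| ≤ (t + t⁻¹ * a₀ ^ 2) / 2 := by
    have := sq_nonneg (t - |a₀|)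
    have h3 : 2 * |a₀| * t ≤ t * (t + t⁻¹ * a₀ ^ 2) := by
      rw [mul_add, ← mul_assoc, tt, one_mul]
      nlinarith [sq_abs a₀]
    nlinarith
  have hA : |ρ ^ 2 * w * n * (a₀ * E)| ≤
      C ^ 2 * (2 * m + 6) * ((t * (ρ ^ 2 * w * n) + t⁻¹ * (ρ ^ 2 * a₀ ^ 2 * w * n)) / 2) := by
    rw [abs_mul, abs_mul a₀ E, abs_of_nonneg (by positivity : 0 ≤ ρ ^ 2 * w * n)]
    calc ρ ^ 2 * w * n * (|a₀| * |E|)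
        ≤ ρ ^ 2 * w * n * ((t + t⁻¹ * a₀ ^ 2) / 2 * (C ^ 2 * (2 * m + 6))) := by gcongr
      _ = _ := by ring
  have hB : |2 * ρ * s * a₀ * a₁ * w * J| ≤
      C ^ 2 * (t⁻¹ * (ρ ^ 2 * a₀ ^ 2 * w * n) + t * (s ^ 2 * (w * p))) := by
    have h3 := mul_mul_abs_le_of_sq_le (r := |ρ * a₀|) (s := |s|) hn hp hJ hti
    have h4 : |2 * ρ * s * a₀ * a₁ * w * J| = 2 * |a₁| * w * (|ρ * a₀| * |s| * |J|) := by
      simp only [abs_mul, abs_of_nonneg hw, abs_two]; ring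
    rw [h4]
    rw [sq_abs, sq_abs, inv_inv] at h3
    calc 2 * |a₁| * w * (|ρ * a₀| * |s| * |J|)
        ≤ 2 * C ^ 2 * w * ((t⁻¹ * ((ρ * a₀) ^ 2 * n) + t * (s ^ 2 * p)) / 2) := by
          gcongr
          nlinarith
      _ = _ := by ring
  have hA' := (abs_le.1 hA).1
  have hB' := (abs_le.1 hB).1
  have hm : 0 ≤ m := hk.trans hkm
  have q1 : 0 ≤ t * (ρ ^ 2 * w * n) := by positivity
  have q2 : 0 ≤ t⁻¹ * (ρ ^ 2 * a₀ ^ 2 * w * n) := by positivity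
  have q3 : 0 ≤ t * (s ^ 2 * (w * p)) := by positivity
  have c1 : 0 ≤ C ^ 2 * m := by positivity
  have c2 : 0 ≤ C ^ 2 := by positivity
  have k1 := mul_nonneg c1 q1
  have k2 := mul_nonneg c1 q2
  have k3 := mul_nonneg c1 q3
  have l1 := mul_nonneg c2 q1
  have l2 := mul_nonneg c2 q2
  have l3 := mul_nonneg c2 q3
  rw [hD]
  linarith

/-- Multiplying the equation by `w * conj k` and taking real parts. -/
lemma real_part_estimate (h : IsFrequency n β α s C ρ ρ')
    (hs : 0 < s) (hzT : z ≤ T)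
    (hd : IsQuadraticData (β 0) s (α - τ) z T M N P Jr Ji)
    (hw : ∀ y, 0 < w y) (hwd : ∀ y, HasDerivAt w (w' y) y) (hwc : Continuous w')
    (hwe : w T = w z) {κ : ℝ} (hδ : 0 ≤ δ) (hκ : 0 ≤ κ) (hτ : ∀ y, τ ≤ κ * ρ y ^ 2)
    (hw' : ∀ y ∈ Icc z T, s * |w' y| ≤ δ * (ρ y * w y)) :
    (∫ y in z..T, (s ^ 2 * (w y * P y) + α * (w y * N y))) ≤
      w z * M + (δ / 2 + κ) * ∫ y in z..T, w y * (ρ y ^ 2 * N y + s ^ 2 * P y) := by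
  have hwcont : Continuous w := continuous_iff_continuousAt.2 fun y => (hwd y).continuousAt
  have hρc := h.continuous
  have hNc := hd.n_cont
  have hPc := hd.p_cont
  have hJc := hd.Jr_cont
  have key := integral_le_sub_add_integral (H := fun y => s ^ 2 * (w y * Jr y))
    (H' := fun y => s ^ 2 * (w' y * Jr y + w y * (P y + (α - τ) / s ^ 2 * N y)))
    (f := fun y => s ^ 2 * (w y * P y) + α * (w y * N y))
    (g := fun y => (δ / 2 + κ) * (w y * (ρ y ^ 2 * N y + s ^ 2 * P y)))
    hzT (fun y hy => ((hwd y).mul (hd.Jr_deriv y hy)).const_mul _)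
    (by fun_prop) (by fun_prop) (by fun_prop) ?_
  · rw [intervalIntegral.integral_const_mul] at key
    refine key.trans (add_le_add_left ?_ _)
    rw [hwe]
    calc s ^ 2 * (w z * Jr T) - s ^ 2 * (w z * Jr z) = w z * (s ^ 2 * (Jr T - Jr z)) := by ring
      _ ≤ w z * M := by
        have := (abs_le.1 hd.Jr_end).2
        have := (hw z).le
        gcongr
  · intro y hy
    have hn := hd.n_nonneg y
    have hp := hd.p_nonneg y
    have hwy := hw y
    have h1 := mul_mul_abs_le_of_sq_le (r := ρ y) (s := s) hn hp (hd.Jr_sq_le y) one_pos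
    have h2 : |s ^ 2 * (w' y * Jr y)| ≤ δ / 2 * (w y * (ρ y ^ 2 * N y + s ^ 2 * P y)) := by
      rw [abs_mul, abs_mul, abs_of_pos (pow_pos hs 2)]
      calc s ^ 2 * (|w' y| * |Jr y|) = (s * |w' y|) * (s * |Jr y|) := by ring
        _ ≤ (δ * (ρ y * w y)) * (s * |Jr y|) := by
          exact mul_le_mul_of_nonneg_right (hw' y hy) (by positivity)
        _ = δ * w y * (ρ y * s * |Jr y|) := by ring
        _ ≤ δ * w y * ((1 * (ρ y ^ 2 * N y) + 1⁻¹ * (s ^ 2 * P y)) / 2) := by gcongr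
        _ = _ := by rw [inv_one]; ring
    have h3 : τ * (w y * N y) ≤ κ * (w y * (ρ y ^ 2 * N y + s ^ 2 * P y)) := by
      calc τ * (w y * N y) ≤ κ * ρ y ^ 2 * (w y * N y) := by gcongr; exact hτ y
        _ ≤ κ * ρ y ^ 2 * (w y * N y) + κ * (w y * (s ^ 2 * P y)) := by
          have : 0 ≤ κ * (w y * (s ^ 2 * P y)) := by positivity
          linarith
        _ = _ := by ring
    have h4 : s ^ 2 * (w' y * Jr y + w y * (P y + (α - τ) / s ^ 2 * N y)) =
        s ^ 2 * (w' y * Jr y) + s ^ 2 * (w y * P y) + α * (w y * N y) - τ * (w y * N y) := by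
      field_simp; ring
    simp only [h4]
    have := (abs_le.1 h2).1
    linarith

/-- Multiplying the equation by `scaledJet 0 * w * conj k`, where `scaledJet 0 = β 0 / ρ²` is a
smooth substitute for the sign of `β 0`, and taking imaginary parts. -/
lemma imaginary_part_estimate (h : IsFrequency n β α s C ρ ρ') (hC : 1 ≤ C)
    (hβ : ∀ k ≤ n, ∀ y, HasDerivAt (β k) (β (k + 1) y) y) (hβc : Continuous (β (n + 1)))
    (hs : 0 < s) (hzT : z ≤ T) (hβe : β 0 T = β 0 z) (hρe : ρ T = ρ z)
    (hd : IsQuadraticData (β 0) s a z T M N P Jr Ji)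
    (hw : ∀ y, 0 < w y) (hwd : ∀ y, HasDerivAt w (w' y) y) (hwc : Continuous w')
    (hwe : w T = w z) (hw' : ∀ y ∈ Icc z T, s * |w' y| ≤ ρ y * w y) {t : ℝ} (ht : 0 < t) :
    (∫ y in z..T, ρ y ^ 2 * scaledJet β s ρ 0 y ^ 2 * w y * N y) ≤
      C * (w z * M) + 2 * C ^ 2 * (t * (∫ y in z..T, w y * (ρ y ^ 2 * N y + s ^ 2 * P y))
        + t⁻¹ * ∫ y in z..T, s ^ 2 * (w y * P y)) := by
  have hwcont : Continuous w := continuous_iff_continuousAt.2 fun y => (hwd y).continuousAt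
  have hρc := h.continuous
  have hNc := hd.n_cont
  have hPc := hd.p_cont
  have hJc := hd.Ji_cont
  have hρ'c := h.continuous_deriv
  have hβ0 : Continuous (β 0) :=
    continuous_iff_continuousAt.2 fun y => (hβ 0 (by omega) y).continuousAt
  have ha0 := h.continuous_scaledJet hβ hβc (k := 0) (by omega)
  have ha1 := h.continuous_scaledJet hβ hβc (k := 1) (by omega)
  have hρ2 : ∀ y, ρ y ^ 2 ≠ 0 := fun y => pow_ne_zero _ (h.pos y).ne'
  have key := integral_le_sub_add_integral
    (H := fun y => s ^ 2 * (scaledJet β s ρ 0 y * w y * Ji y))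
    (H' := fun y => s ^ 2 * ((ρ y / s * (scaledJet β s ρ (0 + 1) y
        - ((0 : ℕ) + 2) * (s * ρ' y / ρ y ^ 2) * scaledJet β s ρ 0 y) * w y
        + scaledJet β s ρ 0 y * w' y) * Ji y + scaledJet β s ρ 0 y * w y * (β 0 y / s ^ 2 * N y)))
    (f := fun y => ρ y ^ 2 * scaledJet β s ρ 0 y ^ 2 * w y * N y)
    (g := fun y => 2 * C ^ 2 * (t * (w y * (ρ y ^ 2 * N y + s ^ 2 * P y))
      + t⁻¹ * (s ^ 2 * (w y * P y))))
    hzT (fun y hy => (((h.hasDerivAt_scaledJet hs hβ (by omega) y).mul (hwd y)).mul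
      (hd.Ji_deriv y hy)).const_mul _)
    (by fun_prop (disch := assumption)) (by fun_prop) (by fun_prop) ?_
  · rw [intervalIntegral.integral_const_mul, intervalIntegral.integral_add
      (Continuous.intervalIntegrable (by fun_prop) _ _)
      (Continuous.intervalIntegrable (by fun_prop) _ _),
      intervalIntegral.integral_const_mul, intervalIntegral.integral_const_mul] at key
    refine key.trans (add_le_add_left ?_ _)
    have e : scaledJet β s ρ 0 T = scaledJet β s ρ 0 z := by simp [scaledJet, hβe, hρe]
    rw [hwe, e]
    have hwz := hw z
    calc s ^ 2 * (scaledJet β s ρ 0 z * w z * Ji T) - s ^ 2 * (scaledJet β s ρ 0 z * w z * Ji z)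
        = scaledJet β s ρ 0 z * (w z * (s ^ 2 * (Ji T - Ji z))) := by ring
      _ ≤ |scaledJet β s ρ 0 z * (w z * (s ^ 2 * (Ji T - Ji z)))| := le_abs_self _
      _ = |scaledJet β s ρ 0 z| * (w z * |s ^ 2 * (Ji T - Ji z)|) := by
        rw [abs_mul, abs_mul (w z), abs_of_pos hwz]
      _ ≤ C * (w z * M) := by
        have := hd.Ji_end
        have := h.abs_scaledJet_le hs (k := 0) (by omega) z
        gcongr
  · intro y hy
    have hn := hd.n_nonneg y
    have hp := hd.p_nonneg y
    have hwy := hw y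
    have hρy := h.pos y
    have hb0 := h.abs_scaledJet_le hs (k := 0) (by omega) y
    have hb1 := h.abs_scaledJet_le hs (k := 1) (by omega) y
    have h1 := mul_mul_abs_le_of_sq_le (r := ρ y) (s := s) hn hp (hd.Ji_sq_le y) ht
    have hκ : |s * ρ' y / ρ y ^ 2| ≤ C := by
      rw [abs_div, abs_mul, abs_of_pos hs, abs_of_pos (pow_pos hρy 2),
        div_le_iff₀ (pow_pos hρy 2)]
      exact h.slow y
    set κ := s * ρ' y / ρ y ^ 2
    have hβy : β 0 y = scaledJet β s ρ 0 y * ρ y ^ 2 := by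
      simp only [scaledJet]; field_simp
    rw [zero_add]
    set a₀ := scaledJet β s ρ 0 y
    set a₁ := scaledJet β s ρ 1 y
    have e1 : s ^ 2 * ((ρ y / s * (a₁ - ((0 : ℕ) + 2) * κ * a₀) * w y + a₀ * w' y) * Ji y
        + a₀ * w y * (β 0 y / s ^ 2 * N y)) =
        ((a₁ - 2 * κ * a₀) * (ρ y * w y) + a₀ * (s * w' y)) * (s * Ji y)
          + ρ y ^ 2 * a₀ ^ 2 * w y * N y := by
      rw [hβy]; field_simp; push_cast; ring
    simp only [e1]
    have e2 : |(a₁ - 2 * κ * a₀) * (ρ y * w y) + a₀ * (s * w' y)| ≤ 4 * C ^ 2 * (ρ y * w y) := by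
      have i1 : |a₁ - 2 * κ * a₀| ≤ 3 * C ^ 2 := by
        calc |a₁ - 2 * κ * a₀| ≤ |a₁| + |2 * κ * a₀| := abs_sub _ _
          _ = |a₁| + 2 * (|κ| * |a₀|) := by rw [abs_mul, abs_mul, abs_two]; ring
          _ ≤ C + 2 * (C * C) := by gcongr
          _ ≤ 3 * C ^ 2 := by nlinarith
      calc _ ≤ |(a₁ - 2 * κ * a₀) * (ρ y * w y)| + |a₀ * (s * w' y)| := abs_add_le _ _
        _ = |a₁ - 2 * κ * a₀| * (ρ y * w y) + |a₀| * (s * |w' y|) := by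
          rw [abs_mul, abs_mul a₀, abs_mul s, abs_of_pos hs,
            abs_of_pos (mul_pos hρy hwy)]
        _ ≤ 3 * C ^ 2 * (ρ y * w y) + C * (ρ y * w y) := by
          have := hw' y hy
          gcongr
        _ ≤ _ := by
          have : C * (ρ y * w y) ≤ C ^ 2 * (ρ y * w y) := by gcongr; nlinarith
          linarith
    have e3 : |((a₁ - 2 * κ * a₀) * (ρ y * w y) + a₀ * (s * w' y)) * (s * Ji y)| ≤
        2 * C ^ 2 * (t * (w y * (ρ y ^ 2 * N y)) + t⁻¹ * (s ^ 2 * (w y * P y))) := by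
      rw [abs_mul, abs_mul s, abs_of_pos hs]
      calc _ ≤ 4 * C ^ 2 * (ρ y * w y) * (s * |Ji y|) := by gcongr
        _ = 4 * C ^ 2 * w y * (ρ y * s * |Ji y|) := by ring
        _ ≤ 4 * C ^ 2 * w y * ((t * (ρ y ^ 2 * N y) + t⁻¹ * (s ^ 2 * P y)) / 2) := by gcongr
        _ = _ := by ring
    have e4 := (abs_le.1 e3).1
    have e5 : 0 ≤ 2 * C ^ 2 * (t * (w y * (s ^ 2 * P y))) := by positivity
    linarith

/-- Integrated form of `chain_pointwise`: the energy estimate climbs from `β k` to `β (k+1)` by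
integrating the derivative of `ρ * scaledJet k * scaledJet (k+1) * w * |K|²`. -/
lemma chain_estimate (h : IsFrequency n β α s C ρ ρ') (hC : 1 ≤ C)
    (hβ : ∀ k ≤ n, ∀ y, HasDerivAt (β k) (β (k + 1) y) y) (hβc : Continuous (β (n + 1)))
    (hs : 0 < s) (hzT : z ≤ T) (hβe : ∀ k ≤ n, β k T = β k z) (hρe : ρ T = ρ z)
    (hd : IsQuadraticData (β 0) s a z T M N P Jr Ji)
    (hw : ∀ y, 0 < w y) (hwd : ∀ y, HasDerivAt w (w' y) y) (hwc : Continuous w')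
    (hwe : w T = w z) (hw' : ∀ y ∈ Icc z T, s * |w' y| ≤ ρ y * w y) {t : ℝ} (ht : 0 < t)
    {k : ℕ} (hk : k < n) :
    (∫ y in z..T, ρ y ^ 2 * scaledJet β s ρ (k + 1) y ^ 2 * w y * N y) ≤
      C ^ 2 * (2 * n + 9) * (t * (∫ y in z..T, w y * (ρ y ^ 2 * N y + s ^ 2 * P y))
        + t⁻¹ * ∫ y in z..T, ρ y ^ 2 * scaledJet β s ρ k y ^ 2 * w y * N y) := by
  have hwcont : Continuous w := continuous_iff_continuousAt.2 fun y => (hwd y).continuousAt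
  have hρc := h.continuous
  have hNc := hd.n_cont
  have hPc := hd.p_cont
  have hJc := hd.Jr_cont
  have hρ'c := h.continuous_deriv
  have ha0 := h.continuous_scaledJet hβ hβc (k := k) (by omega)
  have ha1 := h.continuous_scaledJet hβ hβc (k := k + 1) (by omega)
  have ha2 := h.continuous_scaledJet hβ hβc (k := k + 1 + 1) (by omega)
  have hρ2 : ∀ y, ρ y ^ 2 ≠ 0 := fun y => pow_ne_zero _ (h.pos y).ne'
  have key := integral_le_sub_add_integral
    (H := fun y => s * (ρ y * scaledJet β s ρ k y * scaledJet β s ρ (k + 1) y * w y * N y))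
    (H' := fun y => s * (((((ρ' y * scaledJet β s ρ k y + ρ y * (ρ y / s *
        (scaledJet β s ρ (k + 1) y
          - (k + 2) * (s * ρ' y / ρ y ^ 2) * scaledJet β s ρ k y))) * scaledJet β s ρ (k + 1) y
        + ρ y * scaledJet β s ρ k y * (ρ y / s * (scaledJet β s ρ (k + 1 + 1) y
          - ((k + 1 : ℕ) + 2) * (s * ρ' y / ρ y ^ 2) * scaledJet β s ρ (k + 1) y))) * w y
        + ρ y * scaledJet β s ρ k y * scaledJet β s ρ (k + 1) y * w' y) * N y
        + ρ y * scaledJet β s ρ k y * scaledJet β s ρ (k + 1) y * w y * (2 * Jr y))))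
    (f := fun y => ρ y ^ 2 * scaledJet β s ρ (k + 1) y ^ 2 * w y * N y)
    (g := fun y => C ^ 2 * (2 * n + 9) * (t * (w y * (ρ y ^ 2 * N y + s ^ 2 * P y))
      + t⁻¹ * (ρ y ^ 2 * scaledJet β s ρ k y ^ 2 * w y * N y)))
    hzT (fun y hy => (((((h.hasDerivAt y).mul (h.hasDerivAt_scaledJet hs hβ (by omega) y)).mul
      (h.hasDerivAt_scaledJet hs hβ (by omega) y)).mul (hwd y)).mul
      (hd.n_deriv y hy)).const_mul _)
    (by fun_prop (disch := assumption)) (by fun_prop) (by fun_prop) ?_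
  · rw [intervalIntegral.integral_const_mul, intervalIntegral.integral_add
      (Continuous.intervalIntegrable (by fun_prop) _ _)
      (Continuous.intervalIntegrable (by fun_prop) _ _),
      intervalIntegral.integral_const_mul, intervalIntegral.integral_const_mul] at key
    have e : ∀ j ≤ n, scaledJet β s ρ j T = scaledJet β s ρ j z := fun j hj => by
      simp [scaledJet, hβe j hj, hρe]
    rw [hwe, e k hk.le, e (k + 1) hk, hρe, hd.n_end] at key
    simpa using key
  · intro y hy
    have hwy := hw y
    have hρy := h.pos y
    have hκ : |s * ρ' y / ρ y ^ 2| ≤ C := by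
      rw [abs_div, abs_mul, abs_of_pos hs, abs_of_pos (pow_pos hρy 2),
        div_le_iff₀ (pow_pos hρy 2)]
      exact h.slow y
    have hθ : |s * w' y / (ρ y * w y)| ≤ 1 := by
      rw [abs_div, abs_mul, abs_of_pos hs, abs_of_pos (mul_pos hρy hwy),
        div_le_one (mul_pos hρy hwy)]
      exact hw' y hy
    refine chain_pointwise (k := k) (m := n) hwy.le (hd.n_nonneg y) (hd.p_nonneg y) (hd.Jr_sq_le y)
      hC hκ hθ (h.abs_scaledJet_le hs (by omega) y)
      (h.abs_scaledJet_le hs (k := k + 1 + 1) (by omega) y) ht (by positivity)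
      (by exact_mod_cast hk.le) ?_
    field_simp
    push_cast
    ring

/-- The weighted energy estimate: the weight `w` may vary by a small factor on the length
`s / ρ`, and `τ` may be as large as a small multiple of `ρ²`. -/
theorem exists_energy_estimate (n : ℕ) (C : ℝ) (hC : 1 ≤ C) :
    ∃ δ C' : ℝ, 0 < δ ∧ 0 < C' ∧
      ∀ (β : ℕ → ℝ → ℝ) (α s τ z T M : ℝ) (ρ ρ' N P Jr Ji w w' : ℝ → ℝ),
      IsFrequency n β α s C ρ ρ' →
      (∀ k ≤ n, ∀ y, HasDerivAt (β k) (β (k + 1) y) y) → Continuous (β (n + 1)) →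
      0 < s → 0 ≤ α → z ≤ T → (∀ k ≤ n, β k T = β k z) → ρ T = ρ z →
      IsQuadraticData (β 0) s (α - τ) z T M N P Jr Ji →
      (∀ y, 0 < w y) → (∀ y, HasDerivAt w (w' y) y) → Continuous w' → w T = w z →
      (∀ y ∈ Icc z T, s * |w' y| ≤ δ * (ρ y * w y)) → (∀ y, τ ≤ δ * ρ y ^ 2) →
      ∫ y in z..T, w y * (ρ y ^ 2 * N y + s ^ 2 * P y) ≤ C' * (w z * M) := by
  obtain ⟨D, hD, hsum⟩ := exists_sum_le_of_interpolation (C ^ 2 * (2 * n + 9)) (by positivity) n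
    (1 / 4) (by norm_num)
  set C₂ := 2 * C ^ 2 with hC₂
  have hC₂0 : 0 < C₂ := by positivity
  set G := 1 + 4 * D ^ 2 * C₂ ^ 2 with hG
  have hG1 : 1 ≤ G := by
    have : 0 ≤ 4 * D ^ 2 * C₂ ^ 2 := by positivity
    linarith
  refine ⟨1 / (8 * G), 4 * (G + D * C), by positivity, by positivity, ?_⟩
  intro β α s τ z T M ρ ρ' N P Jr Ji w w' h hβ hβc hs hα hzT hβe hρe hd hw hwd hwc hwe hw' hτ
  have hδ1 : 1 / (8 * G) ≤ 1 := by
    rw [div_le_one (by positivity)]; linarith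
  have hw1 : ∀ y ∈ Icc z T, s * |w' y| ≤ ρ y * w y := fun y hy => (hw' y hy).trans
    (mul_le_of_le_one_left (mul_pos (h.pos y) (hw y)).le hδ1)
  have hwcont : Continuous w := continuous_iff_continuousAt.2 fun y => (hwd y).continuousAt
  have hρc := h.continuous
  have hNc := hd.n_cont
  have hPc := hd.p_cont
  have hre := real_part_estimate h hs hzT hd hw hwd hwc hwe (κ := 1 / (8 * G)) (by positivity)
    (by positivity) hτ hw'
  have him := imaginary_part_estimate h hC hβ hβc hs hzT (hβe 0 (by omega)) hρe hd hw hwd hwc hwe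
    hw1 (t := 1 / (4 * D * C₂)) (by positivity)
  set Y := ∫ y in z..T, w y * (ρ y ^ 2 * N y + s ^ 2 * P y) with hY
  set X : ℕ → ℝ := fun k => ∫ y in z..T, ρ y ^ 2 * scaledJet β s ρ k y ^ 2 * w y * N y with hX
  have hY0 : 0 ≤ Y := intervalIntegral.integral_nonneg hzT fun y _ => by
    have := hd.n_nonneg y; have := hd.p_nonneg y; have := hw y; positivity
  have hX0 : ∀ k, 0 ≤ X k := fun k => intervalIntegral.integral_nonneg hzT fun y _ => by
    have := hd.n_nonneg y; have := hw y; positivity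
  have hs1 := hsum X Y hY0 hX0 fun k hk t ht _ =>
    chain_estimate h hC hβ hβc hs hzT hβe hρe hd hw hwd hwc hwe hw1 ht hk
  have hcont : ∀ k ∈ Finset.range (n + 1), Continuous fun y =>
      ρ y ^ 2 * scaledJet β s ρ k y ^ 2 * w y * N y := fun k hk => by
    have := h.continuous_scaledJet hβ hβc (k := k) (by simp at hk; omega)
    fun_prop
  have hXρ : ∫ y in z..T, w y * (ρ y ^ 2 * N y) ≤ (∫ y in z..T, α * (w y * N y))
      + ∑ k ∈ Finset.range (n + 1), X k := by
    rw [hX, ← intervalIntegral.integral_finsetSum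
      fun k hk => (hcont k hk).intervalIntegrable _ _,
      ← intervalIntegral.integral_add (Continuous.intervalIntegrable (by fun_prop) _ _)
        ((continuous_finsetSum _ hcont).intervalIntegrable _ _)]
    refine intervalIntegral.integral_mono_on hzT (Continuous.intervalIntegrable (by fun_prop) _ _)
      (((by fun_prop : Continuous fun y => α * (w y * N y)).add
        (continuous_finsetSum _ hcont)).intervalIntegrable _ _) fun y _ => ?_
    have hρy := h.pos y
    have h1 := h.le_jet y
    have hwn : 0 ≤ ρ y ^ 2 * (w y * N y) := by
      have := hd.n_nonneg y; have := hw y; positivity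
    have h2 := mul_le_mul_of_nonneg_left h1 hwn
    rw [mul_one, mul_add, Finset.mul_sum] at h2
    calc w y * (ρ y ^ 2 * N y) = ρ y ^ 2 * (w y * N y) := by ring
      _ ≤ _ := h2
      _ = _ := by
        congr 1
        · field_simp
        · exact Finset.sum_congr rfl fun k _ => by simp only [scaledJet]; ring
  have hsplit : Y = (∫ y in z..T, w y * (ρ y ^ 2 * N y)) + ∫ y in z..T, s ^ 2 * (w y * P y) := by
    rw [hY, ← intervalIntegral.integral_add (Continuous.intervalIntegrable (by fun_prop) _ _)
      (Continuous.intervalIntegrable (by fun_prop) _ _)]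
    congr 1; ext y; ring
  rw [intervalIntegral.integral_add (Continuous.intervalIntegrable (by fun_prop) _ _)
      (Continuous.intervalIntegrable (by fun_prop) _ _)] at hre
  set E := ∫ y in z..T, s ^ 2 * (w y * P y) with hE
  set A := ∫ y in z..T, α * (w y * N y) with hA
  have hA0 : 0 ≤ A := intervalIntegral.integral_nonneg hzT fun y _ => by
    have := hd.n_nonneg y; have := hw y; positivity
  set S := w z * M
  have him' : D * X 0 ≤ D * C * S + Y / 4 + (G - 1) * E := by
    calc D * X 0 ≤ D * (C * S + C₂ * (1 / (4 * D * C₂) * Y + (1 / (4 * D * C₂))⁻¹ * E)) := by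
          gcongr
      _ = _ := by rw [hG]; field_simp; ring
  have hre' : G * (E + A) ≤ G * S + Y / 4 := by
    calc G * (E + A) ≤ G * (S + (1 / (8 * G) / 2 + 1 / (8 * G)) * Y) := by gcongr
      _ = G * S + 3 / 16 * Y := by field_simp; ring
      _ ≤ _ := by linarith
  have : A ≤ G * A := by nlinarith
  nlinarith

end Energy

/-! ### Functions of finite type and their frequency -/

/-- `F 0, F 1, …, F n` are successive derivatives, `F n` is bounded by `A`, and at every point one
of `F 0, …, F (n-1)` is at least `c` in absolute value. -/
structure IsFiniteType (n : ℕ) (F : ℕ → ℝ → ℝ) (c A : ℝ) : Prop where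
  hasDerivAt : ∀ k < n, ∀ y, HasDerivAt (F k) (F (k + 1) y) y
  continuous_top : Continuous (F n)
  top_le : ∀ y, |F n y| ≤ A
  nondegenerate : ∀ y, ∃ k < n, c ≤ |F k y|

lemma IsFiniteType.continuous {n : ℕ} {F : ℕ → ℝ → ℝ} {c A : ℝ} (h : IsFiniteType n F c A)
    {k : ℕ} (hk : k ≤ n) : Continuous (F k) := by
  rcases hk.eq_or_lt with rfl | hk
  · exact h.continuous_top
  · exact continuous_iff_continuousAt.2 fun y => (h.hasDerivAt k hk y).continuousAt

/-- The exponent `(n+2)! / (k+2)`, chosen so that `freqPow` is a polynomial in its arguments. -/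
def freqExp (n k : ℕ) : ℕ := (n + 2).factorial / (k + 2)

lemma mul_freqExp {n k : ℕ} (hk : k ≤ n) : (k + 2) * freqExp n k = (n + 2).factorial :=
  Nat.mul_div_cancel' (Nat.dvd_factorial (by omega) (by omega))

lemma freqExp_pos {n k : ℕ} (hk : k ≤ n) : 0 < freqExp n k :=
  Nat.pos_of_ne_zero fun h => by
    have := mul_freqExp hk
    rw [h, mul_zero] at this
    exact (Nat.factorial_pos _).ne this

/-- The `2 (n+2)!`-th power of `freq`. -/
noncomputable def freqPow (n : ℕ) (β : ℕ → ℝ → ℝ) (α s y : ℝ) : ℝ :=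
  α ^ (n + 2).factorial + ∑ k ∈ Finset.range (n + 1), ((s ^ k * β k y) ^ 2) ^ freqExp n k

/-- A smooth function comparable with the largest of `α ^ (1/2)` and
`(s ^ k * |β k y|) ^ (1 / (k + 2))`, `k ≤ n`: the inverse, in units of `s`, of the length `ℓ` at
which the oscillation of `β 0` near `y` is of order `s² / ℓ²`. -/
noncomputable def freq (n : ℕ) (β : ℕ → ℝ → ℝ) (α s y : ℝ) : ℝ :=
  freqPow n β α s y ^ (1 / (2 * ((n + 2).factorial : ℝ)))

/-- The derivative of `freq` with respect to its last argument. -/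
noncomputable def freqDeriv (n : ℕ) (β : ℕ → ℝ → ℝ) (α s y : ℝ) : ℝ :=
  (∑ k ∈ Finset.range (n + 1), (freqExp n k : ℝ) * ((s ^ k * β k y) ^ 2) ^ (freqExp n k - 1) *
    (2 * (s ^ k * β k y) * (s ^ k * β (k + 1) y))) / (2 * ((n + 2).factorial : ℝ)) *
    freq n β α s y / freqPow n β α s y

section Freq

variable {n : ℕ} {β : ℕ → ℝ → ℝ} {c A α s : ℝ}

lemma freqPow_nonneg (hα : 0 ≤ α) (y : ℝ) : 0 ≤ freqPow n β α s y := by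
  unfold freqPow; positivity

lemma freq_nonneg (hα : 0 ≤ α) (y : ℝ) : 0 ≤ freq n β α s y :=
  Real.rpow_nonneg (freqPow_nonneg hα y) _

lemma freq_pow (hα : 0 ≤ α) (y : ℝ) :
    freq n β α s y ^ (2 * (n + 2).factorial) = freqPow n β α s y := by
  have : (0 : ℝ) < (n + 2).factorial := by exact_mod_cast Nat.factorial_pos _
  rw [freq, ← Real.rpow_natCast, ← Real.rpow_mul (freqPow_nonneg hα y)]
  push_cast
  rw [one_div, inv_mul_cancel₀ (by positivity), Real.rpow_one]

lemma le_freq_sq (hα : 0 ≤ α) (y : ℝ) : α ≤ freq n β α s y ^ 2 := by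
  refine le_of_pow_le_pow_left₀ (Nat.factorial_ne_zero (n + 2)) (by positivity) ?_
  rw [← pow_mul, freq_pow hα]
  exact le_add_of_nonneg_right (by positivity)

lemma jet_le_freq (hα : 0 ≤ α) {k : ℕ} (hk : k ≤ n) (y : ℝ) :
    s ^ k * |β k y| ≤ freq n β α s y ^ (k + 2) := by
  have h0 := freq_nonneg (n := n) (β := β) (s := s) hα y
  refine le_of_pow_le_pow_left₀ (n := 2 * freqExp n k)
    (mul_ne_zero two_ne_zero (freqExp_pos hk).ne') (by positivity) ?_
  rw [← pow_mul, show (k + 2) * (2 * freqExp n k) = 2 * (n + 2).factorial by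
    rw [← mul_freqExp hk]; ring, freq_pow hα]
  have : (s ^ k * |β k y|) ^ (2 * freqExp n k) = ((s ^ k * β k y) ^ 2) ^ freqExp n k := by
    rw [pow_mul, mul_pow (s ^ k), sq_abs, ← mul_pow (s ^ k)]
  rw [this]
  refine (Finset.single_le_sum (f := fun k => ((s ^ k * β k y) ^ 2) ^ freqExp n k)
    (fun i _ => by positivity) (Finset.mem_range.2 (Nat.lt_succ_of_le hk))).trans ?_
  exact le_add_of_nonneg_left (by positivity)

lemma le_freq_pow (hα : 0 ≤ α) (hs : 0 < s) (hs1 : s ≤ 1) (hc : 0 < c) (hc1 : c ≤ 1) {y : ℝ}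
    {m : ℕ} (hm : m ≤ n) (h : ∃ k ≤ m, c ≤ |β k y|) :
    c ^ (m + 2) * s ^ m ≤ freq n β α s y ^ (m + 2) := by
  obtain ⟨k, hk, hck⟩ := h
  have h0 := freq_nonneg (n := n) (β := β) (s := s) hα y
  refine le_of_pow_le_pow_left₀ (n := k + 2) (by omega) (by positivity) ?_
  have h1 := jet_le_freq (β := β) (s := s) hα (hk.trans hm) y
  calc (c ^ (m + 2) * s ^ m) ^ (k + 2) = c ^ ((m + 2) * (k + 2)) * s ^ (m * (k + 2)) := by
        rw [mul_pow, ← pow_mul, ← pow_mul]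
    _ ≤ c ^ (m + 2) * s ^ (k * (m + 2)) := by
        gcongr ?_ * ?_
        · exact pow_le_pow_of_le_one hc.le hc1 (Nat.le_mul_of_pos_right _ (by omega))
        · exact pow_le_pow_of_le_one hs.le hs1 (by nlinarith)
    _ = (s ^ k * c) ^ (m + 2) := by rw [mul_pow, ← pow_mul]; ring
    _ ≤ (freq n β α s y ^ (k + 2)) ^ (m + 2) := by
        gcongr
        exact (by gcongr : s ^ k * c ≤ s ^ k * |β k y|).trans h1
    _ = _ := by rw [← pow_mul, ← pow_mul, mul_comm]

lemma mul_le_freq (hα : 0 ≤ α) (hs : 0 < s) (hs1 : s ≤ 1) (hc : 0 < c) (hc1 : c ≤ 1) {y : ℝ}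
    (h : ∃ k ≤ n, c ≤ |β k y|) : c * s ≤ freq n β α s y := by
  have h0 := freq_nonneg (n := n) (β := β) (s := s) hα y
  refine le_of_pow_le_pow_left₀ (n := n + 2) (by omega) h0 ?_
  rw [mul_pow]
  refine le_trans ?_ (le_freq_pow hα hs hs1 hc hc1 le_rfl h)
  exact mul_le_mul_of_nonneg_left (pow_le_pow_of_le_one hs.le hs1 (Nat.le_add_right n 2))
    (by positivity)

/-- Enlarging `s` by the factor `m` enlarges the frequency by at most `m ^ (n/(n+2))`, which is
negligible against `m`. -/
lemma freq_pow_le_freq_mul (hα : 0 ≤ α) {m : ℝ} (hm : 1 ≤ m) (y : ℝ) :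
    freq n β α (m * s) y ^ (n + 2) ≤ m ^ n * freq n β α s y ^ (n + 2) := by
  have h0 := freq_nonneg (n := n) (β := β) (s := s) hα y
  refine le_of_pow_le_pow_left₀ (n := 2 * freqExp n n)
    (mul_ne_zero two_ne_zero (freqExp_pos le_rfl).ne') (by positivity) ?_
  have e : ∀ s, (freq n β α s y ^ (n + 2)) ^ (2 * freqExp n n) = freqPow n β α s y := fun s => by
    rw [← pow_mul, show (n + 2) * (2 * freqExp n n) = 2 * (n + 2).factorial by
      rw [← mul_freqExp le_rfl]; ring, freq_pow hα]
  rw [mul_pow, e, e, ← pow_mul, freqPow, freqPow, mul_add, Finset.mul_sum]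
  refine add_le_add (le_mul_of_one_le_left (by positivity) (one_le_pow₀ hm))
    (Finset.sum_le_sum fun k hk => ?_)
  have hk : k ≤ n := by simp at hk; omega
  have e2 : ((((m * s) ^ k) * β k y) ^ 2) ^ freqExp n k
      = m ^ (k * (2 * freqExp n k)) * ((s ^ k * β k y) ^ 2) ^ freqExp n k := by
    rw [mul_pow m s k, mul_assoc, mul_pow _ _ 2, mul_pow _ _ (freqExp n k), ← pow_mul, ← pow_mul]
  rw [e2]
  gcongr ?_ * _
  refine pow_le_pow_right₀ hm ?_
  have h1 := mul_freqExp hk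
  have h2 := mul_freqExp (le_refl n)
  have h3 : freqExp n n ≤ freqExp n k := Nat.div_le_div_left (by omega) (by omega)
  nlinarith

lemma freq_le_freq_mul (hα : 0 ≤ α) (hs : 0 ≤ s) {m : ℝ} (hm : 1 ≤ m) (y : ℝ) :
    freq n β α s y ≤ freq n β α (m * s) y := by
  refine Real.rpow_le_rpow (freqPow_nonneg hα y) ?_ (by positivity)
  unfold freqPow
  refine add_le_add_right (Finset.sum_le_sum fun k _ => ?_) _
  rw [mul_pow (s ^ k), mul_pow ((m * s) ^ k)]
  gcongr
  nlinarith

lemma freq_periodic {T : ℝ} (hβ : ∀ k ≤ n, Function.Periodic (β k) T) :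
    Function.Periodic (freq n β α s) T := fun y => by
  unfold freq freqPow
  congr 2
  refine Finset.sum_congr rfl fun k hk => ?_
  rw [hβ k (by simp at hk; omega) y]

/-- `freq` is a frequency, with a constant that does not depend on `α`, `s` and `β 0`. -/
theorem exists_isFrequency_freq (n : ℕ) (c A : ℝ) (hc : 0 < c) (hc1 : c ≤ 1) (hA : 0 ≤ A) :
    ∃ C : ℝ, 1 ≤ C ∧ ∀ (β : ℕ → ℝ → ℝ) (α s : ℝ), 0 ≤ α → 0 < s → s ≤ 1 →
      (∀ y, HasDerivAt (β 0) (β 1 y) y) → IsFiniteType n (fun k => β (k + 1)) c A →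
      IsFrequency n β α s C (freq n β α s) (freqDeriv n β α s) := by
  set C₁ : ℝ := 1 + A / c ^ (n + 3) with hC₁
  have hC₁1 : 1 ≤ C₁ := le_add_of_nonneg_right (by positivity)
  set C₂ : ℝ := ∑ k ∈ Finset.range (n + 1), (freqExp n k : ℝ) * (2 * C₁) with hC₂
  have hC₂0 : 0 ≤ C₂ := Finset.sum_nonneg fun k _ => by positivity
  refine ⟨C₁ + C₂, by linarith, fun β α s hα hs hs1 hβ0 hF => ?_⟩
  have hnd : ∀ y, ∃ k ≤ n, c ≤ |β k y| := fun y => by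
    obtain ⟨k, hk, h⟩ := hF.nondegenerate y
    exact ⟨k + 1, hk, h⟩
  have hpos : ∀ y, 0 < freq n β α s y := fun y =>
    (by positivity : 0 < c * s).trans_le (mul_le_freq hα hs hs1 hc hc1 (hnd y))
  have hPpos : ∀ y, 0 < freqPow n β α s y := fun y => by
    rw [← freq_pow hα]; exact pow_pos (hpos y) _
  have hβd : ∀ k ≤ n, ∀ y, HasDerivAt (β k) (β (k + 1) y) y := by
    intro k hk y
    cases k with
    | zero => exact hβ0 y
    | succ k => exact hF.hasDerivAt k (by omega) y
  have hβc : ∀ k ≤ n + 1, Continuous (β k) := by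
    intro k hk
    cases k with
    | zero => exact continuous_iff_continuousAt.2 fun y => (hβ0 y).continuousAt
    | succ k => exact hF.continuous (k := k) (by omega)
  have hjet : ∀ k ≤ n + 1, ∀ y, s ^ k * |β k y| ≤ C₁ * freq n β α s y ^ (k + 2) := by
    intro k hk y
    have hp := hpos y
    rcases Nat.lt_or_ge n k with h1 | h1
    · obtain rfl : k = n + 1 := by omega
      have i1 := le_freq_pow hα hs hs1 hc hc1 le_rfl (hnd y)
      have i2 := mul_le_freq hα hs hs1 hc hc1 (hnd y)
      have i3 : c ^ (n + 3) * s ^ (n + 1) ≤ freq n β α s y ^ (n + 1 + 2) := by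
        calc c ^ (n + 3) * s ^ (n + 1) = (c ^ (n + 2) * s ^ n) * (c * s) := by ring
          _ ≤ freq n β α s y ^ (n + 2) * freq n β α s y := by gcongr
          _ = _ := by ring
      calc s ^ (n + 1) * |β (n + 1) y| ≤ s ^ (n + 1) * A := by gcongr; exact hF.top_le y
        _ = A / c ^ (n + 3) * (c ^ (n + 3) * s ^ (n + 1)) := by field_simp
        _ ≤ A / c ^ (n + 3) * freq n β α s y ^ (n + 1 + 2) := by gcongr
        _ ≤ _ := by gcongr; linarith
    · exact (jet_le_freq hα h1 y).trans (le_mul_of_one_le_left (by positivity) hC₁1)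
  have hQ : (0 : ℝ) < (n + 2).factorial := by exact_mod_cast Nat.factorial_pos _
  have hfc : Continuous (freqPow n β α s) := by
    unfold freqPow
    refine continuous_const.add (continuous_finsetSum _ fun k hk => ?_)
    have := hβc k (by simp at hk; omega)
    fun_prop
  have hderiv : ∀ y, HasDerivAt (freq n β α s) (freqDeriv n β α s y) y := by
    intro y
    have h1 : HasDerivAt (freqPow n β α s) (∑ k ∈ Finset.range (n + 1),
        (freqExp n k : ℝ) * ((s ^ k * β k y) ^ 2) ^ (freqExp n k - 1) *
        (2 * (s ^ k * β k y) * (s ^ k * β (k + 1) y))) y := by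
      unfold freqPow
      refine HasDerivAt.const_add _ (HasDerivAt.fun_sum fun k hk => ?_)
      have := (((hβd k (by simp at hk; omega) y).const_mul (s ^ k)).fun_pow 2).fun_pow (freqExp n k)
      refine this.congr_deriv ?_
      simp
    have h2 := h1.rpow_const (p := 1 / (2 * ((n + 2).factorial : ℝ))) (Or.inl (hPpos y).ne')
    refine h2.congr_deriv ?_
    rw [Real.rpow_sub_one (hPpos y).ne', freqDeriv, freq]
    ring
  have hfreqc : Continuous (freq n β α s) :=
    continuous_iff_continuousAt.2 fun y => (hderiv y).continuousAt
  refine ⟨hpos, hderiv, ?_, ?_, ?_, ?_⟩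
  · unfold freqDeriv
    refine Continuous.div (Continuous.mul (Continuous.div_const
      (continuous_finsetSum _ fun k hk => ?_) _) hfreqc) hfc fun y => (hPpos y).ne'
    have := hβc k (by simp at hk; omega)
    have := hβc (k + 1) (by simp at hk; omega)
    fun_prop
  · intro y
    have hp := hpos y
    set ρ := freq n β α s y with hρ
    have hsum : s * |∑ k ∈ Finset.range (n + 1),
        (freqExp n k : ℝ) * ((s ^ k * β k y) ^ 2) ^ (freqExp n k - 1) *
        (2 * (s ^ k * β k y) * (s ^ k * β (k + 1) y))| ≤ C₂ * ρ ^ (2 * (n + 2).factorial + 1) := by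
      rw [hC₂, Finset.sum_mul]
      calc _ ≤ s * ∑ k ∈ Finset.range (n + 1),
            |(freqExp n k : ℝ) * ((s ^ k * β k y) ^ 2) ^ (freqExp n k - 1) *
            (2 * (s ^ k * β k y) * (s ^ k * β (k + 1) y))| := by
            gcongr; exact Finset.abs_sum_le_sum_abs _ _
        _ = ∑ k ∈ Finset.range (n + 1), s *
            |(freqExp n k : ℝ) * ((s ^ k * β k y) ^ 2) ^ (freqExp n k - 1) *
            (2 * (s ^ k * β k y) * (s ^ k * β (k + 1) y))| := by rw [Finset.mul_sum]
        _ ≤ _ := Finset.sum_le_sum fun k hk => ?_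
      have hk : k ≤ n := by simp at hk; omega
      have i1 := jet_le_freq (β := β) (s := s) hα hk y
      have i2 := hjet (k + 1) (by omega) y
      rw [← hρ] at i1 i2
      have e : s * |(freqExp n k : ℝ) * ((s ^ k * β k y) ^ 2) ^ (freqExp n k - 1) *
            (2 * (s ^ k * β k y) * (s ^ k * β (k + 1) y))| =
          (freqExp n k : ℝ) * ((s ^ k * |β k y|) ^ 2) ^ (freqExp n k - 1) *
            (2 * (s ^ k * |β k y|) * (s ^ (k + 1) * |β (k + 1) y|)) := by
        simp only [abs_mul, abs_pow, Nat.abs_cast, abs_two, abs_of_pos hs]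
        ring
      rw [e]
      calc _ ≤ (freqExp n k : ℝ) * ((ρ ^ (k + 2)) ^ 2) ^ (freqExp n k - 1) *
            (2 * (ρ ^ (k + 2)) * (C₁ * ρ ^ (k + 1 + 2))) := by gcongr
        _ = (freqExp n k : ℝ) * (2 * C₁) * ρ ^ (2 * ((k + 2) * (freqExp n k - 1 + 1)) + 1) := by
          rw [← pow_mul, ← pow_mul]; ring
        _ = _ := by rw [Nat.sub_add_cancel (freqExp_pos hk), mul_freqExp hk]
    have hQ1 : (1 : ℝ) ≤ 2 * (n + 2).factorial := by
      have : (1 : ℝ) ≤ (n + 2).factorial := by exact_mod_cast Nat.factorial_pos _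
      linarith
    rw [freqDeriv, ← hρ, abs_div, abs_mul, abs_div, abs_of_pos hp, abs_of_pos (hPpos y),
      abs_of_pos (by positivity : (0 : ℝ) < 2 * (n + 2).factorial), ← freq_pow hα, ← hρ]
    rw [pow_succ] at hsum
    set S := |∑ k ∈ Finset.range (n + 1),
        (freqExp n k : ℝ) * ((s ^ k * β k y) ^ 2) ^ (freqExp n k - 1) *
        (2 * (s ^ k * β k y) * (s ^ k * β (k + 1) y))|
    calc s * (S / (2 * (n + 2).factorial) * ρ / ρ ^ (2 * (n + 2).factorial))
        = (s * S) / (2 * (n + 2).factorial) * (ρ / ρ ^ (2 * (n + 2).factorial)) := by ring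
      _ ≤ (C₂ * (ρ ^ (2 * (n + 2).factorial) * ρ)) / 1 * (ρ / ρ ^ (2 * (n + 2).factorial)) := by
        gcongr
      _ = C₂ * ρ ^ 2 := by field_simp
      _ ≤ _ := by gcongr; linarith
  · intro k hk y
    have hp := hpos y
    refine (hjet k hk y).trans ?_
    gcongr
    linarith
  · intro y
    have hp := hpos y
    have h1 : 1 = (α / freq n β α s y ^ 2) ^ (n + 2).factorial + ∑ k ∈ Finset.range (n + 1),
        ((s ^ k * β k y / freq n β α s y ^ (k + 2)) ^ 2) ^ freqExp n k := by
      have e : ∀ k ∈ Finset.range (n + 1),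
          ((s ^ k * β k y / freq n β α s y ^ (k + 2)) ^ 2) ^ freqExp n k =
          ((s ^ k * β k y) ^ 2) ^ freqExp n k / freq n β α s y ^ (2 * (n + 2).factorial) := by
        intro k hk
        rw [div_pow, div_pow, ← mul_freqExp (show k ≤ n by simp at hk; omega), ← pow_mul _ (k + 2),
          ← pow_mul _ ((k + 2) * 2)]
        ring_nf
      rw [Finset.sum_congr rfl e, ← Finset.sum_div, div_pow, ← pow_mul, ← add_div, freq_pow hα]
      exact (div_self (hPpos y).ne').symm
    calc (1 : ℝ) = _ := h1
      _ ≤ _ := by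
        refine add_le_add (pow_le_of_le_one (by positivity) ?_ (Nat.factorial_ne_zero _))
          (Finset.sum_le_sum fun k hk => ?_)
        · rw [div_le_one (by positivity)]
          exact le_freq_sq hα y
        · have hk : k ≤ n := by simp at hk; omega
          refine pow_le_of_le_one (by positivity) ?_ (freqExp_pos hk).ne'
          rw [sq_le_one_iff_abs_le_one, abs_div, abs_mul, abs_of_pos (pow_pos hs k),
            abs_of_pos (pow_pos hp _), div_le_one (pow_pos hp _)]
          exact jet_le_freq hα hk y

end Freq

/-! ### Regularity of distributional solutions -/

/-- A continuous periodic function whose nonzero Fourier modes on `[z, z + 2π]` vanish is constant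
there. -/
lemma eq_const_of_integral_exp_eq_zero {z : ℝ} {f : ℝ → ℂ} (hf : Continuous f)
    (hp : f (z + 2 * Real.pi) = f z)
    (h : ∀ n : ℤ, n ≠ 0 →
      ∫ y in z..(z + 2 * Real.pi), Complex.exp (Complex.I * n * y) * f y = 0) :
    ∃ c : ℂ, ∀ y ∈ Icc z (z + 2 * Real.pi), f y = c := by
  have : Fact (0 < 2 * Real.pi) := ⟨Real.two_pi_pos⟩
  have hG : Continuous (AddCircle.liftIco (2 * Real.pi) z f) :=
    AddCircle.liftIco_continuous hp.symm hf.continuousOn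
  set G : C(AddCircle (2 * Real.pi), ℂ) := ⟨_, hG⟩ with hGd
  have hcoef : ∀ n : ℤ, n ≠ 0 → fourierCoeff G n = 0 := by
    intro n hn
    change fourierCoeff (AddCircle.liftIco (2 * Real.pi) z f) n = 0
    rw [fourierCoeff_liftIco_eq, fourierCoeffOn_eq_integral]
    have e : ∀ y : ℝ, (fourier (-n) (y : AddCircle (z + 2 * Real.pi - z)) : ℂ) • f y
        = Complex.exp (Complex.I * ((-n : ℤ) : ℂ) * y) * f y := by
      intro y
      rw [fourier_coe_apply, smul_eq_mul]
      congr 2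
      have : (Real.pi : ℂ) ≠ 0 := by exact_mod_cast Real.pi_ne_zero
      push_cast
      rw [add_sub_cancel_left]
      field_simp
    simp only [e]
    rw [h (-n) (by simpa using hn), smul_zero]
  have hs : Summable (fourierCoeff G) :=
    summable_of_ne_finset_zero (s := {0}) fun n hn => hcoef n (by simpa using hn)
  refine ⟨fourierCoeff G 0, ?_⟩
  have hval : ∀ x, G x = fourierCoeff G 0 := by
    intro x
    have h1 := has_pointwise_sum_fourier_series_of_summable hs x
    have h2 := hasSum_single (f := fun i => fourierCoeff G i • fourier i x) 0 fun n hn => by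
      simp [hcoef n hn]
    have := h1.unique h2
    simpa using this
  intro y hy
  rcases hy.2.eq_or_lt with rfl | hlt
  · rw [hp, ← hval (z : AddCircle (2 * Real.pi))]
    exact (AddCircle.liftIco_coe_apply (f := f) ⟨le_rfl, by linarith [Real.two_pi_pos]⟩).symm
  · rw [← hval (y : AddCircle (2 * Real.pi))]
    exact (AddCircle.liftIco_coe_apply (f := f) ⟨hy.1, hlt⟩).symm

/-- A continuous distributional solution coincides on `[z, z + 2π]` with a function `k` of class
`C²`, and its derivative jumps by `-1 / ε` at `z`. -/
theorem IsFundamentalSolution.exists_classical {b : ℝ → ℝ} {N : ℕ} {σ₀ ε α lam z : ℝ} {K : ℝ → ℂ}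
    (h : IsFundamentalSolution b N σ₀ ε α lam z K) (hε : 0 < ε) (hb : Continuous b)
    (hbp : Function.Periodic b (2 * Real.pi)) :
    ∃ k dk : ℝ → ℂ, (∀ y ∈ Icc z (z + 2 * Real.pi), k y = K y) ∧
      (∀ y, HasDerivAt k (dk y) y) ∧
      (∀ y, HasDerivAt dk ((((α - σ₀ * ε ^ (((N : ℝ) + 1) / ((N : ℝ) + 3)) : ℝ) : ℂ)
        + Complex.I * ((b y - lam : ℝ) : ℂ)) / ε * K y) y) ∧
      dk (z + 2 * Real.pi) - dk z = 1 / ε := by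
  obtain ⟨hK, hKp, hsol⟩ := h
  have hε' : (ε : ℂ) ≠ 0 := by exact_mod_cast hε.ne'
  set a : ℝ := α - σ₀ * ε ^ (((N : ℝ) + 1) / ((N : ℝ) + 3))
  set T := z + 2 * Real.pi with hT
  set V : ℝ → ℂ := fun y => (a : ℂ) + Complex.I * ((b y - lam : ℝ) : ℂ) with hV
  have hVc : Continuous V := by fun_prop
  set F : ℝ → ℂ := fun y => V y / ε * K y with hF
  have hFc : Continuous F := by fun_prop
  set D₀ : ℝ → ℂ := fun y => ∫ x in z..y, F x with hD₀
  have hD₀d : ∀ y, HasDerivAt D₀ (F y) y := fun y => hFc.integral_hasStrictDerivAt z y |>.hasDerivAt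
  have hD₀c : Continuous D₀ := continuous_iff_continuousAt.2 fun y => (hD₀d y).continuousAt
  set m : ℂ := (∫ x in z..T, D₀ x) / (2 * Real.pi) with hm
  set D : ℝ → ℂ := fun y => D₀ y - m with hD
  have hDd : ∀ y, HasDerivAt D (F y) y := fun y => (hD₀d y).sub_const m
  have hDc : Continuous D := hD₀c.sub continuous_const
  set P : ℝ → ℂ := fun y => ∫ x in z..y, D x with hP
  have hPd : ∀ y, HasDerivAt P (D y) y := fun y => hDc.integral_hasStrictDerivAt z y |>.hasDerivAt
  have hPc : Continuous P := continuous_iff_continuousAt.2 fun y => (hPd y).continuousAt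
  have hPz : P z = 0 := by simp [hP]
  have hπ : (Real.pi : ℂ) ≠ 0 := by exact_mod_cast Real.pi_ne_zero
  have hPT : P T = 0 := by
    simp only [hP, hD]
    rw [intervalIntegral.integral_sub (hD₀c.intervalIntegrable _ _) (by simp),
      intervalIntegral.integral_const, hT, add_sub_cancel_left, ← hT, hm]
    rw [Complex.real_smul]
    push_cast
    field_simp
    ring
  -- the weak formulation over the period `[z, T]`
  have hsol' : ∀ φ φ' φ'' : ℝ → ℂ, ContDiff ℝ ∞ φ → Function.Periodic φ (2 * Real.pi) →
      (∀ y, HasDerivAt φ (φ' y) y) → (∀ y, HasDerivAt φ' (φ'' y) y) → Continuous φ'' →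
      Function.Periodic φ'' (2 * Real.pi) →
      ∫ y in z..T, (-(ε : ℂ) * (K y * φ'' y) + ε * (F y * φ y)) = φ z := by
    intro φ φ' φ'' hφ hφp h1 h2 h2c h2p
    have e : iteratedDeriv 2 φ = φ'' := by
      rw [iteratedDeriv_succ, iteratedDeriv_one, (funext fun y => (h1 y).deriv : deriv φ = φ')]
      exact funext fun y => (h2 y).deriv
    rw [← hsol φ hφ hφp, e]
    have hper : Function.Periodic (fun y => -(ε : ℂ) * (K y * φ'' y) + ε * (F y * φ y))
        (2 * Real.pi) := fun y => by
      simp only [hF, hV, hKp y, h2p y, hφp y, hbp y]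
    rw [hT, hper.intervalIntegral_add_eq z 0, zero_add]
    refine intervalIntegral.integral_congr fun y _ => ?_
    simp only [hF, hV]
    field_simp
    ring
  have hjump : D T - D z = 1 / ε := by
    have h1 := hsol' (fun _ => 1) (fun _ => 0) (fun _ => 0) contDiff_const (fun _ => rfl)
      (fun y => hasDerivAt_const y _) (fun y => hasDerivAt_const y _) continuous_const
      (fun _ => rfl)
    simp only [mul_zero, zero_add, mul_one, intervalIntegral.integral_const_mul] at h1
    have h2 : D T - D z = ∫ y in z..T, F y := by simp [hD, hD₀]
    rw [h2]
    field_simp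
    linear_combination h1
  have horth : ∀ n : ℤ, n ≠ 0 →
      ∫ y in z..T, Complex.exp (Complex.I * n * y) * (K y - P y) = 0 := by
    intro n hn
    set e : ℝ → ℂ := fun y => Complex.exp (Complex.I * n * y) with he
    have hed : ∀ y, HasDerivAt e (Complex.I * n * e y) y := fun y => by
      have h1 : HasDerivAt (fun y : ℝ => Complex.I * n * (y : ℂ)) (Complex.I * n) y := by
        simpa using (Complex.ofRealCLM.hasDerivAt (x := y)).const_mul (Complex.I * n)
      exact h1.cexp.congr_deriv (by rw [he]; ring)
    have hed2 : ∀ y, HasDerivAt (fun y => Complex.I * n * e y) (-(n : ℂ) ^ 2 * e y) y := fun y => by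
      refine ((hed y).const_mul (Complex.I * n)).congr_deriv ?_
      linear_combination (n : ℂ) ^ 2 * e y * Complex.I_sq
    have hesm : ContDiff ℝ ∞ e := by
      have : ContDiff ℝ ∞ (fun y : ℝ => Complex.I * n * (y : ℂ)) :=
        contDiff_const.mul Complex.ofRealCLM.contDiff
      exact this.cexp
    have hec : Continuous e := hesm.continuous
    have hep : Function.Periodic e (2 * Real.pi) := fun y => by
      simp only [he]
      push_cast
      rw [show Complex.I * n * (y + 2 * Real.pi) = Complex.I * n * y + n * (2 * Real.pi * Complex.I)
        by ring, Complex.exp_add, Complex.exp_int_mul_two_pi_mul_I, mul_one]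
    have h1 := hsol' e _ _ hesm hep hed hed2 (by fun_prop) fun y => by simp only [hep y]
    have h2 : ∫ y in z..T, (P y * (-(n : ℂ) ^ 2 * e y) - F y * e y) =
        (P T * (Complex.I * n * e T) - D T * e T) - (P z * (Complex.I * n * e z) - D z * e z) := by
      refine intervalIntegral.integral_eq_sub_of_hasDerivAt
        (f := fun y => P y * (Complex.I * n * e y) - D y * e y) (fun y _ => ?_)
        (Continuous.intervalIntegrable (by fun_prop) _ _)
      exact (((hPd y).mul (hed2 y)).sub ((hDd y).mul (hed y))).congr_deriv (by ring)
    have heT : e T = e z := hep z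
    rw [hPT, hPz, heT] at h2
    have h3 : ∫ y in z..T, (P y * (-(n : ℂ) ^ 2 * e y) - F y * e y) = - (1 / ε) * e z := by
      rw [h2, ← hjump]; ring
    have h4 : (ε : ℂ) * (n : ℂ) ^ 2 * ∫ y in z..T, e y * (K y - P y) = 0 := by
      rw [← intervalIntegral.integral_const_mul]
      have : ∫ y in z..T, (ε : ℂ) * (n : ℂ) ^ 2 * (e y * (K y - P y)) =
          (∫ y in z..T, (-(ε : ℂ) * (K y * (-(n : ℂ) ^ 2 * e y)) + ε * (F y * e y)))
          + ε * ∫ y in z..T, (P y * (-(n : ℂ) ^ 2 * e y) - F y * e y) := by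
        rw [← intervalIntegral.integral_const_mul, ← intervalIntegral.integral_add
          (Continuous.intervalIntegrable (by fun_prop) _ _)
          (Continuous.intervalIntegrable (by fun_prop) _ _)]
        refine intervalIntegral.integral_congr fun y _ => ?_
        ring
      rw [this, h1, h3]
      field_simp
      ring
    have hn' : (n : ℂ) ^ 2 ≠ 0 := pow_ne_zero _ (by exact_mod_cast hn)
    exact (mul_eq_zero.1 h4).resolve_left (mul_ne_zero hε' hn')
  obtain ⟨c, hc⟩ := eq_const_of_integral_exp_eq_zero (z := z) (f := fun y => K y - P y)
    (hK.sub hPc) (by simp only [← hT]; rw [hPT, hPz, hT, hKp z]) horth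
  refine ⟨fun y => P y + c, D, fun y hy => ?_, fun y => (hPd y).add_const c, hDd, hjump⟩
  rw [← hc y hy]; ring

/-! ### Doubling for functions of finite type -/

/-- Taylor's formula for a sequence of successive derivatives. The constant `A` in place of
`A / n!` suffices here. -/
lemma abs_sub_taylor_le (n : ℕ) {A : ℝ} (hA : 0 ≤ A) : ∀ F : ℕ → ℝ → ℝ,
    (∀ k < n, ∀ y, HasDerivAt (F k) (F (k + 1) y) y) → (∀ y, |F n y| ≤ A) → ∀ z u : ℝ,
    |F 0 (z + u) - ∑ k ∈ Finset.range n, F k z * u ^ k / k.factorial| ≤ A * |u| ^ n := by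
  induction n with
  | zero => intro F _ h z u; simpa using h (z + u)
  | succ n ih =>
    intro F hF hb z u
    have ih' := ih (fun k => F (k + 1)) (fun k hk => hF (k + 1) (by omega)) hb z
    set g : ℝ → ℝ := fun u => F 0 (z + u) - ∑ k ∈ Finset.range (n + 1), F k z * u ^ k / k.factorial
    have hg : ∀ x, HasDerivAt g
        (F 1 (z + x) - ∑ k ∈ Finset.range n, F (k + 1) z * x ^ k / k.factorial) x := by
      intro x
      have h1 : HasDerivAt (fun u => F 0 (z + u)) (F 1 (z + x)) x :=
        (hF 0 (by omega) (z + x)).comp_const_add z x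
      have h2 : HasDerivAt (fun u : ℝ => ∑ k ∈ Finset.range (n + 1), F k z * u ^ k / k.factorial)
          (∑ k ∈ Finset.range n, F (k + 1) z * x ^ k / k.factorial) x := by
        have h3 : ∀ k ∈ Finset.range (n + 1), HasDerivAt (fun u : ℝ => F k z * u ^ k / k.factorial)
            (F k z * (k * x ^ (k - 1)) / k.factorial) x := fun k _ =>
          ((hasDerivAt_pow k x).const_mul _).div_const _
        refine (HasDerivAt.fun_sum h3).congr_deriv ?_
        rw [Finset.sum_range_succ']
        simp only [Nat.cast_zero, zero_mul, mul_zero, zero_div, add_zero]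
        refine Finset.sum_congr rfl fun k _ => ?_
        rw [Nat.factorial_succ, Nat.add_sub_cancel]
        push_cast
        have : (k.factorial : ℝ) ≠ 0 := by exact_mod_cast Nat.factorial_ne_zero k
        field_simp
      exact h1.sub h2
    have hg0 : g 0 = 0 := by
      simp only [g]
      rw [Finset.sum_range_succ']
      simp
    have := Convex.norm_image_sub_le_of_norm_hasDerivWithin_le (f := g) (C := A * |u| ^ n)
      (s := uIcc 0 u) (x := 0) (y := u) (fun x _ => (hg x).hasDerivWithinAt) (fun x hx => by
        rw [Real.norm_eq_abs]
        refine (ih' x).trans ?_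
        have hxu : |x| ≤ |u| := by simpa using abs_sub_left_of_mem_uIcc hx
        gcongr) (convex_uIcc _ _) left_mem_uIcc right_mem_uIcc
    rw [hg0, sub_zero, sub_zero, Real.norm_eq_abs, Real.norm_eq_abs] at this
    calc _ ≤ A * |u| ^ n * |u| := this
      _ = _ := by ring

/-- On polynomials of bounded degree the `L¹` norm over `[0, 1]` controls the coefficients. -/
lemma exists_le_integral_abs_poly (n : ℕ) : ∃ m : ℝ, 0 < m ∧ ∀ p : Fin n → ℝ,
    m * ‖p‖ ≤ ∫ t in (0 : ℝ)..1, |∑ i, p i * t ^ (i : ℕ)| := by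
  have hcont : Continuous fun p : Fin n → ℝ => ∫ t in (0 : ℝ)..1, |∑ i, p i * t ^ (i : ℕ)| := by
    refine intervalIntegral.continuous_parametric_intervalIntegral_of_continuous' ?_ 0 1
    fun_prop
  have hpos : ∀ p ∈ Metric.sphere (0 : Fin n → ℝ) 1,
      0 < ∫ t in (0 : ℝ)..1, |∑ i, p i * t ^ (i : ℕ)| := by
    intro p hp
    have hp0 : p ≠ 0 := by
      rintro rfl
      simp at hp
    refine intervalIntegral.integral_pos one_pos (by fun_prop) (fun _ _ => abs_nonneg _) ?_
    by_contra! hcon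
    set q : Polynomial ℝ := ∑ i : Fin n, Polynomial.C (p i) * Polynomial.X ^ (i : ℕ) with hq
    have hq0 : q = 0 := by
      refine Polynomial.eq_zero_of_infinite_isRoot q ((Icc_infinite one_pos).mono fun t ht => ?_)
      have h1 := abs_nonpos_iff.1 (hcon t ht)
      simp only [mem_ofPred_eq, Polynomial.IsRoot.def, hq, Polynomial.eval_finsetSum,
        Polynomial.eval_mul, Polynomial.eval_C, Polynomial.eval_pow, Polynomial.eval_X, h1]
    refine hp0 (funext fun j => ?_)
    have h2 : q.coeff j = p j := by
      simp [hq, Polynomial.coeff_X_pow, Fin.val_inj]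
    rw [← h2, hq0]
    simp
  obtain ⟨m, hm, hmin⟩ :=
    (isCompact_sphere (0 : Fin n → ℝ) 1).exists_forall_le' hcont.continuousOn hpos
  refine ⟨m, hm, fun p => ?_⟩
  rcases eq_or_ne p 0 with rfl | hp
  · simp
  have hnp : 0 < ‖p‖ := norm_pos_iff.2 hp
  have h1 := hmin (‖p‖⁻¹ • p) (by simp [norm_smul, hnp.ne'])
  have h2 : ∀ t : ℝ, |∑ i, (‖p‖⁻¹ • p) i * t ^ (i : ℕ)| = ‖p‖⁻¹ * |∑ i, p i * t ^ (i : ℕ)| := by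
    intro t
    rw [← abs_of_pos (inv_pos.2 hnp), ← abs_mul, abs_of_pos (inv_pos.2 hnp), Finset.mul_sum]
    congr 1
    exact Finset.sum_congr rfl fun i _ => by simp [mul_assoc]
  simp only [h2, intervalIntegral.integral_const_mul] at h1
  rw [inv_mul_eq_div, le_div_iff₀ hnp] at h1
  exact h1

/-- On short intervals a function of finite type is a small perturbation of its Taylor polynomial,
so its supremum is controlled by its mean. -/
theorem exists_sup_le_mean (n : ℕ) (c A : ℝ) (hc : 0 < c) (hA : 0 ≤ A) :
    ∃ h₀ C : ℝ, 0 < h₀ ∧ 0 < C ∧ ∀ F : ℕ → ℝ → ℝ, IsFiniteType n F c A →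
      ∀ z h : ℝ, 0 < h → h ≤ h₀ →
        (∀ x ∈ Icc z (z + h), h * |F 0 x| ≤ C * ∫ y in z..(z + h), |F 0 y|) ∧
        h ^ n ≤ C * ∫ y in z..(z + h), |F 0 y| := by
  obtain ⟨m, hm, hmin⟩ := exists_le_integral_abs_poly n
  have hfac : (0 : ℝ) < n.factorial := by exact_mod_cast Nat.factorial_pos n
  set h₀ : ℝ := min 1 (m * c / (2 * (A * n.factorial + 1))) with hh₀
  set C : ℝ := 2 * (n + m / 2) / m + 2 * n.factorial / (m * c) with hC
  refine ⟨h₀, C, lt_min one_pos (by positivity), by positivity, fun F hF z h h0 hh => ?_⟩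
  have hh1 : h ≤ 1 := hh.trans (min_le_left _ _)
  set p : Fin n → ℝ := fun i => F i z * h ^ (i : ℕ) / (i : ℕ).factorial with hp
  have hpn : c * h ^ n ≤ n.factorial * h * ‖p‖ := by
    obtain ⟨k, hk, hck⟩ := hF.nondegenerate z
    have h1 : |F k z * h ^ k / k.factorial| ≤ ‖p‖ := norm_le_pi_norm p ⟨k, hk⟩
    rw [abs_div, abs_mul, abs_of_pos (pow_pos h0 k), Nat.abs_cast,
      div_le_iff₀ (by exact_mod_cast Nat.factorial_pos k)] at h1
    have h2 : (k.factorial : ℝ) ≤ n.factorial := by exact_mod_cast Nat.factorial_le hk.le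
    calc c * h ^ n ≤ c * (h ^ k * h) := by
          rw [← pow_succ]; gcongr ?_ * ?_; exact pow_le_pow_of_le_one h0.le hh1 hk
      _ ≤ |F k z| * (h ^ k * h) := by gcongr
      _ = |F k z| * h ^ k * h := by ring
      _ ≤ ‖p‖ * k.factorial * h := by gcongr
      _ ≤ ‖p‖ * n.factorial * h := by gcongr
      _ = _ := by ring
  have herr : A * h ^ n ≤ m / 2 * ‖p‖ := by
    have h1 : h * (2 * (A * n.factorial + 1)) ≤ m * c := by
      rw [← le_div_iff₀ (by positivity)]
      exact hh.trans (min_le_right _ _)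
    have h2 : A * (c * h ^ n) ≤ A * (n.factorial * h * ‖p‖) := by gcongr
    have h3 : A * n.factorial * h * ‖p‖ ≤ m * c / 2 * ‖p‖ := by
      gcongr; nlinarith
    have h4 : c * (A * h ^ n) ≤ c * (m / 2 * ‖p‖) := by linarith
    exact le_of_mul_le_mul_left h4 hc
  have hv : ∀ t ∈ Icc (0 : ℝ) 1, |F 0 (z + h * t) - ∑ i, p i * t ^ (i : ℕ)| ≤ m / 2 * ‖p‖ := by
    intro t ht
    have h1 := abs_sub_taylor_le n hA F hF.hasDerivAt hF.top_le z (h * t)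
    rw [abs_of_nonneg (mul_nonneg h0.le ht.1),
      Finset.sum_range (fun k => F k z * (h * t) ^ k / k.factorial)] at h1
    have e : ∑ i : Fin n, F i z * (h * t) ^ (i : ℕ) / (i : ℕ).factorial
        = ∑ i, p i * t ^ (i : ℕ) := Finset.sum_congr rfl fun i _ => by rw [hp, mul_pow]; ring
    rw [e] at h1
    refine h1.trans (le_trans ?_ herr)
    have : h * t ≤ h := mul_le_of_le_one_right h0.le ht.2
    have := mul_nonneg h0.le ht.1
    gcongr
  have hsup : ∀ t ∈ Icc (0 : ℝ) 1, |F 0 (z + h * t)| ≤ (n + m / 2) * ‖p‖ := by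
    intro t ht
    have h1 : |∑ i, p i * t ^ (i : ℕ)| ≤ n * ‖p‖ := by
      refine (Finset.abs_sum_le_sum_abs _ _).trans ?_
      calc ∑ i, |p i * t ^ (i : ℕ)| ≤ ∑ _i : Fin n, ‖p‖ := Finset.sum_le_sum fun i _ => by
            rw [abs_mul, abs_pow, abs_of_nonneg ht.1]
            calc |p i| * t ^ (i : ℕ) ≤ ‖p‖ * 1 := by
                  exact mul_le_mul (norm_le_pi_norm p i) (pow_le_one₀ ht.1 ht.2)
                    (pow_nonneg ht.1 _) (norm_nonneg _)
              _ = _ := mul_one _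
        _ = n * ‖p‖ := by simp
    have h2 := hv t ht
    have h3 := abs_sub_abs_le_abs_sub (F 0 (z + h * t)) (∑ i, p i * t ^ (i : ℕ))
    linarith
  have hFc : Continuous (F 0) := hF.continuous (Nat.zero_le _)
  have hint : m / 2 * ‖p‖ ≤ ∫ t in (0 : ℝ)..1, |F 0 (z + h * t)| := by
    have h1 : ∫ t in (0 : ℝ)..1, (|∑ i, p i * t ^ (i : ℕ)| - m / 2 * ‖p‖)
        ≤ ∫ t in (0 : ℝ)..1, |F 0 (z + h * t)| := by
      refine intervalIntegral.integral_mono_on zero_le_one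
        (Continuous.intervalIntegrable (by fun_prop) _ _)
        (Continuous.intervalIntegrable (by fun_prop) _ _) fun t ht => ?_
      have h2 := hv t ht
      have h3 := abs_sub_abs_le_abs_sub (∑ i, p i * t ^ (i : ℕ)) (F 0 (z + h * t))
      rw [abs_sub_comm] at h3
      linarith
    rw [intervalIntegral.integral_sub (Continuous.intervalIntegrable (by fun_prop) _ _)
      (Continuous.intervalIntegrable (by fun_prop) _ _)] at h1
    have := hmin p
    simp only [intervalIntegral.integral_const, sub_zero, smul_eq_mul, one_mul] at h1
    linarith
  have hscale : ∫ y in z..(z + h), |F 0 y| = h * ∫ t in (0 : ℝ)..1, |F 0 (z + h * t)| := by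
    rw [intervalIntegral.mul_integral_comp_add_mul (f := fun y => |F 0 y|)]
    simp
  have hint2 : h * (m / 2 * ‖p‖) ≤ ∫ y in z..(z + h), |F 0 y| := by rw [hscale]; gcongr
  have hI0 : 0 ≤ ∫ y in z..(z + h), |F 0 y| := le_trans (by positivity) hint2
  constructor
  · intro x hx
    have ht : (x - z) / h ∈ Icc (0 : ℝ) 1 := by
      constructor
      · have := hx.1
        exact div_nonneg (by linarith) h0.le
      · rw [div_le_one h0]; linarith [hx.2]
    have h1 := hsup _ ht
    rw [mul_div_cancel₀ _ h0.ne', add_sub_cancel] at h1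
    calc h * |F 0 x| ≤ h * ((n + m / 2) * ‖p‖) := by gcongr
      _ = 2 * (n + m / 2) / m * (h * (m / 2 * ‖p‖)) := by field_simp
      _ ≤ C * ∫ y in z..(z + h), |F 0 y| := by
        gcongr
        exact le_add_of_nonneg_right (by positivity)
  · calc h ^ n = 1 / c * (c * h ^ n) := by field_simp
      _ ≤ 1 / c * (n.factorial * h * ‖p‖) := by gcongr
      _ = 2 * n.factorial / (m * c) * (h * (m / 2 * ‖p‖)) := by field_simp
      _ ≤ C * ∫ y in z..(z + h), |F 0 y| := by
        gcongr
        exact le_add_of_nonneg_left (by positivity)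

/-- Powers `θ ≤ 1` of the absolute value of functions of finite type satisfy the same doubling
property, since `|F| ≤ S` implies `|F| ^ θ ≥ |F| * S ^ (θ - 1)`, and their
integrals over intervals that are not short are bounded below. -/
theorem exists_rpow_doubling (n : ℕ) (c A h₁ θ : ℝ) (hc : 0 < c) (hA : 0 ≤ A) (hh₁ : 0 < h₁)
    (hθ : 0 < θ) (hθ1 : θ ≤ 1) :
    ∃ h₀ C : ℝ, 0 < h₀ ∧ h₀ ≤ h₁ ∧ 0 < C ∧ ∀ F : ℕ → ℝ → ℝ, IsFiniteType n F c A →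
      (∀ z h : ℝ, 0 < h → h ≤ h₀ → ∀ x ∈ Icc z (z + h),
        h * |F 0 x| ^ θ ≤ C * ∫ y in z..(z + h), |F 0 y| ^ θ) ∧
      (∀ z h : ℝ, h₀ ≤ h → 1 ≤ C * ∫ y in z..(z + h), |F 0 y| ^ θ) := by
  obtain ⟨h₂, C, hh₂, hC, hmain⟩ := exists_sup_le_mean n c A hc hA
  set h₀ := min h₁ h₂
  have hh₀ : 0 < h₀ := lt_min hh₁ hh₂
  set D : ℝ := C / (h₀ * (h₀ ^ n / (C * h₀)) ^ θ) with hD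
  have hD0 : 0 < D := by positivity
  refine ⟨h₀, C + D, hh₀, min_le_left _ _, by positivity, fun F hF => ?_⟩
  have hFc : Continuous (F 0) := hF.continuous (Nat.zero_le _)
  have hFθ : Continuous fun y => |F 0 y| ^ θ :=
    hFc.abs.rpow_const fun _ => Or.inr hθ.le
  have hI0 : ∀ z h : ℝ, 0 ≤ h → 0 ≤ ∫ y in z..(z + h), |F 0 y| ^ θ := fun z h hh =>
    intervalIntegral.integral_nonneg (by linarith) fun y _ => by positivity
  have hshort : ∀ z h : ℝ, 0 < h → h ≤ h₀ → ∃ S : ℝ, (∀ x ∈ Icc z (z + h), |F 0 x| ≤ S) ∧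
      h ^ n ≤ C * (h * S) ∧ h * S ^ θ ≤ C * ∫ y in z..(z + h), |F 0 y| ^ θ := by
    intro z h h0 hh
    obtain ⟨h1, h2⟩ := hmain F hF z h h0 (hh.trans (min_le_right _ _))
    obtain ⟨x, hx, hmax⟩ := (isCompact_Icc (a := z) (b := z + h)).exists_isMaxOn
      ⟨z, le_rfl, by linarith⟩ hFc.abs.continuousOn
    have hmax' : ∀ y ∈ Icc z (z + h), |F 0 y| ≤ |F 0 x| := fun y hy => hmax hy
    refine ⟨|F 0 x|, hmax', h2.trans ?_, ?_⟩
    · gcongr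
      have := intervalIntegral.integral_mono_on (a := z) (b := z + h)
        (μ := MeasureTheory.volume) (by linarith) (hFc.abs.intervalIntegrable _ _)
        (continuous_const.intervalIntegrable _ _) hmax'
      simpa using this
    · rcases (abs_nonneg (F 0 x)).eq_or_lt with h3 | h3
      · rw [← h3, Real.zero_rpow hθ.ne', mul_zero]
        exact mul_nonneg hC.le (hI0 z h h0.le)
      have h4 : ∫ y in z..(z + h), |F 0 y| ≤
          |F 0 x| ^ (1 - θ) * ∫ y in z..(z + h), |F 0 y| ^ θ := by
        rw [← intervalIntegral.integral_const_mul]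
        refine intervalIntegral.integral_mono_on (by linarith) (hFc.abs.intervalIntegrable _ _)
          ((continuous_const.mul hFθ).intervalIntegrable _ _) fun y hy => ?_
        rcases (abs_nonneg (F 0 y)).eq_or_lt with h5 | h5
        · rw [← h5]; positivity
        · calc |F 0 y| = |F 0 y| ^ (1 - θ) * |F 0 y| ^ θ := by
                rw [← Real.rpow_add h5, sub_add_cancel, Real.rpow_one]
            _ ≤ |F 0 x| ^ (1 - θ) * |F 0 y| ^ θ := by
                exact mul_le_mul_of_nonneg_right
                  (Real.rpow_le_rpow h5.le (hmax' y hy) (by linarith)) (by positivity)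
      have h5 := h1 x hx
      have h6 : |F 0 x| ^ (1 - θ) * (h * |F 0 x| ^ θ) ≤
          |F 0 x| ^ (1 - θ) * (C * ∫ y in z..(z + h), |F 0 y| ^ θ) := by
        calc |F 0 x| ^ (1 - θ) * (h * |F 0 x| ^ θ) = h * |F 0 x| := by
              rw [mul_left_comm, ← Real.rpow_add h3, sub_add_cancel, Real.rpow_one]
          _ ≤ C * ∫ y in z..(z + h), |F 0 y| := h5
          _ ≤ C * (|F 0 x| ^ (1 - θ) * ∫ y in z..(z + h), |F 0 y| ^ θ) := by gcongr
          _ = _ := by ring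
      exact le_of_mul_le_mul_left h6 (by positivity)
  constructor
  · intro z h h0 hh x hx
    obtain ⟨S, h1, -, h3⟩ := hshort z h h0 hh
    calc h * |F 0 x| ^ θ ≤ h * S ^ θ := by
          have := h1 x hx
          gcongr
      _ ≤ C * ∫ y in z..(z + h), |F 0 y| ^ θ := h3
      _ ≤ _ := by
        have := hI0 z h h0.le
        gcongr
        linarith
  · intro z h hh
    obtain ⟨S, -, h2, h3⟩ := hshort z h₀ hh₀ le_rfl
    have h4 : h₀ ^ n / (C * h₀) ≤ S := by
      rw [div_le_iff₀ (by positivity)]; linarith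
    have h5 : ∫ y in z..(z + h₀), |F 0 y| ^ θ ≤ ∫ y in z..(z + h), |F 0 y| ^ θ := by
      refine intervalIntegral.integral_mono_interval le_rfl (by linarith) (by linarith)
        (Filter.Eventually.of_forall fun y => by simp only [Pi.zero_apply]; positivity)
        (hFθ.intervalIntegrable _ _)
    have h6 : h₀ * (h₀ ^ n / (C * h₀)) ^ θ ≤ C * ∫ y in z..(z + h), |F 0 y| ^ θ := by
      calc _ ≤ h₀ * S ^ θ := by gcongr
        _ ≤ C * ∫ y in z..(z + h₀), |F 0 y| ^ θ := h3
        _ ≤ _ := by gcongr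
    calc (1 : ℝ) = D / C * (h₀ * (h₀ ^ n / (C * h₀)) ^ θ) := by rw [hD]; field_simp
      _ ≤ D / C * (C * ∫ y in z..(z + h), |F 0 y| ^ θ) := by gcongr
      _ = D * ∫ y in z..(z + h), |F 0 y| ^ θ := by field_simp
      _ ≤ _ := by
        have := hI0 z h (by linarith)
        gcongr
        linarith

/-! ### The shear profile near its critical points -/

/-- The function `b - lam` followed by the derivatives of `b`. -/
noncomputable def shearJet (b : ℝ → ℝ) (lam : ℝ) : ℕ → ℝ → ℝ
  | 0 => fun y => b y - lam
  | k + 1 => iteratedDeriv (k + 1) b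

section Shear

variable {b : ℝ → ℝ} {σs : ℝ} {N : ℕ}

lemma iteratedDeriv_periodic {T : ℝ} (h : Function.Periodic b T) (k : ℕ) :
    Function.Periodic (iteratedDeriv k b) T := fun y => by
  have h1 := iteratedDeriv_comp_add_const k b T
  rw [← congrFun h1 y]
  congr 1
  exact funext h

namespace ShearAssumption

lemma hasDerivAt_iteratedDeriv (hb : ShearAssumption b σs N) {k : ℕ} (hk : k < N + 2) (y : ℝ) :
    HasDerivAt (iteratedDeriv k b) (iteratedDeriv (k + 1) b y) y := by
  rw [iteratedDeriv_succ]
  exact (hb.contDiff.differentiable_iteratedDeriv k (by exact_mod_cast hk) y).hasDerivAt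

lemma continuous_iteratedDeriv (hb : ShearAssumption b σs N) {k : ℕ} (hk : k ≤ N + 2) :
    Continuous (iteratedDeriv k b) :=
  hb.contDiff.continuous_iteratedDeriv k (by exact_mod_cast hk)

lemma exists_isFiniteType (hb : ShearAssumption b σs N) : ∃ c : ℝ, 0 < c ∧ c ≤ 1 ∧
    IsFiniteType (N + 1) (fun k => iteratedDeriv (k + 1) b) c σs⁻¹ := by
  have hcont : Continuous fun y => ∑ k ∈ Finset.range (N + 1), |iteratedDeriv (k + 1) b y| :=
    continuous_finsetSum _ fun k hk =>
      (hb.continuous_iteratedDeriv (by simp at hk; omega)).abs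
  have hpos : ∀ y ∈ Icc 0 (2 * Real.pi),
      0 < ∑ k ∈ Finset.range (N + 1), |iteratedDeriv (k + 1) b y| := by
    intro y _
    obtain ⟨k, hk, hne⟩ : ∃ k ≤ N, iteratedDeriv (k + 1) b y ≠ 0 := by
      by_cases h : deriv b y = 0
      · exact hb.order_le y h
      · exact ⟨0, Nat.zero_le _, by simpa [iteratedDeriv_one] using h⟩
    exact Finset.sum_pos' (fun _ _ => abs_nonneg _)
      ⟨k, by simpa [Nat.lt_succ_iff] using hk, abs_pos.2 hne⟩
  obtain ⟨c, hc, hmin⟩ := isCompact_Icc.exists_forall_le' hcont.continuousOn hpos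
  refine ⟨min 1 (c / (N + 1)), lt_min one_pos (by positivity), min_le_left _ _,
    fun k hk y => hb.hasDerivAt_iteratedDeriv (by omega) y, hb.continuous_iteratedDeriv le_rfl,
    hb.norm_le _ le_rfl, fun y => ?_⟩
  by_contra! hcon
  have hper : Function.Periodic (fun y => ∑ k ∈ Finset.range (N + 1), |iteratedDeriv (k + 1) b y|)
      (2 * Real.pi) := fun y => by
    simp only [iteratedDeriv_periodic hb.periodic _ y]
  obtain ⟨x, hx, hxy⟩ := hper.exists_mem_Ico₀ Real.two_pi_pos y
  have h1 := hmin x ⟨hx.1, hx.2.le⟩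
  rw [← hxy] at h1
  have h2 : ∑ k ∈ Finset.range (N + 1), |iteratedDeriv (k + 1) b y|
      < ∑ k ∈ Finset.range (N + 1), c / (N + 1) :=
    Finset.sum_lt_sum_of_nonempty ⟨0, by simp⟩ fun k hk =>
      (hcon k (by simpa using hk)).trans_le (min_le_right _ _)
  have h3 : ∑ _k ∈ Finset.range (N + 1), c / ((N : ℝ) + 1) = c := by
    simp; field_simp
  linarith

lemma exists_order (hb : ShearAssumption b σs N) {γ : ℝ} (hγ : deriv b γ = 0) :
    ∃ m, IsCriticalPointOfOrder b γ m := by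
  classical
  have hex : ∃ k, iteratedDeriv (k + 1) b γ ≠ 0 := let ⟨k, _, h⟩ := hb.order_le γ hγ; ⟨k, h⟩
  refine ⟨Nat.find hex, ?_, fun j hj1 hj => ?_, Nat.find_spec hex⟩
  · rw [Nat.one_le_iff_ne_zero]
    intro h0
    have := Nat.find_spec hex
    rw [h0] at this
    exact this (by simpa [iteratedDeriv_one] using hγ)
  · have := Nat.find_min hex (m := j - 1) (by omega)
    rw [not_not, Nat.sub_add_cancel hj1] at this
    exact this

end ShearAssumption

lemma IsCriticalPointOfOrder.deriv_eq_zero {γ : ℝ} {m : ℕ} (h : IsCriticalPointOfOrder b γ m) :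
    deriv b γ = 0 := by
  rw [← iteratedDeriv_one]; exact h.2.1 1 le_rfl h.1

lemma IsCriticalPointOfOrder.le (hb : ShearAssumption b σs N) {γ : ℝ} {m : ℕ}
    (h : IsCriticalPointOfOrder b γ m) : m ≤ N := by
  obtain ⟨k, hk, hne⟩ := hb.order_le γ h.deriv_eq_zero
  by_contra hlt
  exact hne (h.2.1 (k + 1) (by omega) (by omega))

lemma IsCriticalPointOfOrder.translate {T : ℝ} (hT : Function.Periodic b T) {γ : ℝ} {m : ℕ}
    (h : IsCriticalPointOfOrder b γ m) (j : ℤ) : IsCriticalPointOfOrder b (γ + j * T) m := by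
  have e : ∀ k, iteratedDeriv k b (γ + j * T) = iteratedDeriv k b γ := fun k => by
    simpa using (iteratedDeriv_periodic hT k).int_mul j γ
  refine ⟨h.1, fun i h1 h2 => ?_, ?_⟩
  · rw [e]; exact h.2.1 i h1 h2
  · rw [e]; exact h.2.2

lemma torusDist_le (y z : ℝ) (j : ℤ) : torusDist y z ≤ |y - z - j * (2 * Real.pi)| := by
  have e : ((y - z - j * (2 * Real.pi) : ℝ) : AddCircle (2 * Real.pi)) = ((y - z : ℝ)) := by
    rw [AddCircle.coe_sub, sub_eq_self, ← zsmul_eq_mul, AddCircle.coe_zsmul, AddCircle.coe_period,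
      smul_zero]
  rw [torusDist, ← e]
  exact QuotientAddGroup.norm_mk_le_norm

lemma torusDist_eq_abs {y z : ℝ} (h : |y - z| ≤ Real.pi) : torusDist y z = |y - z| := by
  rw [torusDist, AddCircle.norm_coe_eq_abs_iff _ Real.two_pi_pos.ne',
    abs_of_pos Real.two_pi_pos]
  linarith

namespace ShearAssumption

/-- By the separation of critical points, a critical point is the only one within `3 σs`. -/
lemma deriv_ne_zero_of_near (hb : ShearAssumption b σs N) {γ y : ℝ} (hγ : deriv b γ = 0)
    (hy : y ≠ γ) (hle : |y - γ| ≤ 3 * σs) : deriv b y ≠ 0 := by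
  intro h
  have h1 := hb.lt_one
  have h2 := Real.pi_gt_three
  have h3 := torusDist_eq_abs (y := y) (z := γ) (by linarith)
  have h4 := hb.separated y γ h hγ (by rw [h3]; exact abs_ne_zero.2 (sub_ne_zero.2 hy))
  have := hb.pos
  linarith

/-- Near a critical point of order `m`, the first `m + 1` derivatives of `b` do not vanish
simultaneously, and `|b'|` is at least a multiple of `|y - γ| ^ m`. -/
lemma exists_local_bounds (hb : ShearAssumption b σs N) {γ : ℝ} (hγ : deriv b γ = 0) :
    ∃ c : ℝ, 0 < c ∧ ∀ m, IsCriticalPointOfOrder b γ m → ∀ y, |y - γ| ≤ 3 * σs →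
      (∃ k ≤ m, c ≤ |iteratedDeriv (k + 1) b y|) ∧ c * |y - γ| ^ m ≤ |deriv b y| := by
  obtain ⟨m, hm⟩ := hb.exists_order hγ
  have hmN := hm.le hb
  have huniq : ∀ m', IsCriticalPointOfOrder b γ m' → m' = m := by
    intro m' hm'
    rcases lt_trichotomy m' m with h | h | h
    · exact absurd (hm.2.1 (m' + 1) (by omega) (by omega)) hm'.2.2
    · exact h
    · exact absurd (hm'.2.1 (m + 1) (by omega) (by omega)) hm.2.2
  have hσ := hb.pos
  have hσ1 := hb.lt_one
  have hball : ∀ y, y ∈ Icc (γ - 3 * σs) (γ + 3 * σs) ↔ |y - γ| ≤ 3 * σs := fun y => by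
    rw [abs_le, mem_Icc]; constructor <;> rintro ⟨h1, h2⟩ <;> constructor <;> linarith
  -- the first claim, by compactness
  have hcont : Continuous fun y => ∑ k ∈ Finset.range (m + 1), |iteratedDeriv (k + 1) b y| :=
    continuous_finsetSum _ fun k hk =>
      (hb.continuous_iteratedDeriv (by simp at hk; omega)).abs
  have hpos : ∀ y ∈ Icc (γ - 3 * σs) (γ + 3 * σs),
      0 < ∑ k ∈ Finset.range (m + 1), |iteratedDeriv (k + 1) b y| := by
    intro y hy
    rw [hball] at hy
    by_cases hyγ : y = γ
    · subst hyγ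
      exact Finset.sum_pos' (fun _ _ => abs_nonneg _) ⟨m, by simp, abs_pos.2 hm.2.2⟩
    · refine Finset.sum_pos' (fun _ _ => abs_nonneg _) ⟨0, by simp, abs_pos.2 ?_⟩
      rw [zero_add, iteratedDeriv_one]
      exact hb.deriv_ne_zero_of_near hγ hyγ hy
  obtain ⟨c₁, hc₁, hmin₁⟩ := isCompact_Icc.exists_forall_le' hcont.continuousOn hpos
  -- the second claim close to `γ`, by Taylor expansion
  set d : ℝ := |iteratedDeriv (m + 1) b γ| / m.factorial with hd
  have hmf : (0 : ℝ) < m.factorial := by exact_mod_cast Nat.factorial_pos m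
  have hd0 : 0 < d := div_pos (abs_pos.2 hm.2.2) hmf
  have htaylor : ∀ y, d * |y - γ| ^ m - σs⁻¹ * |y - γ| ^ (m + 1) ≤ |deriv b y| := by
    intro y
    have h1 := abs_sub_taylor_le (m + 1) (inv_pos.2 hσ).le (fun k => iteratedDeriv (k + 1) b)
      (fun k hk y => hb.hasDerivAt_iteratedDeriv (by omega) y) (hb.norm_le _ (by omega)) γ (y - γ)
    rw [Finset.sum_range_succ, Finset.sum_eq_zero (fun k hk => by
      rw [hm.2.1 (k + 1) (by omega) (by simp at hk; omega)]; simp), zero_add, add_sub_cancel,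
      zero_add, iteratedDeriv_one] at h1
    have h2 : |iteratedDeriv (m + 1) b γ * (y - γ) ^ m / m.factorial| = d * |y - γ| ^ m := by
      rw [abs_div, abs_mul, abs_pow, Nat.abs_cast, hd]; ring
    have h3 := abs_sub_abs_le_abs_sub (iteratedDeriv (m + 1) b γ * (y - γ) ^ m / m.factorial)
      (deriv b y)
    rw [abs_sub_comm] at h3
    linarith
  set u : ℝ := d * σs / 2 with hu
  have hu0 : 0 < u := by positivity
  -- the second claim away from `γ`, by compactness
  have hcomp : IsCompact (Icc (γ - 3 * σs) (γ + 3 * σs) ∩ {y | u ≤ |y - γ|}) :=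
    isCompact_Icc.inter_right (isClosed_le continuous_const (by fun_prop))
  have hdc : Continuous fun y => |deriv b y| := by
    have := (hb.continuous_iteratedDeriv (k := 1) (by omega)).abs
    rwa [iteratedDeriv_one] at this
  obtain ⟨c₂, hc₂, hmin₂⟩ := hcomp.exists_forall_le' (a := 0) hdc.continuousOn (by
    rintro y ⟨hy1, hy2⟩
    rw [hball] at hy1
    refine abs_pos.2 (hb.deriv_ne_zero_of_near hγ ?_ hy1)
    rintro rfl
    simp only [mem_ofPred_eq, sub_self, abs_zero] at hy2
    linarith)
  refine ⟨min (c₁ / (m + 1)) (min (d / 2) (c₂ / 3 ^ m)),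
    lt_min (by positivity) (lt_min (by positivity) (by positivity)), fun m' hm' y hy => ?_⟩
  obtain rfl := huniq m' hm'
  constructor
  · by_contra! hcon
    have h1 := hmin₁ y ((hball y).2 hy)
    have h2 : ∑ k ∈ Finset.range (m' + 1), |iteratedDeriv (k + 1) b y|
        < ∑ k ∈ Finset.range (m' + 1), c₁ / (m' + 1) :=
      Finset.sum_lt_sum_of_nonempty ⟨0, by simp⟩ fun k hk =>
        (hcon k (by simp at hk; omega)).trans_le (min_le_left _ _)
    have h3 : ∑ _k ∈ Finset.range (m' + 1), c₁ / ((m' : ℝ) + 1) = c₁ := by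
      simp; field_simp
    linarith
  · rcases le_or_gt u |y - γ| with h | h
    · calc _ ≤ c₂ / 3 ^ m' * 3 ^ m' := by
            gcongr
            · exact (min_le_right _ _).trans (min_le_right _ _)
            · linarith
        _ = c₂ := by field_simp
        _ ≤ _ := hmin₂ y ⟨(hball y).2 hy, h⟩
    · refine le_trans ?_ (htaylor y)
      have h4 : σs⁻¹ * |y - γ| ^ (m' + 1) ≤ d / 2 * |y - γ| ^ m' := by
        calc σs⁻¹ * |y - γ| ^ (m' + 1) = σs⁻¹ * |y - γ| * |y - γ| ^ m' := by ring
          _ ≤ σs⁻¹ * u * |y - γ| ^ m' := by gcongr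
          _ = _ := by rw [hu]; field_simp
      have h5 : min (c₁ / (m' + 1)) (min (d / 2) (c₂ / 3 ^ m')) * |y - γ| ^ m'
          ≤ d / 2 * |y - γ| ^ m' := by
        gcongr
        exact (min_le_right _ _).trans (min_le_left _ _)
      linarith

/-- `exists_local_bounds`, uniformly in the critical point. -/
lemma exists_uniform_bounds (hb : ShearAssumption b σs N) :
    ∃ c : ℝ, 0 < c ∧ c ≤ 1 ∧ ∀ γ m, IsCriticalPointOfOrder b γ m → ∀ y, |y - γ| ≤ 3 * σs →
      (∃ k ≤ m, c ≤ |iteratedDeriv (k + 1) b y|) ∧ c * |y - γ| ^ m ≤ |deriv b y| := by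
  set S := {γ : ℝ | γ ∈ Ico 0 (2 * Real.pi) ∧ deriv b γ = 0} with hS
  have hfin : S.Finite := hb.finite_critical
  choose! c hc hloc using fun γ (hγ : γ ∈ S) => hb.exists_local_bounds hγ.2
  obtain ⟨c₀, hc₀, hmin⟩ : ∃ c₀ : ℝ, 0 < c₀ ∧ ∀ γ ∈ S, c₀ ≤ c γ := by
    rcases S.eq_empty_or_nonempty with h | h
    · exact ⟨1, one_pos, by simp [h]⟩
    · obtain ⟨γ, hγ, hle⟩ := exists_min_image S c hfin h
      exact ⟨c γ, hc γ hγ, hle⟩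
  refine ⟨min 1 c₀, lt_min one_pos hc₀, min_le_left _ _, fun γ m hm y hy => ?_⟩
  set j : ℤ := -⌊γ / (2 * Real.pi)⌋ with hj
  have hγ' := hm.translate hb.periodic j
  have hπ := Real.two_pi_pos
  have hmem : γ + j * (2 * Real.pi) ∈ S := by
    refine ⟨⟨?_, ?_⟩, hγ'.deriv_eq_zero⟩
    · have := Int.floor_le (γ / (2 * Real.pi))
      rw [le_div_iff₀ hπ] at this
      rw [hj]; push_cast; linarith
    · have := Int.lt_floor_add_one (γ / (2 * Real.pi))
      rw [div_lt_iff₀ hπ] at this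
      rw [hj]; push_cast; linarith
  have e : y + j * (2 * Real.pi) - (γ + j * (2 * Real.pi)) = y - γ := by ring
  have e2 : ∀ k, iteratedDeriv k b (y + j * (2 * Real.pi)) = iteratedDeriv k b y := fun k => by
    simpa using (iteratedDeriv_periodic hb.periodic k).int_mul j y
  have e3 : deriv b (y + j * (2 * Real.pi)) = deriv b y := by
    have := e2 1
    rwa [iteratedDeriv_one] at this
  have h0 : min 1 c₀ ≤ c (γ + j * (2 * Real.pi)) := (min_le_right _ _).trans (hmin _ hmem)
  have := hloc _ hmem m hγ' (y + j * (2 * Real.pi)) (by rwa [e])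
  rw [e, e3] at this
  simp only [e2] at this
  obtain ⟨⟨k, hk, h1⟩, h2⟩ := this
  refine ⟨⟨k, hk, h0.trans h1⟩, le_trans ?_ h2⟩
  gcongr

/-- The regularized shear is positive, and bounded by `|b'|` or, within `2 σs` of a critical point
of order `m`, by `|b'| + ε ^ (m / (m + 3))`. -/
lemma exists_regShear_le (hb : ShearAssumption b σs N) :
    ∃ C : ℝ, 0 < C ∧ ∀ σ₀ ε y : ℝ, 0 < σ₀ → σ₀ ≤ 1 → 0 < ε → ε ≤ 1 →
      0 < regShear b σs σ₀ ε y ∧ (regShear b σs σ₀ ε y ≤ C * |deriv b y| ∨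
        ∃ γ m, IsCriticalPointOfOrder b γ m ∧ |y - γ| < 2 * σs ∧
          regShear b σs σ₀ ε y ≤ C * (|deriv b y| + ε ^ ((m : ℝ) / ((m : ℝ) + 3)))) := by
  obtain ⟨c, hc, hc1, hloc⟩ := hb.exists_uniform_bounds
  have hσ := hb.pos
  have hσ1 := hb.lt_one
  have hdb : ∀ y, |deriv b y| ≤ σs⁻¹ := fun y => by
    have := hb.norm_le 1 (by omega) y
    rwa [iteratedDeriv_one] at this
  refine ⟨2 / c + 2 + (4 + 2 * σs⁻¹) / (c * σs ^ N), by positivity,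
    fun σ₀ ε y hσ₀ hσ₀1 hε hε1 => ?_⟩
  have hinner : ∀ m r, 0 ≤ r → 0 < innerShear σ₀ ε m r := fun m r hr => by
    unfold innerShear; positivity
  have hC2 : 2 ≤ 2 / c + 2 + (4 + 2 * σs⁻¹) / (c * σs ^ N) := by
    have : 0 ≤ 2 / c := by positivity
    have : 0 ≤ (4 + 2 * σs⁻¹) / (c * σs ^ N) := by positivity
    linarith
  by_cases h : ∃ p : ℝ × ℕ, IsCriticalPointOfOrder b p.1 p.2 ∧ |y - p.1| < 2 * σs
  swap
  · rw [regShear, dif_neg h]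
    have hne : deriv b y ≠ 0 := by
      intro h0
      obtain ⟨m, hm⟩ := hb.exists_order h0
      exact h ⟨(y, m), hm, by simpa using hσ⟩
    have := abs_pos.2 hne
    refine ⟨by positivity, Or.inl ?_⟩
    calc 2 * σ₀ * |deriv b y| ≤ 2 * 1 * |deriv b y| := by gcongr
      _ ≤ _ := by rw [mul_one]; gcongr
  by_cases hle : |y - h.choose.1| ≤ σs
  · have e : regShear b σs σ₀ ε y = innerShear σ₀ ε h.choose.2 |y - h.choose.1| := by
      rw [regShear, dif_pos h]; exact if_pos hle
    rw [e]
    obtain ⟨hγ, hy⟩ := h.choose_spec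
    set γ := h.choose.1
    set m := h.choose.2
    refine ⟨hinner _ _ (abs_nonneg _), Or.inr ⟨γ, m, hγ, hy, ?_⟩⟩
    have h1 := (hloc γ m hγ y (by linarith)).2
    have hE : 0 < ε ^ ((m : ℝ) / ((m : ℝ) + 3)) := by positivity
    unfold innerShear
    calc 2 * σ₀ * (|y - γ| ^ m + ε ^ ((m : ℝ) / ((m : ℝ) + 3)))
        ≤ 2 * 1 * (|deriv b y| / c + ε ^ ((m : ℝ) / ((m : ℝ) + 3))) := by
          gcongr
          rw [le_div_iff₀ hc]; linarith
      _ = 2 / c * |deriv b y| + 2 * ε ^ ((m : ℝ) / ((m : ℝ) + 3)) := by ring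
      _ ≤ (2 / c + 2 + (4 + 2 * σs⁻¹) / (c * σs ^ N)) * |deriv b y|
          + (2 / c + 2 + (4 + 2 * σs⁻¹) / (c * σs ^ N)) * ε ^ ((m : ℝ) / ((m : ℝ) + 3)) := by
          gcongr
          have : 0 ≤ (4 + 2 * σs⁻¹) / (c * σs ^ N) := by positivity
          linarith
      _ = _ := by ring
  · have e : regShear b σs σ₀ ε y = (1 - (|y - h.choose.1| - σs) / σs) *
        innerShear σ₀ ε h.choose.2 σs + (|y - h.choose.1| - σs) / σs * (2 * σ₀ *
          |deriv b (h.choose.1 + SignType.sign (y - h.choose.1) * (2 * σs))|) := by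
      rw [regShear, dif_pos h]; exact if_neg hle
    rw [e]
    obtain ⟨hγ, hy⟩ := h.choose_spec
    set γ := h.choose.1
    set m := h.choose.2
    have hmN := hγ.le hb
    rw [not_le] at hle
    have h1 := (hloc γ m hγ y (by linarith)).2
    have ht0 : 0 ≤ (|y - γ| - σs) / σs := div_nonneg (by linarith) hσ.le
    have ht1 : (|y - γ| - σs) / σs < 1 := by rw [div_lt_one hσ]; linarith
    set t := (|y - γ| - σs) / σs
    constructor
    · have := hinner m σs hσ.le
      have : 0 < 1 - t := by linarith
      positivity
    · left
      have h2 : c * σs ^ N ≤ |deriv b y| := by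
        calc c * σs ^ N ≤ c * σs ^ m := by
              gcongr ?_ * ?_
              exact pow_le_pow_of_le_one hσ.le hσ1.le hmN
          _ ≤ c * |y - γ| ^ m := by gcongr
          _ ≤ _ := h1
      have h3 : innerShear σ₀ ε m σs ≤ 4 := by
        unfold innerShear
        have : σs ^ m ≤ 1 := pow_le_one₀ hσ.le hσ1.le
        have : ε ^ ((m : ℝ) / ((m : ℝ) + 3)) ≤ 1 := Real.rpow_le_one hε.le hε1 (by positivity)
        calc _ ≤ 2 * 1 * ((1 : ℝ) + 1) := by gcongr
          _ = 4 := by norm_num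
      have h4 : 2 * σ₀ * |deriv b (γ + SignType.sign (y - γ) * (2 * σs))| ≤ 2 * σs⁻¹ := by
        calc _ ≤ 2 * 1 * σs⁻¹ := by gcongr; exact hdb _
          _ = _ := by ring
      have h5 := (hinner m σs hσ.le).le
      calc _ ≤ 1 * 4 + 1 * (2 * σs⁻¹) := by
            gcongr
            linarith
        _ = (4 + 2 * σs⁻¹) / (c * σs ^ N) * (c * σs ^ N) := by field_simp
        _ ≤ (4 + 2 * σs⁻¹) / (c * σs ^ N) * |deriv b y| := by gcongr
        _ ≤ _ := by
          gcongr
          have : 0 ≤ 2 / c := by positivity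
          linarith

end ShearAssumption

end Shear

/-! ### The frequency dominates the inverse length in the mean -/

section Rate

variable {b : ℝ → ℝ} {σs : ℝ} {N : ℕ}

/-- The frequency of `b - lam`. -/
noncomputable def shearFreq (b : ℝ → ℝ) (N : ℕ) (ε α lam : ℝ) : ℝ → ℝ :=
  freq (N + 1) (shearJet b lam) α (Real.sqrt ε)

/-- The contribution of one end point to `√ε * invLength`. -/
noncomputable def decayRate (b : ℝ → ℝ) (σs σ₀ ε α lam y : ℝ) : ℝ :=
  α ^ (1 / 2 : ℝ) + (Real.sqrt ε * regShear b σs σ₀ ε y) ^ (1 / 3 : ℝ) + |b y - lam| ^ (1 / 2 : ℝ)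

lemma shearJet_periodic (hb : ShearAssumption b σs N) (lam : ℝ) (k : ℕ) :
    Function.Periodic (shearJet b lam k) (2 * Real.pi) := by
  cases k with
  | zero => intro y; simp [shearJet, hb.periodic y]
  | succ k => exact iteratedDeriv_periodic hb.periodic (k + 1)

lemma hasDerivAt_shearJet_zero (hb : ShearAssumption b σs N) (lam y : ℝ) :
    HasDerivAt (shearJet b lam 0) (shearJet b lam 1 y) y := by
  have := hb.hasDerivAt_iteratedDeriv (k := 0) (by omega) y
  rw [iteratedDeriv_zero] at this
  exact this.sub_const lam

lemma isFiniteType_shearJet (hb : ShearAssumption b σs N) {c : ℝ}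
    (h : IsFiniteType (N + 1) (fun k => iteratedDeriv (k + 1) b) c σs⁻¹) (lam : ℝ) :
    IsFiniteType (N + 2) (shearJet b lam) c σs⁻¹ where
  hasDerivAt k hk y := by
    cases k with
    | zero => exact hasDerivAt_shearJet_zero hb lam y
    | succ k => exact h.hasDerivAt k (by omega) y
  continuous_top := h.continuous_top
  top_le := h.top_le
  nondegenerate y := by
    obtain ⟨k, hk, hck⟩ := h.nondegenerate y
    exact ⟨k + 1, by omega, hck⟩

lemma shearFreq_nonneg {ε α lam : ℝ} (hα : 0 ≤ α) (y : ℝ) : 0 ≤ shearFreq b N ε α lam y :=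
  freq_nonneg hα y

lemma shearFreq_periodic (hb : ShearAssumption b σs N) (ε α lam : ℝ) :
    Function.Periodic (shearFreq b N ε α lam) (2 * Real.pi) :=
  freq_periodic fun k _ => shearJet_periodic hb lam k

lemma rpow_half_le_shearFreq {ε α : ℝ} (hα : 0 ≤ α) (lam y : ℝ) :
    α ^ (1 / 2 : ℝ) ≤ shearFreq b N ε α lam y := by
  rw [← Real.sqrt_eq_rpow]
  exact Real.sqrt_le_iff.2 ⟨shearFreq_nonneg hα y, le_freq_sq hα y⟩

lemma abs_sub_rpow_half_le_shearFreq {ε α : ℝ} (hα : 0 ≤ α) (lam y : ℝ) :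
    |b y - lam| ^ (1 / 2 : ℝ) ≤ shearFreq b N ε α lam y := by
  rw [← Real.sqrt_eq_rpow]
  refine Real.sqrt_le_iff.2 ⟨shearFreq_nonneg hα y, ?_⟩
  have := jet_le_freq (n := N + 1) (β := shearJet b lam) (s := Real.sqrt ε) hα (k := 0)
    (by omega) y
  simpa [shearJet, shearFreq] using this

lemma deriv_rpow_third_le_shearFreq {ε α : ℝ} (hα : 0 ≤ α) (lam y : ℝ) :
    (Real.sqrt ε * |deriv b y|) ^ (1 / 3 : ℝ) ≤ shearFreq b N ε α lam y := by
  have h0 := shearFreq_nonneg (b := b) (N := N) (ε := ε) (lam := lam) hα y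
  have h := jet_le_freq (n := N + 1) (β := shearJet b lam) (s := Real.sqrt ε) hα (k := 1)
    (by omega) y
  simp only [shearJet, pow_one, zero_add, iteratedDeriv_one] at h
  calc _ ≤ (shearFreq b N ε α lam y ^ 3) ^ (1 / 3 : ℝ) := by gcongr; exact h
    _ = _ := by
      rw [← Real.rpow_natCast, ← Real.rpow_mul h0]; norm_num

lemma continuous_shearFreq (hb : ShearAssumption b σs N) {ε α lam : ℝ} :
    Continuous (shearFreq b N ε α lam) := by
  have : Continuous (freqPow (N + 1) (shearJet b lam) α (Real.sqrt ε)) := by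
    unfold freqPow
    refine continuous_const.add (continuous_finsetSum _ fun k hk => ?_)
    have : Continuous (shearJet b lam k) := by
      cases k with
      | zero =>
        exact continuous_iff_continuousAt.2 fun y =>
          (hasDerivAt_shearJet_zero hb lam y).continuousAt
      | succ k => exact hb.continuous_iteratedDeriv (by simp at hk; omega)
    fun_prop
  exact this.rpow_const fun _ => Or.inr (by positivity)

/-- Up to a constant, `(√ε |B'(y)|)^{1/3}` is at most `(√ε |b'(y)|)^{1/3}` plus a number `E` that
bounds the frequency from below on the whole interval `|x - y| ≤ σs`. -/
lemma exists_regShear_rpow_le (hb : ShearAssumption b σs N) :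
    ∃ C : ℝ, 0 < C ∧ ∀ σ₀ ε α lam y : ℝ, 0 < σ₀ → σ₀ ≤ 1 → 0 < ε → ε ≤ 1 → 0 ≤ α →
      0 < regShear b σs σ₀ ε y ∧ ∃ E : ℝ, 0 ≤ E ∧ E ≤ 1 ∧
        (Real.sqrt ε * regShear b σs σ₀ ε y) ^ (1 / 3 : ℝ) ≤
          C * ((Real.sqrt ε * |deriv b y|) ^ (1 / 3 : ℝ) + E) ∧
        ∀ x, |x - y| ≤ σs → E ≤ shearFreq b N ε α lam x := by
  obtain ⟨C₀, hC₀, hreg⟩ := hb.exists_regShear_le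
  obtain ⟨c, hc, hc1, hloc⟩ := hb.exists_uniform_bounds
  refine ⟨C₀ ^ (1 / 3 : ℝ) * c⁻¹, by positivity, fun σ₀ ε α lam y hσ₀ hσ₀1 hε hε1 hα => ?_⟩
  have hci : 1 ≤ c⁻¹ := (one_le_inv₀ hc).2 hc1
  obtain ⟨hpos, hcase⟩ := hreg σ₀ ε y hσ₀ hσ₀1 hε hε1
  refine ⟨hpos, ?_⟩
  have hs := Real.sqrt_pos.2 hε
  have hs1 : Real.sqrt ε ≤ 1 := Real.sqrt_le_one.2 hε1
  set s := Real.sqrt ε with hsd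
  rcases hcase with h | ⟨γ, m, hγ, hy, h⟩
  · refine ⟨0, le_rfl, zero_le_one, ?_, fun x _ => shearFreq_nonneg hα x⟩
    calc _ ≤ (C₀ * (s * |deriv b y|)) ^ (1 / 3 : ℝ) := by
          refine Real.rpow_le_rpow (by positivity) ?_ (by norm_num)
          calc s * regShear b σs σ₀ ε y ≤ s * (C₀ * |deriv b y|) := by gcongr
            _ = C₀ * (s * |deriv b y|) := by ring
      _ = C₀ ^ (1 / 3 : ℝ) * 1 * (s * |deriv b y|) ^ (1 / 3 : ℝ) := by
          rw [Real.mul_rpow hC₀.le (by positivity), mul_one]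
      _ ≤ _ := by rw [add_zero]; gcongr
  · set e : ℝ := s ^ (((m : ℝ) + 1) / ((m : ℝ) + 3)) with he
    have he0 : 0 < e := by positivity
    have he1 : e ≤ 1 := Real.rpow_le_one hs.le hs1 (by positivity)
    have hse : (s * ε ^ ((m : ℝ) / ((m : ℝ) + 3))) ^ (1 / 3 : ℝ) = e := by
      have h1 : ε = s ^ (2 : ℝ) := by
        rw [Real.rpow_two, hsd, Real.sq_sqrt hε.le]
      rw [h1, ← Real.rpow_mul hs.le]
      nth_rewrite 1 [← Real.rpow_one s]
      rw [← Real.rpow_add hs, ← Real.rpow_mul hs.le, he]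
      congr 1
      field_simp
      ring
    refine ⟨c * e, by positivity, mul_le_one₀ hc1 he0.le he1, ?_, fun x hx => ?_⟩
    · calc _ ≤ (C₀ * (s * |deriv b y| + s * ε ^ ((m : ℝ) / ((m : ℝ) + 3)))) ^ (1 / 3 : ℝ) := by
            refine Real.rpow_le_rpow (by positivity) ?_ (by norm_num)
            calc s * regShear b σs σ₀ ε y
                ≤ s * (C₀ * (|deriv b y| + ε ^ ((m : ℝ) / ((m : ℝ) + 3)))) := by gcongr
              _ = C₀ * (s * |deriv b y| + s * ε ^ ((m : ℝ) / ((m : ℝ) + 3))) := by ring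
        _ = C₀ ^ (1 / 3 : ℝ) *
            (s * |deriv b y| + s * ε ^ ((m : ℝ) / ((m : ℝ) + 3))) ^ (1 / 3 : ℝ) :=
            Real.mul_rpow hC₀.le (by positivity)
        _ ≤ C₀ ^ (1 / 3 : ℝ) * ((s * |deriv b y|) ^ (1 / 3 : ℝ) + e) := by
            rw [← hse]
            gcongr
            exact Real.rpow_add_le_add_rpow (by positivity) (by positivity) (by norm_num)
              (by norm_num)
        _ ≤ C₀ ^ (1 / 3 : ℝ) * (c⁻¹ * (s * |deriv b y|) ^ (1 / 3 : ℝ) + e) := by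
            gcongr
            exact le_mul_of_one_le_left (by positivity) hci
        _ = _ := by field_simp
    · have hxγ : |x - γ| ≤ 3 * σs := by
        have := abs_sub_le x y γ
        linarith
      obtain ⟨⟨k, hk, hck⟩, -⟩ := hloc γ m hγ x hxγ
      have h1 := le_freq_pow (β := shearJet b lam) (n := N + 1) (m := m + 1) (y := x) hα hs hs1 hc
        hc1 (by have := hγ.le hb; omega) ⟨k + 1, by omega, hck⟩
      refine le_of_pow_le_pow_left₀ (n := m + 3) (by omega) (shearFreq_nonneg hα x) ?_
      refine le_trans (le_of_eq ?_) h1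
      rw [mul_pow, he, ← Real.rpow_natCast (s ^ _), ← Real.rpow_mul hs.le, ← Real.rpow_natCast s]
      congr 2
      push_cast
      field_simp

lemma exists_decayRate_le (hb : ShearAssumption b σs N) :
    ∃ C : ℝ, 0 < C ∧ ∀ σ₀ ε α lam y : ℝ, 0 < σ₀ → σ₀ ≤ 1 → 0 < ε → ε ≤ 1 → 0 ≤ α →
      0 < regShear b σs σ₀ ε y ∧ decayRate b σs σ₀ ε α lam y ≤ C * shearFreq b N ε α lam y := by
  obtain ⟨C, hC, h⟩ := exists_regShear_rpow_le hb
  refine ⟨2 + 2 * C, by positivity, fun σ₀ ε α lam y hσ₀ hσ₀1 hε hε1 hα => ?_⟩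
  obtain ⟨hpos, E, -, -, hE, hEx⟩ := h σ₀ ε α lam y hσ₀ hσ₀1 hε hε1 hα
  refine ⟨hpos, ?_⟩
  have h1 := rpow_half_le_shearFreq (b := b) (N := N) (ε := ε) hα lam y
  have h2 := abs_sub_rpow_half_le_shearFreq (b := b) (N := N) (ε := ε) hα lam y
  have h3 := deriv_rpow_third_le_shearFreq (b := b) (N := N) (ε := ε) hα lam y
  have h4 := hEx y (by simpa using hb.pos.le)
  have h5 : C * ((Real.sqrt ε * |deriv b y|) ^ (1 / 3 : ℝ) + E) ≤
      C * (shearFreq b N ε α lam y + shearFreq b N ε α lam y) := by gcongr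
  unfold decayRate
  linarith

/-- The mean of the frequency over an interval dominates the decay rate at each point of the interval.
Its integral over intervals of length at least `σs` dominates `1 + α ^ (1 / 2)`. -/
lemma exists_mul_decayRate_le_integral (hb : ShearAssumption b σs N) :
    ∃ C : ℝ, 0 < C ∧ ∀ σ₀ ε α lam : ℝ, 0 < σ₀ → σ₀ ≤ 1 → 0 < ε → ε ≤ 1 → 0 ≤ α →
      ∀ a h : ℝ, 0 ≤ h → h ≤ 2 * Real.pi →
        (∀ y ∈ Icc a (a + h), h * decayRate b σs σ₀ ε α lam y ≤
          C * ∫ x in a..(a + h), shearFreq b N ε α lam x) ∧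
        (σs ≤ h → 1 + α ^ (1 / 2 : ℝ) ≤ C * ∫ x in a..(a + h), shearFreq b N ε α lam x) := by
  obtain ⟨c, hc, hc1, hft⟩ := hb.exists_isFiniteType
  have hσ := hb.pos
  obtain ⟨C₀, hC₀, hreg⟩ := exists_regShear_rpow_le hb
  obtain ⟨h₂, C₂, hh₂, hh₂σ, hC₂, hdoub₂⟩ := exists_rpow_doubling (N + 1) c σs⁻¹ σs (1 / 3) hc
    (inv_pos.2 hσ).le hσ (by norm_num) (by norm_num)
  obtain ⟨h₁, C₁, hh₁, hh₁₂, hC₁, hdoub₁⟩ := exists_rpow_doubling (N + 2) c σs⁻¹ h₂ (1 / 2) hc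
    (inv_pos.2 hσ).le hh₂ (by norm_num) (by norm_num)
  have hπ := Real.pi_pos
  set G : ℝ := C₀ * (σs⁻¹ ^ (1 / 3 : ℝ) + 1) + (2 * σs⁻¹) ^ (1 / 2 : ℝ) with hG
  have hG0 : 0 ≤ G := by positivity
  refine ⟨3 + 2 * Real.pi * G * C₁ + C₁ + C₀ * (C₂ + 1) + σs⁻¹, by positivity,
    fun σ₀ ε α lam hσ₀ hσ₀1 hε hε1 hα a h h0 hh => ?_⟩
  have hs := Real.sqrt_pos.2 hε
  have hs1 : Real.sqrt ε ≤ 1 := Real.sqrt_le_one.2 hε1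
  set s := Real.sqrt ε with hsd
  have hρc : Continuous (shearFreq b N ε α lam) := continuous_shearFreq hb
  have hmono : ∀ f : ℝ → ℝ, Continuous f →
      (∀ x ∈ Icc a (a + h), f x ≤ shearFreq b N ε α lam x) →
      ∫ x in a..(a + h), f x ≤ ∫ x in a..(a + h), shearFreq b N ε α lam x := fun f hf hle =>
    intervalIntegral.integral_mono_on (by linarith) (hf.intervalIntegrable _ _)
      (hρc.intervalIntegrable _ _) hle
  have hconst : ∀ r : ℝ, (∀ x ∈ Icc a (a + h), r ≤ shearFreq b N ε α lam x) →
      h * r ≤ ∫ x in a..(a + h), shearFreq b N ε α lam x := fun r hle => by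
    simpa using hmono (fun _ => r) continuous_const hle
  set I := ∫ x in a..(a + h), shearFreq b N ε α lam x with hI
  have hI0 : 0 ≤ I := intervalIntegral.integral_nonneg (by linarith) fun x _ =>
    shearFreq_nonneg hα x
  have hα1 : h * α ^ (1 / 2 : ℝ) ≤ I := hconst _ fun x _ => rpow_half_le_shearFreq hα lam x
  have hbc : Continuous b := by simpa using hb.continuous_iteratedDeriv (k := 0) (by omega)
  have hdbc : Continuous (deriv b) := by
    simpa [iteratedDeriv_one] using hb.continuous_iteratedDeriv (k := 1) (by omega)
  have hi1 : ∫ x in a..(a + h), |b x - lam| ^ (1 / 2 : ℝ) ≤ I :=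
    hmono _ ((by fun_prop : Continuous fun x => |b x - lam|).rpow_const
      fun _ => Or.inr (by norm_num)) fun x _ => abs_sub_rpow_half_le_shearFreq hα lam x
  have hlong : h₁ ≤ h → 1 ≤ C₁ * I := fun hle => by
    have h1 := (hdoub₁ (shearJet b lam) (isFiniteType_shearJet hb hft lam)).2 a h hle
    simp only [shearJet] at h1
    exact h1.trans (by gcongr)
  have hbnd : ∀ j ≤ N + 2, ∀ y, |iteratedDeriv j b y| ≤ σs⁻¹ := hb.norm_le
  have hp1 : 0 ≤ 2 * Real.pi * G * C₁ * I := by positivity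
  have hp2 : 0 ≤ C₁ * I := by positivity
  have hp3 : 0 ≤ C₀ * (C₂ + 1) * I := by positivity
  have hp4 : 0 ≤ σs⁻¹ * I := by positivity
  constructor
  · intro y hy
    obtain ⟨-, E, hE0, hE1, hE, hEx⟩ := hreg σ₀ ε α lam y hσ₀ hσ₀1 hε hε1 hα
    unfold decayRate
    rw [mul_add, mul_add]
    rcases le_or_gt h₁ h with hle | hlt
    -- on an interval of length at least `h₁`, `I` is bounded below, `√ε |B'|` is bounded, and
    -- `b - lam` oscillates by at most `2 σs⁻¹`
    · have h1 := hlong hle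
      have h2 : (s * regShear b σs σ₀ ε y) ^ (1 / 3 : ℝ) ≤ C₀ * (σs⁻¹ ^ (1 / 3 : ℝ) + 1) := by
        refine hE.trans ?_
        gcongr
        have := hbnd 1 (by omega) y
        rw [iteratedDeriv_one] at this
        calc s * |deriv b y| ≤ 1 * σs⁻¹ := by gcongr
          _ = _ := one_mul _
      have h3 : h * (|b y - lam| ^ (1 / 2 : ℝ) - (2 * σs⁻¹) ^ (1 / 2 : ℝ)) ≤ I := by
        refine hconst _ fun x _ => ?_
        refine le_trans ?_ (abs_sub_rpow_half_le_shearFreq hα lam x)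
        rw [sub_le_iff_le_add]
        refine le_trans ?_ (Real.rpow_add_le_add_rpow (abs_nonneg _) (by positivity)
          (by norm_num) (by norm_num))
        refine Real.rpow_le_rpow (abs_nonneg _) ?_ (by norm_num)
        have h4 := hbnd 0 (by omega) x
        have h5 := hbnd 0 (by omega) y
        rw [iteratedDeriv_zero] at h4 h5
        have h6 : |b y - lam| ≤ |b x - lam| + |b y| + |b x| := by
          calc |b y - lam| = |(b x - lam) + b y + -b x| := by ring_nf
            _ ≤ |b x - lam| + |b y| + |-b x| := abs_add_three _ _ _
            _ = _ := by rw [abs_neg]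
        linarith
      have h4 : h * (s * regShear b σs σ₀ ε y) ^ (1 / 3 : ℝ) ≤
          h * (C₀ * (σs⁻¹ ^ (1 / 3 : ℝ) + 1)) := by gcongr
      have h5 : h * G ≤ 2 * Real.pi * G * C₁ * I := by
        calc h * G ≤ 2 * Real.pi * G * 1 := by rw [mul_one]; gcongr
          _ ≤ 2 * Real.pi * G * (C₁ * I) := by gcongr
          _ = _ := by ring
      rw [hG, mul_add] at h5
      linarith
    -- on a short interval both `b - lam` and `b'` are doubling
    · rcases h0.eq_or_lt with rfl | h0
      · simp only [zero_mul, add_zero]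
        positivity
      have h1 := (hdoub₁ (shearJet b lam) (isFiniteType_shearJet hb hft lam)).1 a h h0 hlt.le y hy
      have h2 := (hdoub₂ _ hft).1 a h h0 (hlt.le.trans hh₁₂) y hy
      simp only [shearJet] at h1
      simp only [zero_add, iteratedDeriv_one] at h2
      have h3 : h * |b y - lam| ^ (1 / 2 : ℝ) ≤ C₁ * I := h1.trans (by gcongr)
      have h4 : h * (s * |deriv b y|) ^ (1 / 3 : ℝ) ≤ C₂ * I := by
        have h5 : ∫ x in a..(a + h), s ^ (1 / 3 : ℝ) * |deriv b x| ^ (1 / 3 : ℝ) ≤ I := by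
          refine hmono _ (continuous_const.mul (hdbc.abs.rpow_const
            fun _ => Or.inr (by norm_num))) fun x _ => ?_
          rw [← Real.mul_rpow hs.le (abs_nonneg _)]
          exact deriv_rpow_third_le_shearFreq hα lam x
        rw [intervalIntegral.integral_const_mul] at h5
        calc h * (s * |deriv b y|) ^ (1 / 3 : ℝ)
            = s ^ (1 / 3 : ℝ) * (h * |deriv b y| ^ (1 / 3 : ℝ)) := by
              rw [Real.mul_rpow hs.le (abs_nonneg _)]; ring
          _ ≤ s ^ (1 / 3 : ℝ) * (C₂ * ∫ x in a..(a + h), |deriv b x| ^ (1 / 3 : ℝ)) := by gcongr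
          _ = C₂ * (s ^ (1 / 3 : ℝ) * ∫ x in a..(a + h), |deriv b x| ^ (1 / 3 : ℝ)) := by ring
          _ ≤ _ := by gcongr
      have h6 : h * E ≤ I := hconst _ fun x hx => hEx x (by
        rw [abs_le]; constructor <;> linarith [hx.1, hx.2, hy.1, hy.2])
      have h7 : h * (s * regShear b σs σ₀ ε y) ^ (1 / 3 : ℝ) ≤ C₀ * (C₂ + 1) * I := by
        calc _ ≤ h * (C₀ * ((s * |deriv b y|) ^ (1 / 3 : ℝ) + E)) := by gcongr
          _ = C₀ * (h * (s * |deriv b y|) ^ (1 / 3 : ℝ) + h * E) := by ring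
          _ ≤ C₀ * (C₂ * I + I) := by gcongr
          _ = _ := by ring
      linarith
  · intro hle
    have h1 := hlong ((hh₁₂.trans hh₂σ).trans hle)
    have h2 : α ^ (1 / 2 : ℝ) ≤ σs⁻¹ * I := by
      rw [inv_mul_eq_div, le_div_iff₀ hσ]
      calc α ^ (1 / 2 : ℝ) * σs ≤ α ^ (1 / 2 : ℝ) * h := by gcongr
        _ ≤ I := by linarith
    linarith

lemma sqrt_mul_invLength_le_of_near {σ₀ ε α lam y z : ℝ} (hε : 0 < ε) (hα : 0 ≤ α)
    (hy : 0 ≤ regShear b σs σ₀ ε y) (hz : 0 ≤ regShear b σs σ₀ ε z) (h : torusDist y z < σs) :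
    Real.sqrt ε * invLength b σs σ₀ ε α lam y z ≤
      decayRate b σs σ₀ ε α lam y + decayRate b σs σ₀ ε α lam z := by
  have hs := Real.sqrt_pos.2 hε
  have e : ∀ B : ℝ, 0 ≤ B → (ε ^ (1 / 3 : ℝ) * B ^ (2 / 3 : ℝ)) ^ (1 / 2 : ℝ)
      = (Real.sqrt ε * B) ^ (1 / 3 : ℝ) := fun B hB => by
    rw [Real.sqrt_eq_rpow, Real.mul_rpow (by positivity) (by positivity),
      Real.mul_rpow (by positivity) hB, ← Real.rpow_mul hε.le, ← Real.rpow_mul hB,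
      ← Real.rpow_mul hε.le]
    norm_num
  have hadd : ∀ u v : ℝ, 0 ≤ u → 0 ≤ v →
      (u + v) ^ (1 / 2 : ℝ) ≤ u ^ (1 / 2 : ℝ) + v ^ (1 / 2 : ℝ) :=
    fun u v hu hv => Real.rpow_add_le_add_rpow hu hv (by norm_num) (by norm_num)
  unfold invLength decayRate
  rw [if_pos h, Real.sqrt_eq_rpow ε, mul_div_cancel₀ _ (by positivity), ← Real.sqrt_eq_rpow ε,
    ← e _ hy, ← e _ hz]
  set u := ε ^ (1 / 3 : ℝ) * regShear b σs σ₀ ε y ^ (2 / 3 : ℝ)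
  set v := ε ^ (1 / 3 : ℝ) * regShear b σs σ₀ ε z ^ (2 / 3 : ℝ)
  have hu : 0 ≤ u := by positivity
  have hv : 0 ≤ v := by positivity
  have h1 := hadd (α + u + v + |b y - lam|) |b z - lam| (by positivity) (by positivity)
  have h2 := hadd (α + u + v) |b y - lam| (by positivity) (by positivity)
  have h3 := hadd (α + u) v (by positivity) (by positivity)
  have h4 := hadd α u (by positivity) (by positivity)
  have : 0 ≤ α ^ (1 / 2 : ℝ) := by positivity
  linarith

lemma sqrt_mul_invLength_le_of_far {σ₀ ε α lam y z : ℝ} (hε : 0 < ε) (hα : 0 ≤ α)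
    (hσ : 0 ≤ σs) (hσ1 : σs ≤ 1) (h : ¬ torusDist y z < σs) :
    Real.sqrt ε * invLength b σs σ₀ ε α lam y z ≤ 1 + α ^ (1 / 2 : ℝ) := by
  unfold invLength
  rw [if_neg h, Real.sqrt_eq_rpow ε, mul_div_cancel₀ _ (by positivity)]
  have h1 := Real.rpow_add_le_add_rpow (p := 1 / 2) hα hσ (by norm_num) (by norm_num)
  have h2 : σs ^ (1 / 2 : ℝ) ≤ 1 := Real.rpow_le_one hσ hσ1 (by norm_num)
  linarith

/-- The exponent in the conclusion is at most a multiple of the integral of the frequency along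
either arc from `z` to `y`. Here `z + 2πj` is the representative of `z` that precedes `y`. -/
lemma exists_torusDist_mul_invLength_le (hb : ShearAssumption b σs N) :
    ∃ C : ℝ, 0 < C ∧ ∀ σ₀ ε α lam : ℝ, 0 < σ₀ → σ₀ ≤ 1 → 0 < ε → ε ≤ 1 → 0 ≤ α →
      ∀ (y z : ℝ) (j : ℤ), z + j * (2 * Real.pi) ≤ y → y ≤ z + j * (2 * Real.pi) + 2 * Real.pi →
        torusDist y z * (Real.sqrt ε * invLength b σs σ₀ ε α lam y z) ≤
          C * ∫ x in (z + j * (2 * Real.pi))..y, shearFreq b N ε α lam x ∧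
        torusDist y z * (Real.sqrt ε * invLength b σs σ₀ ε α lam y z) ≤
          C * ∫ x in y..(z + j * (2 * Real.pi) + 2 * Real.pi), shearFreq b N ε α lam x := by
  obtain ⟨C, hC, hmean⟩ := exists_mul_decayRate_le_integral hb
  obtain ⟨_, _, hpos⟩ := exists_regShear_rpow_le hb
  have hπ := Real.pi_pos
  refine ⟨2 * C + 2 * Real.pi * C, by positivity,
    fun σ₀ ε α lam hσ₀ hσ₀1 hε hε1 hα y z j hy1 hy2 => ?_⟩
  have hm := hmean σ₀ ε α lam hσ₀ hσ₀1 hε hε1 hα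
  have hBpos := fun y => (hpos σ₀ ε α lam y hσ₀ hσ₀1 hε hε1 hα).1
  have hper := shearFreq_periodic hb ε α lam
  set ρ := shearFreq b N ε α lam with hρ
  have htrans : ∀ (i : ℤ) (u v : ℝ),
      ∫ x in (u + i * (2 * Real.pi))..(v + i * (2 * Real.pi)), ρ x = ∫ x in u..v, ρ x := by
    intro i u v
    rw [← intervalIntegral.integral_comp_add_right]
    exact intervalIntegral.integral_congr fun x _ => hper.int_mul i x
  have hd0 : 0 ≤ torusDist y z := norm_nonneg _
  have hd1 : torusDist y z ≤ y - (z + j * (2 * Real.pi)) := by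
    have := torusDist_le y z j
    rwa [abs_of_nonneg (by linarith), sub_sub] at this
  have hd2 : torusDist y z ≤ z + j * (2 * Real.pi) + 2 * Real.pi - y := by
    have := torusDist_le y z (j + 1)
    push_cast at this
    rw [abs_of_nonpos (by linarith)] at this
    linarith
  set d := torusDist y z with hd
  set h := y - (z + j * (2 * Real.pi)) with hh
  have e1 : z + j * (2 * Real.pi) + h = y := by rw [hh]; ring
  have e2 : y + (2 * Real.pi - h) = z + j * (2 * Real.pi) + 2 * Real.pi := by rw [hh]; ring
  have hI : ∀ u v, u ≤ v → 0 ≤ ∫ x in u..v, ρ x := fun u v huv =>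
    intervalIntegral.integral_nonneg huv fun x _ => shearFreq_nonneg hα x
  have hI1 := hI _ _ hy1
  have hI2 := hI _ _ hy2
  have hrate0 : ∀ y, 0 ≤ decayRate b σs σ₀ ε α lam y := fun y => by
    have := hBpos y
    unfold decayRate; positivity
  by_cases hfar : d < σs
  · have hnear := sqrt_mul_invLength_le_of_near (lam := lam) hε hα (hBpos y).le (hBpos z).le hfar
    have key : d * (Real.sqrt ε * invLength b σs σ₀ ε α lam y z) ≤
        d * decayRate b σs σ₀ ε α lam y + d * decayRate b σs σ₀ ε α lam z := by
      rw [← mul_add]; gcongr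
    have y1 := (hm (z + j * (2 * Real.pi)) h (by linarith) (by linarith)).1 y
      ⟨hy1, by rw [e1]⟩
    have z1 := (hm z h (by linarith) (by linarith)).1 z ⟨le_rfl, by linarith⟩
    rw [← htrans j z (z + h), show z + h + j * (2 * Real.pi) = y by linarith] at z1
    rw [e1] at y1
    have y2 := (hm y (2 * Real.pi - h) (by linarith) (by linarith)).1 y
      ⟨le_rfl, by linarith⟩
    have z2 := (hm (z - (2 * Real.pi - h)) (2 * Real.pi - h) (by linarith) (by linarith)).1 z
      ⟨by linarith, by linarith⟩
    rw [← htrans (j + 1)] at z2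
    push_cast at z2
    rw [show z - (2 * Real.pi - h) + (j + 1) * (2 * Real.pi) = y by linarith,
      show z - (2 * Real.pi - h) + (2 * Real.pi - h) + (j + 1) * (2 * Real.pi)
        = z + j * (2 * Real.pi) + 2 * Real.pi by ring] at z2
    rw [e2] at y2
    have hle : ∀ r k, 0 ≤ r → d ≤ k → d * r ≤ k * r := fun r k hr hk => by gcongr
    have a1 := hle _ _ (hrate0 y) hd1
    have a2 := hle _ _ (hrate0 z) hd1
    have a3 := hle _ (2 * Real.pi - h) (hrate0 y) (by linarith)
    have a4 := hle _ (2 * Real.pi - h) (hrate0 z) (by linarith)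
    have p1 : 0 ≤ 2 * Real.pi * C * ∫ x in (z + j * (2 * Real.pi))..y, ρ x := by positivity
    have p2 : 0 ≤ 2 * Real.pi * C *
      ∫ x in y..(z + j * (2 * Real.pi) + 2 * Real.pi), ρ x := by positivity
    constructor <;> linarith
  · have hF := sqrt_mul_invLength_le_of_far (b := b) (σ₀ := σ₀) (lam := lam) (y := y) (z := z)
      hε hα hb.pos.le hb.lt_one.le hfar
    rw [not_lt] at hfar
    have y1 := (hm (z + j * (2 * Real.pi)) h (by linarith) (by linarith)).2 (by linarith)
    have y2 := (hm y (2 * Real.pi - h) (by linarith) (by linarith)).2 (by linarith)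
    rw [e1] at y1
    rw [e2] at y2
    have key : d * (Real.sqrt ε * invLength b σs σ₀ ε α lam y z) ≤
        2 * Real.pi * (1 + α ^ (1 / 2 : ℝ)) := by
      calc _ ≤ d * (1 + α ^ (1 / 2 : ℝ)) := by gcongr
        _ ≤ _ := by gcongr; linarith
    have q1 := mul_le_mul_of_nonneg_left y1 (by positivity : 0 ≤ 2 * Real.pi)
    have q2 := mul_le_mul_of_nonneg_left y2 (by positivity : 0 ≤ 2 * Real.pi)
    have p1 : 0 ≤ 2 * C * ∫ x in (z + j * (2 * Real.pi))..y, ρ x := by positivity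
    have p2 : 0 ≤ 2 * C *
      ∫ x in y..(z + j * (2 * Real.pi) + 2 * Real.pi), ρ x := by positivity
    constructor <;> linarith

end Rate

/-! ### Pointwise bounds from the energy estimate -/

/-- A nonnegative function on an interval of length at least `1` exceeds its integral by at most its
total variation, for which `∫ g` is an upper bound. -/
lemma le_integral_add_integral {z T : ℝ} (hzT : 1 ≤ T - z) {f f' g : ℝ → ℝ}
    (hf : ∀ y ∈ Icc z T, HasDerivAt f (f' y) y) (hfc : Continuous f)
    (hf' : ContinuousOn f' (Icc z T)) (hg : Continuous g) (hf0 : ∀ y, 0 ≤ f y) (hg0 : ∀ y, 0 ≤ g y)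
    (hfg : ∀ y ∈ Icc z T, |f' y| ≤ g y) {x : ℝ} (hx : x ∈ Icc z T) :
    f x ≤ (∫ y in z..T, f y) + ∫ y in z..T, g y := by
  have hle : z ≤ T := by linarith
  obtain ⟨y, hy, hmin⟩ :=
    isCompact_Icc.exists_isMinOn ⟨z, le_rfl, hle⟩ hfc.continuousOn (s := Icc z T)
  have h1 : f y ≤ ∫ y in z..T, f y := by
    have h2 := intervalIntegral.integral_mono_on (μ := MeasureTheory.volume) hle
      (continuous_const.intervalIntegrable _ _)
      (hfc.intervalIntegrable _ _) fun t ht => hmin ht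
    simp only [intervalIntegral.integral_const, smul_eq_mul] at h2
    refine le_trans ?_ h2
    exact le_mul_of_one_le_left (hf0 y) hzT
  have key : ∀ u ∈ Icc z T, ∀ v ∈ Icc z T, u ≤ v → |f v - f u| ≤ ∫ y in z..T, g y := by
    intro u hu v hv huv
    have hsub : Icc u v ⊆ Icc z T := Icc_subset_Icc hu.1 hv.2
    rw [← intervalIntegral.integral_eq_sub_of_hasDerivAt (f := f) (f' := f')
      (fun t ht => hf t (hsub (by rwa [uIcc_of_le huv] at ht)))
      ((hf'.mono hsub).intervalIntegrable_of_Icc huv)]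
    refine (intervalIntegral.abs_integral_le_integral_abs huv).trans ?_
    refine (intervalIntegral.integral_mono_on huv
      ((hf'.mono hsub).abs.intervalIntegrable_of_Icc huv) (hg.intervalIntegrable _ _)
      fun t ht => hfg t (hsub ht)).trans ?_
    exact intervalIntegral.integral_mono_interval hu.1 huv hv.2
      (Filter.Eventually.of_forall hg0) (hg.intervalIntegrable _ _)
  rcases le_total y x with h | h
  · have := (abs_le.1 (key y hy x hx h)).2
    linarith
  · have := (abs_le.1 (key x hx y hy h)).1
    linarith

/-- The quadratic quantities of a complex solution, in terms of its real and imaginary parts. -/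
lemma exists_isQuadraticData {b : ℝ → ℝ} {s a lam z T : ℝ} {K k dk : ℝ → ℂ} (hs : 0 < s)
    (hK : ∀ y ∈ Icc z T, k y = K y) (hzT : z ≤ T) (hKT : K T = K z)
    (hk : ∀ y, HasDerivAt k (dk y) y)
    (hdk : ∀ y, HasDerivAt dk (((a : ℂ) + Complex.I * ((b y - lam : ℝ) : ℂ)) / ((s ^ 2 : ℝ) : ℂ)
      * K y) y)
    (hjump : dk T - dk z = 1 / ((s ^ 2 : ℝ) : ℂ)) :
    ∃ Jr Ji : ℝ → ℝ,
      IsQuadraticData (fun y => b y - lam) s a z T ‖K z‖ (fun y => ‖k y‖ ^ 2) (fun y => ‖dk y‖ ^ 2)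
        Jr Ji ∧
      ∀ y ∈ Icc z T, HasDerivAt (fun y => ‖dk y‖ ^ 2)
        (2 / s ^ 2 * (a * Jr y + (b y - lam) * Ji y)) y := by
  have hre : ∀ {f : ℝ → ℂ} {f' : ℂ} {y : ℝ}, HasDerivAt f f' y →
      HasDerivAt (fun y => (f y).re) f'.re y := fun h =>
    (Complex.reCLM.hasFDerivAt.comp_hasDerivAt _ h)
  have him : ∀ {f : ℝ → ℂ} {f' : ℂ} {y : ℝ}, HasDerivAt f f' y →
      HasDerivAt (fun y => (f y).im) f'.im y := fun h =>
    (Complex.imCLM.hasFDerivAt.comp_hasDerivAt _ h)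
  have hkc : Continuous k := continuous_iff_continuousAt.2 fun y => (hk y).continuousAt
  have hdkc : Continuous dk := continuous_iff_continuousAt.2 fun y => (hdk y).continuousAt
  have hn : ∀ w : ℂ, ‖w‖ ^ 2 = w.re ^ 2 + w.im ^ 2 := fun w => by
    rw [← Complex.normSq_eq_norm_sq, Complex.normSq_apply]; ring
  have hV : ∀ y ∈ Icc z T, (((a : ℂ) + Complex.I * ((b y - lam : ℝ) : ℂ)) / ((s ^ 2 : ℝ) : ℂ)
      * K y).re = (a * (k y).re - (b y - lam) * (k y).im) / s ^ 2 ∧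
      (((a : ℂ) + Complex.I * ((b y - lam : ℝ) : ℂ)) / ((s ^ 2 : ℝ) : ℂ)
      * K y).im = (a * (k y).im + (b y - lam) * (k y).re) / s ^ 2 := by
    intro y hy
    rw [← hK y hy, div_mul_eq_mul_div, Complex.div_ofReal_re, Complex.div_ofReal_im]
    simp only [Complex.mul_re, Complex.mul_im, Complex.add_re, Complex.add_im, Complex.ofReal_re,
      Complex.ofReal_im, Complex.I_re, Complex.I_im]
    constructor <;> ring
  have hkT : k T = k z := by rw [hK T ⟨hzT, le_rfl⟩, hK z ⟨le_rfl, hzT⟩, hKT]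
  have hj : dk T = dk z + ((1 / s ^ 2 : ℝ) : ℂ) := by
    rw [← sub_eq_iff_eq_add', hjump]; push_cast; rfl
  have hs2 : s ^ 2 ≠ 0 := by positivity
  refine ⟨fun y => (k y).re * (dk y).re + (k y).im * (dk y).im,
    fun y => (k y).re * (dk y).im - (k y).im * (dk y).re, ⟨fun y => by positivity,
    fun y => by positivity, by fun_prop, by fun_prop, ?_, ?_, fun y => ?_, fun y => ?_,
    fun y _ => ?_, fun y hy => ?_, fun y hy => ?_, by rw [hkT], ?_, ?_⟩, fun y hy => ?_⟩
  · exact ((Complex.continuous_re.comp hkc).mul (Complex.continuous_re.comp hdkc)).add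
      ((Complex.continuous_im.comp hkc).mul (Complex.continuous_im.comp hdkc))
  · exact ((Complex.continuous_re.comp hkc).mul (Complex.continuous_im.comp hdkc)).sub
      ((Complex.continuous_im.comp hkc).mul (Complex.continuous_re.comp hdkc))
  · simp only [hn]
    nlinarith [sq_nonneg ((k y).re * (dk y).im - (k y).im * (dk y).re)]
  · simp only [hn]
    nlinarith [sq_nonneg ((k y).re * (dk y).re + (k y).im * (dk y).im)]
  · simp only [hn]
    exact (((hre (hk y)).fun_pow 2).add ((him (hk y)).fun_pow 2)).congr_deriv (by
      push_cast; ring)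
  · refine (((hre (hk y)).fun_mul (hre (hdk y))).add
      ((him (hk y)).fun_mul (him (hdk y)))).congr_deriv ?_
    rw [(hV y hy).1, (hV y hy).2, hn, hn]
    field_simp
    ring
  · refine (((hre (hk y)).fun_mul (him (hdk y))).sub
      ((him (hk y)).fun_mul (hre (hdk y)))).congr_deriv ?_
    rw [(hV y hy).1, (hV y hy).2, hn]
    field_simp
    ring
  · have e : s ^ 2 * (((k T).re * (dk T).re + (k T).im * (dk T).im)
        - ((k z).re * (dk z).re + (k z).im * (dk z).im)) = (K z).re := by
      rw [hkT, hj, ← hK z ⟨le_rfl, hzT⟩, Complex.add_re, Complex.add_im, Complex.ofReal_re,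
        Complex.ofReal_im]
      field_simp
      ring
    simp only [e]
    exact Complex.abs_re_le_norm _
  · have e : s ^ 2 * (((k T).re * (dk T).im - (k T).im * (dk T).re)
        - ((k z).re * (dk z).im - (k z).im * (dk z).re)) = -(K z).im := by
      rw [hkT, hj, ← hK z ⟨le_rfl, hzT⟩, Complex.add_re, Complex.add_im, Complex.ofReal_re,
        Complex.ofReal_im]
      field_simp
      ring
    simp only [e, abs_neg]
    exact Complex.abs_im_le_norm _
  · simp only [hn]
    refine (((hre (hdk y)).fun_pow 2).add ((him (hdk y)).fun_pow 2)).congr_deriv ?_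
    rw [(hV y hy).1, (hV y hy).2]
    push_cast
    field_simp
    ring

/-- The logarithm of the Agmon weight: with `D y = ∫ x in z..y, ρ x`, it is a multiple of
`D y * (D T - D y) / (s * D T)`, hence comparable with the smaller of the `ρ`-lengths of `[z, y]`
and `[y, T]` in units of `s`. It is smooth on `[z, T]` and vanishes at both end points. -/
noncomputable def agmonExponent (c s z T : ℝ) (ρ : ℝ → ℝ) (y : ℝ) : ℝ :=
  c * (((∫ x in z..y, ρ x) * ((∫ x in z..T, ρ x) - ∫ x in z..y, ρ x)) / (s * ∫ x in z..T, ρ x))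

lemma min_le_agmonExponent {c s z T : ℝ} {ρ : ℝ → ℝ} (hc : 0 ≤ c) (hs : 0 < s) (hzT : z < T)
    (hρ : Continuous ρ) (hρ0 : ∀ y, 0 < ρ y) {y A : ℝ} (hy : y ∈ Icc z T)
    (h1 : A ≤ ∫ x in z..y, ρ x) (h2 : A ≤ ∫ x in y..T, ρ x) :
    c / 2 * (A / s) ≤ agmonExponent c s z T ρ y := by
  have hadd : (∫ x in z..y, ρ x) + (∫ x in y..T, ρ x) = ∫ x in z..T, ρ x :=
    intervalIntegral.integral_add_adjacent_intervals (hρ.intervalIntegrable _ _)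
      (hρ.intervalIntegrable _ _)
  have hT : 0 < ∫ x in z..T, ρ x :=
    intervalIntegral.intervalIntegral_pos_of_pos (hρ.intervalIntegrable _ _) hρ0 hzT
  have p1 : 0 ≤ ∫ x in z..y, ρ x := intervalIntegral.integral_nonneg hy.1 fun x _ => (hρ0 x).le
  have p2 : 0 ≤ ∫ x in y..T, ρ x := intervalIntegral.integral_nonneg hy.2 fun x _ => (hρ0 x).le
  unfold agmonExponent
  rw [← hadd] at hT ⊢
  set u := ∫ x in z..y, ρ x
  set v := ∫ x in y..T, ρ x
  rw [add_sub_cancel_left, div_mul_eq_mul_div, mul_div_assoc]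
  refine mul_le_mul_of_nonneg_left ?_ hc
  rw [div_div, div_le_div_iff₀ (by positivity) (by positivity)]
  have : A * (u + v) ≤ 2 * (u * v) := by nlinarith
  calc A * (s * (u + v)) = s * (A * (u + v)) := by ring
    _ ≤ s * (2 * (u * v)) := by gcongr
    _ = _ := by ring

set_option maxHeartbeats 1000000 in
/-- The energy estimate with the weights `exp (2 ψ) / r` and `exp (2 ψ) * r`, where `ψ` is the Agmon
exponent and `r` is comparable with `ρ` but varies even more slowly, controls
`∫ |(exp (2 ψ) |k|²)'|` and `∫ |(exp (2 ψ) |k'|²)'|`, hence `k` and `k'` pointwise. -/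
theorem exists_pointwise_bounds (n : ℕ) (C : ℝ) (hC : 1 ≤ C) :
    ∃ δ : ℝ, 0 < δ ∧ ∀ m c : ℝ, 1 ≤ m → 0 < c → ∃ G : ℝ, 0 < G ∧
      ∀ (β : ℕ → ℝ → ℝ) (α s τ z T M : ℝ) (ρ ρ' r r' N P Jr Ji : ℝ → ℝ),
      IsFrequency n β α s C ρ ρ' →
      (∀ k ≤ n, ∀ y, HasDerivAt (β k) (β (k + 1) y) y) → Continuous (β (n + 1)) →
      0 < s → 0 ≤ α → 1 ≤ T - z → (∀ k ≤ n, β k T = β k z) → ρ T = ρ z →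
      IsQuadraticData (β 0) s (α - τ) z T M N P Jr Ji → N z = M ^ 2 → 0 ≤ M →
      (∀ y ∈ Icc z T, HasDerivAt P (2 / s ^ 2 * ((α - τ) * Jr y + β 0 y * Ji y)) y) →
      0 ≤ τ → (∀ y, τ ≤ δ * ρ y ^ 2) → (∀ y, α ≤ ρ y ^ 2) → (∀ y, c * s ≤ ρ y) →
      (∀ y, HasDerivAt r (r' y) y) → Continuous r' → r T = r z →
      (∀ y, ρ y ≤ r y) → (∀ y, r y ≤ m * ρ y) → (∀ y, s * |r' y| ≤ δ / 2 * (ρ y * r y)) →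
      M ≤ G / (s * ρ z) ∧ ∀ y ∈ Icc z T,
        Real.exp (2 * agmonExponent (δ / 4) s z T ρ y) * N y ≤ (G / (s * ρ z)) ^ 2 ∧
        Real.exp (2 * agmonExponent (δ / 4) s z T ρ y) * P y ≤ (G / s ^ 2) ^ 2 := by
  obtain ⟨δ, C', hδ, hC', henergy⟩ := exists_energy_estimate n C hC
  refine ⟨δ, hδ, fun m c hm hc => ?_⟩
  have hm0 : 0 < m := one_pos.trans_le hm
  set G₁ : ℝ := (c⁻¹ + (δ / 2 + 1)) * m * C' with hG₁
  set G₂ : ℝ := (c⁻¹ + (δ / 2 + (1 + δ + C))) * C' * m * G₁ with hG₂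
  have hG₁0 : 0 < G₁ := by positivity
  have hG₂0 : 0 < G₂ := by positivity
  refine ⟨G₁ + 1 + G₂, by positivity, ?_⟩
  intro β α s τ z T M ρ ρ' r r' N P Jr Ji h hβ hβc hs hα hzT hβe hρe hd hNz hM hPd hτ0 hτ hαρ hcs
    hr hr'c hre hρr hrm hr'
  have hle : z ≤ T := by linarith
  have hlt : z < T := by linarith
  have hρc := h.continuous
  have hNc := hd.n_cont
  have hPc := hd.p_cont
  have hJrc := hd.Jr_cont
  have hJic := hd.Ji_cont
  have hrc : Continuous r := continuous_iff_continuousAt.2 fun y => (hr y).continuousAt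
  have hr0 : ∀ y, 0 < r y := fun y => (h.pos y).trans_le (hρr y)
  set D : ℝ → ℝ := fun y => ∫ x in z..y, ρ x with hD
  have hDd : ∀ y, HasDerivAt D (ρ y) y := fun y => (hρc.integral_hasStrictDerivAt z y).hasDerivAt
  have hDc : Continuous D := continuous_iff_continuousAt.2 fun y => (hDd y).continuousAt
  have hDT : 0 < D T :=
    intervalIntegral.intervalIntegral_pos_of_pos (hρc.intervalIntegrable _ _) h.pos hlt
  have hDz : D z = 0 := by simp [hD]
  have hDmem : ∀ y ∈ Icc z T, 0 ≤ D y ∧ D y ≤ D T := fun y hy => by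
    refine ⟨intervalIntegral.integral_nonneg hy.1 fun x _ => (h.pos x).le, ?_⟩
    exact intervalIntegral.integral_mono_interval le_rfl hy.1 hy.2
      (Filter.Eventually.of_forall fun x => (h.pos x).le) (hρc.intervalIntegrable _ _)
  set ψ : ℝ → ℝ := agmonExponent (δ / 4) s z T ρ with hψ
  have hψe : ψ = fun y => δ / 4 * ((D y * (D T - D y)) / (s * D T)) := rfl
  set ψ' : ℝ → ℝ := fun y => δ / 4 * ((ρ y * (D T - D y) + D y * (0 - ρ y)) / (s * D T)) with hψ'
  have hψd : ∀ y, HasDerivAt ψ (ψ' y) y := fun y => by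
    rw [hψe]
    exact (((hDd y).mul ((hasDerivAt_const y (D T)).sub (hDd y))).div_const _).const_mul _
  have hψc : Continuous ψ := continuous_iff_continuousAt.2 fun y => (hψd y).continuousAt
  have hψ'c : Continuous ψ' := by
    rw [hψ']
    have := hDT.ne'
    fun_prop
  have hψz : ψ z = 0 := by simp [hψe, hDz]
  have hψT : ψ T = 0 := by simp [hψe]
  have hψ'le : ∀ y ∈ Icc z T, s * |ψ' y| ≤ δ / 4 * ρ y := fun y hy => by
    obtain ⟨h1, h2⟩ := hDmem y hy
    have h3 : |D T - 2 * D y| ≤ D T := by rw [abs_le]; constructor <;> linarith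
    have e : ψ' y = δ / 4 * (ρ y * (D T - 2 * D y) / (s * D T)) := by rw [hψ']; ring
    have hp := h.pos y
    rw [e, abs_mul, abs_of_pos (by positivity : 0 < δ / 4), abs_div, abs_mul, abs_of_pos hp,
      abs_of_pos (by positivity : 0 < s * D T)]
    calc s * (δ / 4 * (ρ y * |D T - 2 * D y| / (s * D T)))
        ≤ s * (δ / 4 * (ρ y * D T / (s * D T))) := by gcongr
      _ = δ / 4 * ρ y := by field_simp
  set E : ℝ → ℝ := fun y => Real.exp (2 * ψ y) with hE
  have hE0 : ∀ y, 0 < E y := fun y => Real.exp_pos _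
  have hEd : ∀ y, HasDerivAt E (E y * (2 * ψ' y)) y := fun y => ((hψd y).const_mul 2).exp
  have hEc : Continuous E := by fun_prop
  have hEz : E z = 1 := by simp [hE, hψz]
  have hET : E T = 1 := by simp [hE, hψT]
  -- the energy estimate with the weight `E * v`
  have hweight : ∀ v v' : ℝ → ℝ, (∀ y, 0 < v y) → (∀ y, HasDerivAt v (v' y) y) → Continuous v' →
      v T = v z → (∀ y, s * |v' y| ≤ δ / 2 * (ρ y * v y)) →
      ∫ y in z..T, E y * v y * (ρ y ^ 2 * N y + s ^ 2 * P y) ≤ C' * (v z * M) := by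
    intro v v' hv hvd hv'c hve hv'
    have hvc : Continuous v := continuous_iff_continuousAt.2 fun y => (hvd y).continuousAt
    have := henergy β α s τ z T M ρ ρ' N P Jr Ji (fun y => E y * v y)
      (fun y => E y * (2 * ψ' y) * v y + E y * v' y) h hβ hβc hs hα hle hβe hρe hd
      (fun y => mul_pos (hE0 y) (hv y)) (fun y => (hEd y).mul (hvd y)) (by fun_prop)
      (by simp only [hEz, hET, hve]) (fun y hy => ?_) hτ
    · simpa only [hEz, one_mul] using this
    · have hEy := hE0 y
      have hvy := hv y
      calc s * |E y * (2 * ψ' y) * v y + E y * v' y|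
          ≤ s * (|E y * (2 * ψ' y) * v y| + |E y * v' y|) := by gcongr; exact abs_add_le _ _
        _ = E y * (2 * (s * |ψ' y|) * v y + s * |v' y|) := by
          simp only [abs_mul, abs_of_pos hEy, abs_of_pos hvy, abs_two]; ring
        _ ≤ E y * (2 * (δ / 4 * ρ y) * v y + δ / 2 * (ρ y * v y)) := by
          have := hψ'le y hy
          have := hv' y
          gcongr
        _ = _ := by ring
  set e : ℝ → ℝ := fun y => ρ y ^ 2 * N y + s ^ 2 * P y with he
  have hec : Continuous e := by fun_prop
  have hN0 := hd.n_nonneg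
  have hP0 := hd.p_nonneg
  have hNe : ∀ y, ρ y ^ 2 * N y ≤ e y := fun y =>
    le_add_of_nonneg_right (mul_nonneg (by positivity) (hP0 y))
  have hPe : ∀ y, s ^ 2 * P y ≤ e y := fun y =>
    le_add_of_nonneg_left (mul_nonneg (by positivity) (hN0 y))
  have he0 : ∀ y, 0 ≤ e y := fun y => (mul_nonneg (by positivity) (hN0 y)).trans (hNe y)
  have hJr : ∀ y, 2 * (ρ y * s * |Jr y|) ≤ e y := fun y => by
    have := mul_mul_abs_le_of_sq_le (r := ρ y) (s := s) (hN0 y) (hP0 y) (hd.Jr_sq_le y) one_pos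
    rw [inv_one, one_mul, one_mul] at this
    linarith
  have hJi : ∀ y, 2 * (ρ y * s * |Ji y|) ≤ e y := fun y => by
    have := mul_mul_abs_le_of_sq_le (r := ρ y) (s := s) (hN0 y) (hP0 y) (hd.Ji_sq_le y) one_pos
    rw [inv_one, one_mul, one_mul] at this
    linarith
  have hci : 0 < c⁻¹ := inv_pos.2 hc
  have hsρ : ∀ y, s ≤ c⁻¹ * ρ y := fun y => by
    rw [inv_mul_eq_div, le_div_iff₀ hc, mul_comm]; exact hcs y
  -- the bound for `N`
  have hI₁ := hweight (fun y => (r y)⁻¹) (fun y => -r' y / r y ^ 2) (fun y => inv_pos.2 (hr0 y))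
    (fun y => (hr y).inv (hr0 y).ne')
    (hr'c.neg.div (hrc.pow 2) fun y => pow_ne_zero _ (hr0 y).ne') (by simp only [hre])
    (fun y => by
      have hry := hr0 y
      rw [abs_div, abs_neg, abs_of_pos (pow_pos hry 2), ← mul_div_assoc,
        div_le_iff₀ (pow_pos hry 2)]
      calc s * |r' y| ≤ δ / 2 * (ρ y * r y) := hr' y
        _ = _ := by field_simp)
  have hNbound : ∀ x ∈ Icc z T, E x * N x ≤ G₁ * M / (s * ρ z) := by
    have hwc : Continuous fun y => E y * (r y)⁻¹ * e y :=
      (hEc.mul (hrc.inv₀ fun y => (hr0 y).ne')).mul hec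
    have hw0 : ∀ y, 0 ≤ E y * (r y)⁻¹ * e y := fun y =>
      mul_nonneg (mul_nonneg (hE0 y).le (inv_nonneg.2 (hr0 y).le)) (he0 y)
    have hρi : ∀ y, (ρ y)⁻¹ ≤ m * (r y)⁻¹ := fun y => by
      have := h.pos y
      have := hr0 y
      rw [← div_eq_mul_inv, inv_eq_one_div, div_le_div_iff₀ (by positivity) (by positivity),
        one_mul]
      exact hrm y
    intro x hx
    have h1 := le_integral_add_integral (z := z) (T := T) hzT (f := fun y => E y * N y)
      (f' := fun y => E y * (2 * ψ' y) * N y + E y * (2 * Jr y))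
      (g := fun y => (δ / 2 + 1) * m / s * (E y * (r y)⁻¹ * e y))
      (fun y hy => (hEd y).mul (hd.n_deriv y hy)) (by fun_prop) (by fun_prop) (by fun_prop)
      (fun y => mul_nonneg (hE0 y).le (hN0 y)) (fun y => mul_nonneg (by positivity) (hw0 y))
      (fun y hy => ?_) hx
    · have h2 : ∫ y in z..T, E y * N y ≤ ∫ y in z..T, c⁻¹ * m / s * (E y * (r y)⁻¹ * e y) := by
        refine intervalIntegral.integral_mono_on hle
          (Continuous.intervalIntegrable (by fun_prop) _ _)
          (Continuous.intervalIntegrable (by fun_prop) _ _) fun y _ => ?_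
        have hEy := hE0 y
        have hp := h.pos y
        have hey := he0 y
        have hNy := hN0 y
        have hρci : (ρ y)⁻¹ ≤ c⁻¹ / s := by
          rw [inv_le_comm₀ hp (by positivity), inv_div, div_inv_eq_mul, mul_comm]
          exact hcs y
        have := hNe y
        have := hρi y
        calc E y * N y = E y * (ρ y)⁻¹ * (ρ y)⁻¹ * (ρ y ^ 2 * N y) := by field_simp
          _ ≤ E y * (ρ y)⁻¹ * (c⁻¹ / s) * e y := by
            gcongr
          _ ≤ E y * (m * (r y)⁻¹) * (c⁻¹ / s) * e y := by
            gcongr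
          _ = _ := by ring
      simp only [intervalIntegral.integral_const_mul] at h1 h2
      calc E x * N x ≤ _ := h1
        _ ≤ c⁻¹ * m / s * (C' * ((r z)⁻¹ * M)) + (δ / 2 + 1) * m / s * (C' * ((r z)⁻¹ * M)) := by
          refine add_le_add (h2.trans ?_) ?_ <;> gcongr
        _ = G₁ * M / s * (r z)⁻¹ := by rw [hG₁]; ring
        _ ≤ G₁ * M / s * (ρ z)⁻¹ := by
          have := h.pos z
          gcongr
          exact hρr z
        _ = _ := by rw [div_mul_eq_mul_div, ← div_eq_mul_inv, div_div, mul_comm (ρ z)]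
    · have hEy := hE0 y
      have hp := h.pos y
      have hey := he0 y
      have hNy := hN0 y
      have hry := hr0 y
      have key : s * |E y * (2 * ψ' y) * N y + E y * (2 * Jr y)| ≤
          (δ / 2 + 1) * m * (E y * (r y)⁻¹ * e y) := by
        calc _ ≤ s * (|E y * (2 * ψ' y) * N y| + |E y * (2 * Jr y)|) := by
              gcongr; exact abs_add_le _ _
          _ = E y * (2 * (s * |ψ' y|) * N y + (ρ y)⁻¹ * (2 * (ρ y * s * |Jr y|))) := by
            simp only [abs_mul, abs_of_pos hEy, abs_of_nonneg hNy, abs_two]; field_simp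
          _ ≤ E y * (2 * (δ / 4 * ρ y) * N y + (ρ y)⁻¹ * e y) := by
            have := hψ'le y hy
            have := hJr y
            gcongr
          _ = E y * (ρ y)⁻¹ * (δ / 2 * (ρ y ^ 2 * N y) + e y) := by field_simp; ring
          _ ≤ E y * (m * (r y)⁻¹) * (δ / 2 * e y + e y) := by
            have := hNe y
            have := hρi y
            gcongr
          _ = _ := by ring
      rw [div_mul_eq_mul_div, le_div_iff₀ hs, mul_comm]
      exact key
  have hM₁ : M ≤ G₁ / (s * ρ z) := by
    have hp := h.pos z
    have h1 := hNbound z ⟨le_rfl, hle⟩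
    rw [hEz, one_mul, hNz] at h1
    rcases hM.eq_or_lt with h0 | h0
    · rw [← h0]; positivity
    · rw [mul_div_right_comm, sq] at h1
      exact le_of_mul_le_mul_right h1 h0
  -- the bound for `P`
  have hI₂ := hweight r r' hr0 hr hr'c hre hr'
  have hPbound : ∀ x ∈ Icc z T, E x * P x ≤ G₂ / s ^ 4 := by
    have hwc : Continuous fun y => E y * r y * e y := (hEc.mul hrc).mul hec
    have hw0 : ∀ y, 0 ≤ E y * r y * e y := fun y =>
      mul_nonneg (mul_nonneg (hE0 y).le (hr0 y).le) (he0 y)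
    have hI₃ : ∫ y in z..T, E y * r y * e y ≤ C' * m * G₁ / s := by
      have hp := h.pos z
      calc _ ≤ C' * (r z * M) := hI₂
        _ ≤ C' * ((m * ρ z) * (G₁ / (s * ρ z))) := by
          gcongr
          exact hrm z
        _ = _ := by field_simp
    intro x hx
    have h1 := le_integral_add_integral (z := z) (T := T) hzT (f := fun y => E y * P y)
      (f' := fun y => E y * (2 * ψ' y) * P y
        + E y * (2 / s ^ 2 * ((α - τ) * Jr y + β 0 y * Ji y)))
      (g := fun y => (δ / 2 + (1 + δ + C)) / s ^ 3 * (E y * r y * e y))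
      (fun y hy => (hEd y).mul (hPd y hy)) (by fun_prop) ?_ (by fun_prop)
      (fun y => mul_nonneg (hE0 y).le (hP0 y)) (fun y => mul_nonneg (by positivity) (hw0 y))
      (fun y hy => ?_) hx
    · have h2 : ∫ y in z..T, E y * P y ≤ ∫ y in z..T, c⁻¹ / s ^ 3 * (E y * r y * e y) := by
        refine intervalIntegral.integral_mono_on hle
          (Continuous.intervalIntegrable (by fun_prop) _ _)
          (Continuous.intervalIntegrable (by fun_prop) _ _) fun y _ => ?_
        have hEy := hE0 y
        have hp := h.pos y
        have hey := he0 y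
        have hry := hr0 y
        have hPy := hP0 y
        calc E y * P y = E y * s * (s ^ 2 * P y) / s ^ 3 := by field_simp
          _ ≤ E y * (c⁻¹ * r y) * e y / s ^ 3 := by
            have := hPe y
            have : s ≤ c⁻¹ * r y := (hsρ y).trans (by gcongr; exact hρr y)
            gcongr
          _ = _ := by ring
      simp only [intervalIntegral.integral_const_mul] at h1 h2
      calc E x * P x ≤ _ := h1
        _ ≤ c⁻¹ / s ^ 3 * (C' * m * G₁ / s)
            + (δ / 2 + (1 + δ + C)) / s ^ 3 * (C' * m * G₁ / s) := by
          refine add_le_add (h2.trans ?_) ?_ <;> gcongr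
        _ = _ := by rw [hG₂]; field_simp
    · have : Continuous (β 0) :=
        continuous_iff_continuousAt.2 fun y => (hβ 0 (by omega) y).continuousAt
      fun_prop
    · have hEy := hE0 y
      have hp := h.pos y
      have hey := he0 y
      have hPy := hP0 y
      have hry := hr0 y
      have hβ0 : |β 0 y| ≤ C * ρ y ^ 2 := by simpa using h.jet_le 0 (by omega) y
      have hατ : |α - τ| ≤ (1 + δ) * ρ y ^ 2 := by
        have := hτ y
        have := hαρ y
        have : 0 ≤ δ * ρ y ^ 2 := by positivity
        rw [abs_le, add_mul, one_mul]; constructor <;> linarith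
      have key : s ^ 3 * |E y * (2 * ψ' y) * P y
          + E y * (2 / s ^ 2 * ((α - τ) * Jr y + β 0 y * Ji y))| ≤
          (δ / 2 + (1 + δ + C)) * (E y * r y * e y) := by
        have h3 : |(α - τ) * Jr y + β 0 y * Ji y| ≤
            (1 + δ) * ρ y ^ 2 * |Jr y| + C * ρ y ^ 2 * |Ji y| := by
          refine (abs_add_le _ _).trans ?_
          rw [abs_mul, abs_mul]
          gcongr
        calc _ ≤ s ^ 3 * (|E y * (2 * ψ' y) * P y|
              + |E y * (2 / s ^ 2 * ((α - τ) * Jr y + β 0 y * Ji y))|) := by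
              gcongr; exact abs_add_le _ _
          _ = E y * (2 * (s * |ψ' y|) * (s ^ 2 * P y)
              + 2 * s * |(α - τ) * Jr y + β 0 y * Ji y|) := by
            rw [abs_mul (E y) (2 / s ^ 2 * _), abs_mul (2 / s ^ 2), abs_mul _ (P y),
              abs_mul (E y), abs_mul 2, abs_of_pos hEy, abs_of_nonneg hPy, abs_two,
              abs_of_pos (by positivity : 0 < 2 / s ^ 2)]
            field_simp
          _ ≤ E y * (2 * (δ / 4 * ρ y) * e y
              + 2 * s * ((1 + δ) * ρ y ^ 2 * |Jr y| + C * ρ y ^ 2 * |Ji y|)) := by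
            have := hψ'le y hy
            have := hPe y
            gcongr
          _ = E y * ρ y * (δ / 2 * e y + ((1 + δ) * (2 * (ρ y * s * |Jr y|))
              + C * (2 * (ρ y * s * |Ji y|)))) := by ring
          _ ≤ E y * r y * (δ / 2 * e y + ((1 + δ) * e y + C * e y)) := by
            have := hJr y
            have := hJi y
            have := hρr y
            gcongr
          _ = _ := by ring
      rw [div_mul_eq_mul_div (δ / 2 + (1 + δ + C)), le_div_iff₀ (by positivity), mul_comm]
      exact key
  have hpz := h.pos z
  refine ⟨hM₁.trans (by gcongr; linarith), fun y hy => ⟨?_, ?_⟩⟩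
  · calc E y * N y ≤ G₁ * M / (s * ρ z) := hNbound y hy
      _ ≤ G₁ * (G₁ / (s * ρ z)) / (s * ρ z) := by gcongr
      _ = (G₁ / (s * ρ z)) ^ 2 := by ring
      _ ≤ _ := by gcongr; linarith
  · calc E y * P y ≤ G₂ / s ^ 4 := hPbound y hy
      _ ≤ (G₁ + 1 + G₂) ^ 2 / s ^ 4 := by gcongr; nlinarith
      _ = _ := by rw [div_pow, ← pow_mul]

/-! ### The bounds for the fundamental solution -/

lemma le_mul_exp_neg_of_exp_mul_sq_le {t x X : ℝ} (hX : 0 ≤ X)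
    (h : Real.exp (2 * t) * x ^ 2 ≤ X ^ 2) : x ≤ X * Real.exp (-t) := by
  have h1 : (Real.exp t * x) ^ 2 ≤ X ^ 2 := by
    rwa [mul_pow, ← Real.exp_nat_mul]
  have h2 := (le_abs_self _).trans (abs_le_of_sq_le_sq h1 hX)
  rw [Real.exp_neg, ← div_eq_mul_inv, le_div_iff₀ (Real.exp_pos t), mul_comm]
  exact h2

lemma IsFundamentalSolution.translate {b : ℝ → ℝ} {N : ℕ} {σ₀ ε α lam z : ℝ} {K : ℝ → ℂ}
    (h : IsFundamentalSolution b N σ₀ ε α lam z K) (j : ℤ) :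
    IsFundamentalSolution b N σ₀ ε α lam (z + j * (2 * Real.pi)) K :=
  ⟨h.1, h.2.1, fun φ hφ hp => by rw [h.2.2 φ hφ hp, hp.int_mul j z]⟩

section FundamentalSolution

variable {b : ℝ → ℝ} {σs : ℝ} {N : ℕ}

/-- The Agmon bounds on one period, in terms of the frequency. -/
theorem exists_agmon_bounds (hb : ShearAssumption b σs N) :
    ∃ δ G ε₀ σ₀ : ℝ, 0 < δ ∧ 0 < G ∧ 0 < ε₀ ∧ ε₀ ≤ 1 ∧ 0 < σ₀ ∧ σ₀ < 1 ∧
      ∀ ε α lam z : ℝ, 0 < ε → ε < ε₀ → 0 ≤ α →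
        (∀ y, 0 < shearFreq b N ε α lam y) ∧
        ∀ K : ℝ → ℂ, IsFundamentalSolution b N σ₀ ε α lam z K →
          ‖K z‖ ≤ G / (Real.sqrt ε * shearFreq b N ε α lam z) ∧
          ∀ y ∈ Icc z (z + 2 * Real.pi),
            ‖K y‖ ≤ G / (Real.sqrt ε * shearFreq b N ε α lam z) * Real.exp
              (-agmonExponent δ (Real.sqrt ε) z (z + 2 * Real.pi) (shearFreq b N ε α lam) y) ∧
            (y ∈ Ioo z (z + 2 * Real.pi) → DifferentiableAt ℝ K y ∧
              ‖deriv K y‖ ≤ G * ε⁻¹ * Real.exp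
                (-agmonExponent δ (Real.sqrt ε) z (z + 2 * Real.pi)
                  (shearFreq b N ε α lam) y)) := by
  obtain ⟨c, hc, hc1, hfin⟩ := hb.exists_isFiniteType
  obtain ⟨C, hC, hfreq⟩ := exists_isFrequency_freq (N + 1) c σs⁻¹ hc hc1 (inv_nonneg.2 hb.pos.le)
  obtain ⟨δ, hδ, hbd⟩ := exists_pointwise_bounds (N + 1) C hC
  have hC0 : 0 < C := one_pos.trans_le hC
  -- `m` is so large that `(m ^ (N + 1)) ^ (1 / (N + 3))` is at most `q * m`
  set q : ℝ := min 1 (δ / (2 * C)) with hq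
  have hq0 : 0 < q := lt_min one_pos (by positivity)
  have hq1 : q ≤ 1 := min_le_left _ _
  have hCq : C * q ≤ δ / 2 := by
    calc C * q ≤ C * (δ / (2 * C)) := by gcongr; exact min_le_right _ _
      _ = δ / 2 := by field_simp
  set m : ℝ := (q ^ (N + 3))⁻¹ with hm
  have hm1 : 1 ≤ m := (one_le_inv₀ (pow_pos hq0 _)).2 (pow_le_one₀ hq0.le hq1)
  have hm0 : 0 < m := one_pos.trans_le hm1
  have hmq : m ^ (N + 1) ≤ (q * m) ^ (N + 3) := by
    calc m ^ (N + 1) ≤ m ^ (N + 2) := pow_le_pow_right₀ hm1 (by omega)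
      _ = (q ^ (N + 3) * m) * m ^ (N + 2) := by
        rw [hm, mul_inv_cancel₀ (pow_pos hq0 _).ne', one_mul]
      _ = _ := by ring
  obtain ⟨G, hG, hbd⟩ := hbd m c hm1 hc
  refine ⟨δ / 4, G, 1 / m ^ 2, min (1 / 2) (δ * c ^ 2), by positivity, hG, by positivity,
    (div_le_one (by positivity)).2 (one_le_pow₀ hm1), lt_min (by norm_num) (by positivity),
    (min_le_left _ _).trans_lt (by norm_num), fun ε α lam z hε hεm hα => ?_⟩
  -- `ρ² ≥ c² ε ^ ((N + 1) / (N + 3))`, so this `σ₀` makes the unstable term at most `δ ρ²`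
  set σ₀ : ℝ := min (1 / 2) (δ * c ^ 2) with hσ₀
  have hσ₀0 : 0 < σ₀ := lt_min (by norm_num) (by positivity)
  set s := Real.sqrt ε with hsd
  have hs : 0 < s := Real.sqrt_pos.2 hε
  have hs2 : s ^ 2 = ε := Real.sq_sqrt hε.le
  have hms : m * s ≤ 1 := by
    refine (sq_le_one_iff₀ (by positivity)).1 ?_
    rw [mul_pow, hs2]
    calc m ^ 2 * ε ≤ m ^ 2 * (1 / m ^ 2) := by gcongr
      _ = 1 := by field_simp
  have hs1 : s ≤ 1 := (le_mul_of_one_le_left hs.le hm1).trans hms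
  have hβ := isFiniteType_shearJet hb hfin lam
  have hβ0 := hasDerivAt_shearJet_zero hb lam
  have hF := hfreq (shearJet b lam) α s hα hs hs1 hβ0 hfin
  have hFm := hfreq (shearJet b lam) α (m * s) hα (by positivity) hms hβ0 hfin
  have hnd : ∀ y, ∃ k ≤ N + 1, c ≤ |shearJet b lam k y| := fun y => by
    obtain ⟨k, hk, h⟩ := hfin.nondegenerate y
    exact ⟨k + 1, hk, h⟩
  have hρdef : shearFreq b N ε α lam = freq (N + 1) (shearJet b lam) α s := rfl
  rw [hρdef]
  set ρ := freq (N + 1) (shearJet b lam) α s with hρ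
  set r := freq (N + 1) (shearJet b lam) α (m * s) with hr
  -- `r` satisfies the frequency bounds at the length `m * s`, where the gain `m` beats its growth
  have hrq : ∀ y, r y ≤ q * m * ρ y := fun y => by
    have hp := hF.pos y
    refine le_of_pow_le_pow_left₀ (n := N + 3) (by omega) (by positivity) ?_
    rw [mul_pow (q * m)]
    exact (freq_pow_le_freq_mul (n := N + 1) hα hm1 y).trans (by gcongr)
  have hrm : ∀ y, r y ≤ m * ρ y := fun y => by
    have hp := hF.pos y
    calc r y ≤ q * m * ρ y := hrq y
      _ ≤ 1 * m * ρ y := by gcongr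
      _ = m * ρ y := by rw [one_mul]
  have hr' : ∀ y, s * |freqDeriv (N + 1) (shearJet b lam) α (m * s) y| ≤
      δ / 2 * (ρ y * r y) := fun y => by
    have hp := hF.pos y
    have hrp := hFm.pos y
    refine le_of_mul_le_mul_left ?_ hm0
    calc m * (s * |freqDeriv (N + 1) (shearJet b lam) α (m * s) y|)
        = m * s * |freqDeriv (N + 1) (shearJet b lam) α (m * s) y| := by ring
      _ ≤ C * r y ^ 2 := hFm.slow y
      _ = C * r y * r y := by ring
      _ ≤ C * (q * m * ρ y) * r y := by gcongr; exact hrq y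
      _ = C * q * (m * (ρ y * r y)) := by ring
      _ ≤ δ / 2 * (m * (ρ y * r y)) := by gcongr
      _ = _ := by ring
  refine ⟨hF.pos, fun K hK => ?_⟩
  obtain ⟨k, dk, hkK, hkd, hdkd, hjump⟩ := hK.exists_classical hε
    (by simpa using hb.continuous_iteratedDeriv (k := 0) (by omega)) hb.periodic
  set τ : ℝ := σ₀ * ε ^ (((N : ℝ) + 1) / ((N : ℝ) + 3)) with hτ
  have hτ0 : 0 ≤ τ := by positivity
  have hτρ : ∀ y, τ ≤ δ * ρ y ^ 2 := fun y => by
    have hp := hF.pos y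
    have h1 : c ^ 2 * ε ^ (((N : ℝ) + 1) / ((N : ℝ) + 3)) ≤ ρ y ^ 2 := by
      refine le_of_pow_le_pow_left₀ (n := N + 3) (by omega) (by positivity) ?_
      have h2 : (ε ^ (((N : ℝ) + 1) / ((N : ℝ) + 3))) ^ (N + 3) = ε ^ (N + 1) := by
        rw [← Real.rpow_natCast, ← Real.rpow_mul hε.le, ← Real.rpow_natCast]
        congr 1
        push_cast
        field_simp
      have h3 := le_freq_pow (n := N + 1) hα hs hs1 hc hc1 le_rfl (hnd y)
      rw [mul_pow, h2, ← hs2]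
      calc (c ^ 2) ^ (N + 3) * (s ^ 2) ^ (N + 1) = (c ^ (N + 1 + 2) * s ^ (N + 1)) ^ 2 := by ring
        _ ≤ (ρ y ^ (N + 1 + 2)) ^ 2 := by gcongr
        _ = _ := by ring
    calc τ ≤ δ * c ^ 2 * ε ^ (((N : ℝ) + 1) / ((N : ℝ) + 3)) := by
          rw [hτ]; gcongr; exact min_le_right _ _
      _ = δ * (c ^ 2 * ε ^ (((N : ℝ) + 1) / ((N : ℝ) + 3))) := by ring
      _ ≤ _ := by gcongr
  have hzT : z ≤ z + 2 * Real.pi := by linarith [Real.pi_pos]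
  obtain ⟨Jr, Ji, hd, hPd⟩ := exists_isQuadraticData (b := b) (a := α - τ) (lam := lam) hs hkK hzT
    (hK.2.1 z) hkd (fun y => by rw [hs2]; exact hdkd y) (by rw [hs2]; exact hjump)
  obtain ⟨hM, hNP⟩ := hbd (shearJet b lam) α s τ z (z + 2 * Real.pi) ‖K z‖ ρ _ r _ _ _ Jr Ji hF
    (fun k hk => hβ.hasDerivAt k (by omega)) hβ.continuous_top hs hα
    (by linarith [Real.pi_gt_three]) (fun k _ => shearJet_periodic hb lam k z)
    (shearFreq_periodic hb ε α lam z) hd (by rw [hkK z ⟨le_rfl, hzT⟩]) (norm_nonneg _) hPd hτ0 hτρ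
    (le_freq_sq hα) (fun y => mul_le_freq hα hs hs1 hc hc1 (hnd y)) hFm.hasDerivAt
    hFm.continuous_deriv (freq_periodic (fun k _ => shearJet_periodic hb lam k) z)
    (freq_le_freq_mul hα hs.le hm1) hrm hr'
  have hpz := hF.pos z
  refine ⟨hM, fun y hy => ⟨?_, fun hy' => ?_⟩⟩
  · rw [← hkK y hy]
    exact le_mul_exp_neg_of_exp_mul_sq_le (by positivity) (hNP y hy).1
  · have hder : HasDerivAt K (dk y) y := by
      refine (hkd y).congr_of_eventuallyEq ?_
      filter_upwards [Ioo_mem_nhds hy'.1 hy'.2] with x hx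
      exact (hkK x ⟨hx.1.le, hx.2.le⟩).symm
    refine ⟨hder.differentiableAt, ?_⟩
    rw [hder.deriv, ← hs2, ← div_eq_mul_inv]
    exact le_mul_exp_neg_of_exp_mul_sq_le (by positivity) (hNP y hy).2

/-- The maximal size of the fundamental solution in terms of the frequency is at most a multiple of
the amplitude. -/
lemma exists_inv_mul_shearFreq_le_amplitude (hb : ShearAssumption b σs N) :
    ∃ C : ℝ, 0 < C ∧ ∀ σ₀ ε α lam z : ℝ, 0 < σ₀ → σ₀ ≤ 1 → 0 < ε → ε ≤ 1 → 0 ≤ α →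
      0 < shearFreq b N ε α lam z →
      (Real.sqrt ε * shearFreq b N ε α lam z)⁻¹ ≤ C * amplitude b σs σ₀ ε α lam z := by
  obtain ⟨C, hC, h⟩ := exists_decayRate_le hb
  refine ⟨C, hC, fun σ₀ ε α lam z hσ₀ hσ₀1 hε hε1 hα hρ => ?_⟩
  obtain ⟨hB, hrate⟩ := h σ₀ ε α lam z hσ₀ hσ₀1 hε hε1 hα
  have hs : 0 < Real.sqrt ε := Real.sqrt_pos.2 hε
  set B := regShear b σs σ₀ ε z with hBd
  have e1 : (ε ^ (1 / 3 : ℝ) * B ^ (2 / 3 : ℝ)) ^ (1 / 2 : ℝ) =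
      (Real.sqrt ε * B) ^ (1 / 3 : ℝ) := by
    rw [Real.sqrt_eq_rpow, Real.mul_rpow (by positivity) (by positivity),
      Real.mul_rpow (by positivity) (by positivity), ← Real.rpow_mul hε.le, ← Real.rpow_mul hB.le,
      ← Real.rpow_mul hε.le]
    norm_num
  have h0 : 0 < α + ε ^ (1 / 3 : ℝ) * B ^ (2 / 3 : ℝ) + |b z - lam| := by positivity
  have h1 : (α + ε ^ (1 / 3 : ℝ) * B ^ (2 / 3 : ℝ) + |b z - lam|) ^ (1 / 2 : ℝ) ≤
      C * shearFreq b N ε α lam z := by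
    refine le_trans ?_ hrate
    unfold decayRate
    rw [← hBd, ← e1]
    refine (Real.rpow_add_le_add_rpow (by positivity) (abs_nonneg _) (by norm_num)
      (by norm_num)).trans ?_
    gcongr
    exact Real.rpow_add_le_add_rpow hα (by positivity) (by norm_num) (by norm_num)
  have e2 : ε ^ (-(1 / 2) : ℝ) = (Real.sqrt ε)⁻¹ := by
    rw [Real.rpow_neg hε.le, Real.sqrt_eq_rpow]
  rw [amplitude, ← hBd, e2, mul_inv, div_eq_mul_inv]
  have h2 := inv_anti₀ (Real.rpow_pos_of_pos h0 (1 / 2)) h1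
  calc _ = C * ((Real.sqrt ε)⁻¹ * (C * shearFreq b N ε α lam z)⁻¹) := by field_simp
    _ ≤ _ := by gcongr

end FundamentalSolution

theorem proposition2p1 (N : ℕ) (σs : ℝ) (b : ℝ → ℝ) (hb : ShearAssumption b σs N) :
    ∃ ε₀ c₀ σ₀ C : ℝ, 0 < ε₀ ∧ 0 < c₀ ∧ 0 < σ₀ ∧ σ₀ < 1 ∧ 0 < C ∧
      ∀ ε α lam z : ℝ, 0 < ε → ε < ε₀ → 0 ≤ α →
        ∀ K : ℝ → ℂ, IsFundamentalSolution b N σ₀ ε α lam z K →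
          ‖K z‖ ≤ C * amplitude b σs σ₀ ε α lam z ∧
          (∀ y : ℝ, ‖K y‖ ≤ C * amplitude b σs σ₀ ε α lam z *
            Real.exp (-(c₀ * (torusDist y z * invLength b σs σ₀ ε α lam y z)))) ∧
          (∀ y : ℝ, torusDist y z ≠ 0 →
            DifferentiableAt ℝ K y ∧
            ‖deriv K y‖ ≤ C * ε⁻¹ *
              Real.exp (-(c₀ * (torusDist y z * invLength b σs σ₀ ε α lam y z)))) := by
  obtain ⟨δ, G, ε₀, σ₀, hδ, hG, hε₀, hε₀1, hσ₀, hσ₀1, hagmon⟩ := exists_agmon_bounds hb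
  obtain ⟨CA, hCA, hamp⟩ := exists_inv_mul_shearFreq_le_amplitude hb
  obtain ⟨CD, hCD, hdist⟩ := exists_torusDist_mul_invLength_le hb
  refine ⟨ε₀, δ / (2 * CD), σ₀, G * CA + G, hε₀, by positivity, hσ₀, hσ₀1, by positivity,
    fun ε α lam z hε hεε₀ hα K hK => ?_⟩
  have hε1 : ε ≤ 1 := hεε₀.le.trans hε₀1
  have hs : 0 < Real.sqrt ε := Real.sqrt_pos.2 hε
  have hρ := (hagmon ε α lam z hε hεε₀ hα).1
  have hρz := hρ z
  have hA := hamp σ₀ ε α lam z hσ₀ hσ₀1.le hε hε1 hα hρz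
  have hA0 : 0 ≤ amplitude b σs σ₀ ε α lam z :=
    nonneg_of_mul_nonneg_right ((by positivity : (0 : ℝ) ≤ _).trans hA) hCA
  have hGA : G / (Real.sqrt ε * shearFreq b N ε α lam z) ≤
      (G * CA + G) * amplitude b σs σ₀ ε α lam z := by
    rw [div_eq_mul_inv]
    calc _ ≤ G * (CA * amplitude b σs σ₀ ε α lam z) := by gcongr
      _ ≤ _ := by nlinarith [mul_nonneg hG.le hA0]
  -- the translate of `z` at which the period containing `y` starts
  have hcell : ∀ y : ℝ, ∃ j : ℤ,
      y ∈ Icc (z + j * (2 * Real.pi)) (z + j * (2 * Real.pi) + 2 * Real.pi) := by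
    intro y
    have hpi := Real.two_pi_pos
    refine ⟨⌊(y - z) / (2 * Real.pi)⌋, ?_, ?_⟩
    · have := (le_div_iff₀ hpi).1 (Int.floor_le ((y - z) / (2 * Real.pi)))
      linarith
    · have := (div_lt_iff₀ hpi).1 (Int.lt_floor_add_one ((y - z) / (2 * Real.pi)))
      linarith
  have hexp : ∀ (y : ℝ) (j : ℤ),
      y ∈ Icc (z + j * (2 * Real.pi)) (z + j * (2 * Real.pi) + 2 * Real.pi) →
      Real.exp (-agmonExponent δ (Real.sqrt ε) (z + j * (2 * Real.pi))
        (z + j * (2 * Real.pi) + 2 * Real.pi) (shearFreq b N ε α lam) y) ≤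
      Real.exp (-(δ / (2 * CD) * (torusDist y z * invLength b σs σ₀ ε α lam y z))) := by
    intro y j hy
    obtain ⟨h1, h2⟩ := hdist σ₀ ε α lam hσ₀ hσ₀1.le hε hε1 hα y z j hy.1 hy.2
    rw [mul_comm CD, ← div_le_iff₀ hCD] at h1 h2
    have := min_le_agmonExponent hδ.le hs (by linarith [Real.pi_pos]) (continuous_shearFreq hb) hρ
      hy h1 h2
    refine Real.exp_le_exp.2 (neg_le_neg (le_trans (le_of_eq ?_) this))
    field_simp
  refine ⟨(hagmon ε α lam z hε hεε₀ hα |>.2 K hK).1.trans hGA, fun y => ?_, fun y hyz => ?_⟩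
  · obtain ⟨j, hj⟩ := hcell y
    have h1 := (((hagmon ε α lam _ hε hεε₀ hα).2 K (hK.translate j)).2 y hj).1
    rw [(shearFreq_periodic hb ε α lam).int_mul j z] at h1
    calc _ ≤ _ := h1
      _ ≤ _ := by
        gcongr ?_ * ?_
        exact hexp y j hj
  · obtain ⟨j, hj⟩ := hcell y
    have hne : ∀ i : ℤ, y ≠ z + i * (2 * Real.pi) := fun i hi => hyz <| by
      refine le_antisymm ((torusDist_le y z i).trans ?_) (norm_nonneg _)
      rw [hi]; simp
    have hj' : y ∈ Ioo (z + j * (2 * Real.pi)) (z + j * (2 * Real.pi) + 2 * Real.pi) := by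
      refine ⟨lt_of_le_of_ne hj.1 (hne j).symm, lt_of_le_of_ne hj.2 fun h => hne (j + 1) ?_⟩
      rw [h]; push_cast; ring
    obtain ⟨hdiff, h1⟩ := (((hagmon ε α lam _ hε hεε₀ hα).2 K (hK.translate j)).2 y hj).2 hj'
    refine ⟨hdiff, h1.trans ?_⟩
    gcongr ?_ * _ * ?_
    · exact le_add_of_nonneg_left (by positivity)
    · exact hexp y j hj
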